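/- Let $(X,\omega)$ be a compact Kähler manifold of dimension $n$, and let $\Lambda_\omega$ be the contraction with $\omega$ (normalized by $\Lambda_\omega\omega=n$). For a smooth function $f$ put $\Delta f=\sqrt{-1}\Lambda_\omega d d^c f=2\sqrt{-1}\Lambda_\omega\partial\bar\partial f$, where $d^c=\bar\partial-\partial$. Let $E$ be a smooth complex vector bundle of rank $r$ over $X$, and let $D$ be a non-Hermitian Yang–Mills (NHYM) connection on $E$, i.e. a smooth connection whose curvature $F_D$ is of type $(1,1)$ and satisfies $\sqrt{-1}\Lambda_\omega F_D=\lambda\,\mathrm{Id}_E$ for some constant $\lambda\in\mathbb R$. For a smooth Hermitian metric $H$ on $E$, write uniquely $D=D_H+\psi_H$ with $D_H$ an $H$-unitary connection and $\psi_H\in\Omega^1(\mathrm{End}\,E)$ self-adjoint with respect to $H$; let $\bar\partial_H$ be the $(0,1)$-part of $D_H$ and $\psi_H^{1,0}$ the $(1,0)$-part of $\psi_H$; and define the pseudo-curvature $$G_H=(\bar\partial_H+\psi_H^{1,0})^2 .$$ For $A\in\mathrm{End}(E)$ put $|A|_H=(\mathrm{tr}(AA^{*_H}))^{1/2}$. Let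 $H$ and $K$ be two smooth Hermitian metrics on the NHYM bundle $(E,D)$, and let $h=K^{-1}H$ be the positive endomorphism defined by $H(\cdot,\cdot)=K(h(\cdot),\cdot)$. Then, at every point of $X$, $$\Delta\log(\mathrm{tr}\,h+\mathrm{tr}\,h^{-1})\ \ge\ -4\,|\sqrt{-1}\Lambda_\omega G_H|_H-4\,|\sqrt{-1}\Lambda_\omega G_K|_K .$$ Moreover, $$\sup_X|\log h|_K\ \le\ C_1\,\|\log h\|_{L^1(X,K)}+C_2,\qquad \|\log h\|_{L^1(X,K)}=\int_X|\log h|_K\,\frac{\omega^n}{n!},$$ where $C_1,C_2$ are positive constants depending only on $(X,\omega)$ and on upper bounds for $\sup_X|\sqrt{-1}\Lambda_\omega G_H|_H$ and $\sup_X|\sqrt{-1}\Lambda_\omega G_K|_K$. -/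

import Mathlib

open Bundle Set MeasureTheory
open scoped Manifold ContDiff Matrix ComplexOrder

noncomputable section

namespace NHYM

/-! ### Complex manifolds

A complex manifold of dimension `n` is a space `X` charted on `ℂⁿ = (Fin n → ℂ)` whose transition
maps are holomorphic: `[ChartedSpace (Fin n → ℂ) X] [IsManifold 𝓘(ℂ, Fin n → ℂ) ω X]`. -/

/-- The smooth manifold underlying a complex manifold. -/
instance isManifold_real {n : ℕ} {X : Type*} [TopologicalSpace X] [ChartedSpace (Fin n → ℂ) X]
    [IsManifold 𝓘(ℂ, Fin n → ℂ) ω X] : IsManifold 𝓘(ℝ, Fin n → ℂ) ∞ X := by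
  apply isManifold_of_contDiffOn
  intro e e' he he'
  have h := ((contDiffGroupoid ω 𝓘(ℂ, Fin n → ℂ)).compatible he he')
  rw [contDiffGroupoid, mem_groupoid_of_pregroupoid] at h
  exact (h.1.restrict_scalars ℝ).of_le le_top

section Base

variable {n : ℕ} {X : Type*} [TopologicalSpace X] [ChartedSpace (Fin n → ℂ) X]

/-- The complex structure `J` of a tangent space. By definition `TangentSpace 𝓘(ℝ, Fin n → ℂ) x` is
`ℂⁿ`, identified with the tangent space through the (holomorphic) preferred chart at `x`. -/
def tangentJ (x : X) (u : TangentSpace 𝓘(ℝ, Fin n → ℂ) x) : TangentSpace 𝓘(ℝ, Fin n → ℂ) x :=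
  (Complex.I • (show Fin n → ℂ from u) : Fin n → ℂ)

/-- The tangent vector of `X` at `φ⁻¹ y` whose coordinates in the chart `φ` are `u`. -/
def chartVec (φ : OpenPartialHomeomorph X (Fin n → ℂ)) (y u : Fin n → ℂ) :
    TangentSpace 𝓘(ℝ, Fin n → ℂ) (φ.symm y) :=
  mfderiv 𝓘(ℝ, Fin n → ℂ) 𝓘(ℝ, Fin n → ℂ) φ.symm y u

/-- The expression in the chart `φ` of a field of real bilinear forms on the tangent spaces. -/
def chartForm
    (w : ∀ x : X, TangentSpace 𝓘(ℝ, Fin n → ℂ) x →ₗ[ℝ] TangentSpace 𝓘(ℝ, Fin n → ℂ) x →ₗ[ℝ] ℝ)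
    (φ : OpenPartialHomeomorph X (Fin n → ℂ)) (y u v : Fin n → ℂ) : ℝ :=
  w (φ.symm y) (chartVec φ y u) (chartVec φ y v)

variable (n X) in
/-- A Kähler form: a smooth closed positive real `(1,1)`-form on the complex manifold `X`. -/
structure KahlerForm where
  form : ∀ x : X,
    TangentSpace 𝓘(ℝ, Fin n → ℂ) x →ₗ[ℝ] TangentSpace 𝓘(ℝ, Fin n → ℂ) x →ₗ[ℝ] ℝ
  alternating : ∀ x u, form x u u = 0
  type_one_one : ∀ x u v, form x (tangentJ x u) (tangentJ x v) = form x u v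
  positive : ∀ x u, u ≠ 0 → 0 < form x u (tangentJ x u)
  smooth : ∀ φ ∈ atlas (Fin n → ℂ) X, ∀ u v,
    ContDiffOn ℝ ∞ (fun y => chartForm form φ y u v) φ.target
  closed : ∀ φ ∈ atlas (Fin n → ℂ) X, ∀ y ∈ φ.target, ∀ u v w,
    fderiv ℝ (fun z => chartForm form φ z v w) y u
      + fderiv ℝ (fun z => chartForm form φ z w u) y v
      + fderiv ℝ (fun z => chartForm form φ z u v) y w = 0

/-- The component `α(∂/∂z_j, ∂/∂z̄_k)` of a real bilinear form `α` on `ℂⁿ` with complex values,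
where `∂/∂z_j = (e_j - i J e_j)/2` and `∂/∂z̄_k = (e_k + i J e_k)/2`. -/
def comp11 {W : Type*} [AddCommGroup W] [Module ℂ W]
    (α : (Fin n → ℂ) → (Fin n → ℂ) → W) (j k : Fin n) : W :=
  let e : Fin n → ℂ := Pi.single j 1
  let f : Fin n → ℂ := Pi.single k 1
  (1 / 4 : ℂ) • (α e f + α (Complex.I • e) (Complex.I • f)
    + Complex.I • α e (Complex.I • f) - Complex.I • α (Complex.I • e) f)

/-- The matrix `g = (g_{j k̄})` with `ω = i ∑ g_{j k̄} dz_j ∧ dz̄_k` in the chart `φ`, at the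
point with coordinates `y`. -/
def KahlerForm.matrix (ω₀ : KahlerForm n X) (φ : OpenPartialHomeomorph X (Fin n → ℂ))
    (y : Fin n → ℂ) : Matrix (Fin n) (Fin n) ℂ :=
  Matrix.of fun j k => -Complex.I * comp11 (fun u v => (chartForm ω₀.form φ y u v : ℂ)) j k

/-- `√-1 Λ_ω α` for a 2-form `α` given at the point with coordinates `y` in the chart `φ`, that is
`∑ g^{j k̄} α_{j k̄}`. It depends only on the `(1,1)`-part of `α`, and `Λ_ω ω = n`. -/
def KahlerForm.iLambda {W : Type*} [AddCommGroup W] [Module ℂ W] (ω₀ : KahlerForm n X)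
    (φ : OpenPartialHomeomorph X (Fin n → ℂ)) (y : Fin n → ℂ)
    (α : (Fin n → ℂ) → (Fin n → ℂ) → W) : W :=
  ∑ j, ∑ k, ((ω₀.matrix φ y)⁻¹ k j) • comp11 α j k

/-- The 2-form `d dᶜ f` on an open set of `ℂⁿ`, where `dᶜ = ∂̄ - ∂`, so `(dᶜ f)(v) = i df(J v)`. -/
def ddc (f : (Fin n → ℂ) → ℝ) (y u v : Fin n → ℂ) : ℂ :=
  Complex.I * ((fderiv ℝ (fun z => fderiv ℝ f z (Complex.I • v)) y u
    - fderiv ℝ (fun z => fderiv ℝ f z (Complex.I • u)) y v : ℝ) : ℂ)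

/-- The Laplacian `Δ f = √-1 Λ_ω d dᶜ f = 2 √-1 Λ_ω ∂ ∂̄ f` of `(X, ω)`, which is
`2 ∑ g^{j k̄} ∂²f/∂z_j∂z̄_k` in holomorphic coordinates. -/
def KahlerForm.laplacian (ω₀ : KahlerForm n X) (f : X → ℝ) (x : X) : ℝ :=
  let φ := chartAt (Fin n → ℂ) x
  (ω₀.iLambda φ (φ x) (ddc (fun z => f (φ.symm z)) (φ x))).re

variable (n) in
theorem exists_chart_cover (X : Type*) [TopologicalSpace X] [ChartedSpace (Fin n → ℂ) X]
    [CompactSpace X] :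
    ∃ t : Finset X, ∀ p : X, ∃ x ∈ t, p ∈ (chartAt (Fin n → ℂ) x).source := by
  obtain ⟨t, ht⟩ := isCompact_univ.elim_finite_subcover
    (fun x : X => (chartAt (Fin n → ℂ) x).source)
    (fun x => (chartAt (Fin n → ℂ) x).open_source)
    (fun p _ => mem_iUnion.2 ⟨p, mem_chart_source _ p⟩)
  refine ⟨t, fun p => ?_⟩
  simpa using ht (mem_univ p)

/-- The measure of `ωⁿ/n! = 2ⁿ det(g_{j k̄}) dLeb` on the domain of the chart `φ`. -/
def KahlerForm.chartVolume [MeasurableSpace X] (ω₀ : KahlerForm n X)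
    (φ : OpenPartialHomeomorph X (Fin n → ℂ)) : Measure X :=
  (((volume : Measure (Fin n → ℂ)).restrict φ.target).withDensity
    (fun y => ENNReal.ofReal (2 ^ n * (ω₀.matrix φ y).det.re))).map φ.symm

open Classical in
/-- The volume measure `ωⁿ/n!` of a compact `X`, glued from its expressions in finitely many charts
that cover `X`: a point is counted with weight `1/N`, where `N` is the number of these charts whose
domain contains it. -/
def KahlerForm.volumeMeasure [CompactSpace X] [MeasurableSpace X] (ω₀ : KahlerForm n X) :
    Measure X :=
  let t := (exists_chart_cover n X).choose
  ∑ x ∈ t, (ω₀.chartVolume (chartAt (Fin n → ℂ) x)).withDensity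
    (fun p => ((t.filter fun z => p ∈ (chartAt (Fin n → ℂ) z).source).card : ENNReal)⁻¹)

end Base

/-! ### Fibrewise linear algebra

Metrics are given by their Gram matrices `M i j = ⟨σ_i, σ_j⟩` in a frame (conjugate-linear in the
first slot), endomorphisms by their matrices in the same frame. -/

section LinAlg

variable {r : ℕ}

/-- The endomorphism `h = K⁻¹ H` defined by `H(s, t) = K(h s, t)`. -/
def relEnd (K H : Matrix (Fin r) (Fin r) ℂ) : Matrix (Fin r) (Fin r) ℂ := K⁻¹ * H

/-- The adjoint of `A` with respect to the metric `M`. -/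
def adj (M A : Matrix (Fin r) (Fin r) ℂ) : Matrix (Fin r) (Fin r) ℂ := M⁻¹ * Aᴴ * M

/-- The norm `|A|_M = (tr (A A^{*M}))^{1/2}` of an endomorphism. -/
def endNorm (M A : Matrix (Fin r) (Fin r) ℂ) : ℝ := Real.sqrt (A * adj M A).trace.re

/-- The logarithm of `h = K⁻¹ H`, that is the `K`-self-adjoint `s` with `H = K eˢ`. -/
def logRelEnd (K H : Matrix (Fin r) (Fin r) ℂ) : Matrix (Fin r) (Fin r) ℂ :=
  let S := cfc Real.sqrt K
  S⁻¹ * cfc Real.log (S⁻¹ * H * S⁻¹) * S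

/-- The self-adjoint part `ψ_H(u)` of a connection in a frame, from the Gram matrix `M`, the value
`A` of the connection form on a tangent vector `u`, and the derivative `dM` of `M` along `u`. -/
def selfAdjPart (M A dM : Matrix (Fin r) (Fin r) ℂ) : Matrix (Fin r) (Fin r) ℂ :=
  (1 / 2 : ℂ) • (A + adj M A - M⁻¹ * dM)

/-- `selfAdjPart` is the unique `ψ` which is self-adjoint and makes `d + (A - ψ)` a unitary
connection, i.e. `d⟨s, t⟩ = ⟨(d + A - ψ) s, t⟩ + ⟨s, (d + A - ψ) t⟩`. -/
theorem eq_selfAdjPart_iff {M A dM P : Matrix (Fin r) (Fin r) ℂ} (hM : M.PosDef)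
    (hdM : dM.IsHermitian) :
    (adj M P = P ∧ dM = (A - P)ᴴ * M + M * (A - P)) ↔ P = selfAdjPart M A dM := by
  have hu : IsUnit M.det := (Matrix.isUnit_iff_isUnit_det M).1 hM.isUnit
  have hMH : Mᴴ = M := hM.1
  have hdH : dMᴴ = dM := hdM
  have key : ∀ Q : Matrix (Fin r) (Fin r) ℂ, adj M Q = Q ↔ Qᴴ * M = M * Q := by
    intro Q
    constructor
    · intro h
      rw [adj, mul_assoc] at h
      rw [← h, Matrix.mul_nonsing_inv_cancel_left _ _ hu, h]
    · intro h
      rw [adj, mul_assoc, h, Matrix.nonsing_inv_mul_cancel_left _ _ hu]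
  have hMP : M * selfAdjPart M A dM = (1 / 2 : ℂ) • (M * A + Aᴴ * M - dM) := by
    rw [selfAdjPart, adj, Matrix.mul_smul, mul_sub, mul_add, mul_assoc M⁻¹,
      Matrix.mul_nonsing_inv_cancel_left _ _ hu, Matrix.mul_nonsing_inv_cancel_left _ _ hu]
  rw [key]
  constructor
  · rintro ⟨h1, h2⟩
    have h3 : M * P = M * selfAdjPart M A dM := by
      rw [hMP, h2, Matrix.conjTranspose_sub, sub_mul, mul_sub, h1]
      module
    rw [← Matrix.nonsing_inv_mul_cancel_left _ P hu, h3,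
      Matrix.nonsing_inv_mul_cancel_left _ _ hu]
  · rintro rfl
    have h1 : (selfAdjPart M A dM)ᴴ * M = M * selfAdjPart M A dM := by
      have h2 := congrArg Matrix.conjTranspose hMP
      rw [Matrix.conjTranspose_mul, hMH] at h2
      rw [h2, hMP]
      simp only [Matrix.conjTranspose_smul, Matrix.conjTranspose_sub, Matrix.conjTranspose_add,
        Matrix.conjTranspose_mul, Matrix.conjTranspose_conjTranspose, hMH, hdH]
      rw [show star (1 / 2 : ℂ) = 1 / 2 by simp]
      module
    refine ⟨h1, ?_⟩
    rw [Matrix.conjTranspose_sub, sub_mul, mul_sub, h1, hMP]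
    module

theorem sqrt_spec {K : Matrix (Fin r) (Fin r) ℂ} (hK : K.PosDef) :
    (cfc Real.sqrt K)ᴴ = cfc Real.sqrt K ∧ cfc Real.sqrt K * cfc Real.sqrt K = K ∧
      IsUnit (cfc Real.sqrt K).det := by
  have hsa : IsSelfAdjoint K := hK.1
  have h2 : cfc Real.sqrt K * cfc Real.sqrt K = K := by
    rw [← cfc_mul _ _ K]
    conv_rhs => rw [← cfc_id' ℝ K]
    refine cfc_congr fun x hx => ?_
    have hx0 : 0 ≤ x := by
      rw [hK.1.spectrum_real_eq_range_eigenvalues] at hx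
      obtain ⟨i, rfl⟩ := hx
      exact (hK.eigenvalues_pos i).le
    exact Real.mul_self_sqrt hx0
  refine ⟨cfc_predicate (p := IsSelfAdjoint) Real.sqrt K, h2, ?_⟩
  have hu : IsUnit K.det := (Matrix.isUnit_iff_isUnit_det K).1 hK.isUnit
  rw [← h2, Matrix.det_mul] at hu
  exact isUnit_of_mul_isUnit_left hu

open scoped Matrix.Norms.L2Operator in
theorem exp_cfc_log {P : Matrix (Fin r) (Fin r) ℂ} (hP : P.PosDef) :
    NormedSpace.exp (cfc Real.log P) = P := by
  have hsa : IsSelfAdjoint P := hP.1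
  have hpos : ∀ x ∈ spectrum ℝ P, 0 < x := by
    intro x hx
    rw [hP.1.spectrum_real_eq_range_eigenvalues] at hx
    obtain ⟨i, rfl⟩ := hx
    exact hP.eigenvalues_pos i
  have hc : ContinuousOn Real.log (spectrum ℝ P) :=
    Real.continuousOn_log.mono fun x hx => (hpos x hx).ne'
  rw [← CFC.real_exp_eq_normedSpace_exp (cfc_predicate Real.log P),
    ← cfc_comp' Real.exp Real.log P]
  conv_rhs => rw [← cfc_id' ℝ P]
  exact cfc_congr fun x hx => Real.exp_log (hpos x hx)

theorem adj_logRelEnd {K H : Matrix (Fin r) (Fin r) ℂ} (hK : K.PosDef) :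
    adj K (logRelEnd K H) = logRelEnd K H := by
  obtain ⟨h1, h2, h3⟩ := sqrt_spec hK
  have h4 : (cfc Real.log ((cfc Real.sqrt K)⁻¹ * H * (cfc Real.sqrt K)⁻¹))ᴴ = _ :=
    cfc_predicate (p := IsSelfAdjoint) Real.log ((cfc Real.sqrt K)⁻¹ * H * (cfc Real.sqrt K)⁻¹)
  simp only [logRelEnd, adj]
  set S := cfc Real.sqrt K
  set L := cfc Real.log (S⁻¹ * H * S⁻¹)
  rw [← h2, Matrix.conjTranspose_mul, Matrix.conjTranspose_mul, Matrix.conjTranspose_nonsing_inv,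
    h1, h4, Matrix.mul_inv_rev]
  simp only [mul_assoc]
  rw [Matrix.nonsing_inv_mul_cancel_left _ _ h3, Matrix.nonsing_inv_mul_cancel_left _ _ h3]

theorem exp_logRelEnd {K H : Matrix (Fin r) (Fin r) ℂ} (hK : K.PosDef) (hH : H.PosDef) :
    NormedSpace.exp (logRelEnd K H) = relEnd K H := by
  obtain ⟨h1, h2, h3⟩ := sqrt_spec hK
  simp only [logRelEnd, relEnd]
  set S := cfc Real.sqrt K
  have hP : (S⁻¹ * H * S⁻¹).PosDef := by
    have h4 : IsUnit S⁻¹ := (Matrix.isUnit_nonsing_inv_iff).2 ((Matrix.isUnit_iff_isUnit_det S).2 h3)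
    have h5 := (Matrix.IsUnit.posDef_star_right_conjugate_iff (x := H) h4).2 hH
    rwa [Matrix.star_eq_conjTranspose, Matrix.conjTranspose_nonsing_inv, h1] at h5
  rw [Matrix.exp_conj' _ _ ((Matrix.isUnit_iff_isUnit_det S).2 h3), exp_cfc_log hP, mul_assoc, mul_assoc,
    Matrix.nonsing_inv_mul _ h3, mul_one, ← mul_assoc, ← Matrix.mul_inv_rev, h2]

end LinAlg

/-! ### Matrix-valued forms on open sets of `ℂⁿ` -/

section Local

variable {n r : ℕ}

/-- The derivative of a matrix-valued function at `y` along `u`. -/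
def dirDeriv (M : (Fin n → ℂ) → Matrix (Fin r) (Fin r) ℂ) (y u : Fin n → ℂ) :
    Matrix (Fin r) (Fin r) ℂ :=
  Matrix.of fun i j => fderiv ℝ (fun z => M z i j) y u

/-- The `(0,1)`-part of the derivative, `(∂̄ M)(u)`. -/
def dbarDeriv (M : (Fin n → ℂ) → Matrix (Fin r) (Fin r) ℂ) (y u : Fin n → ℂ) :
    Matrix (Fin r) (Fin r) ℂ :=
  (1 / 2 : ℂ) • (dirDeriv M y u + Complex.I • dirDeriv M y (Complex.I • u))

/-- The `(1,0)`-part of a 1-form. -/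
def part10 (a : (Fin n → ℂ) → Matrix (Fin r) (Fin r) ℂ) (u : Fin n → ℂ) :
    Matrix (Fin r) (Fin r) ℂ :=
  (1 / 2 : ℂ) • (a u - Complex.I • a (Complex.I • u))

/-- The `(0,1)`-part of a 1-form. -/
def part01 (a : (Fin n → ℂ) → Matrix (Fin r) (Fin r) ℂ) (u : Fin n → ℂ) :
    Matrix (Fin r) (Fin r) ℂ :=
  (1 / 2 : ℂ) • (a u + Complex.I • a (Complex.I • u))

/-- The curvature `dA + A ∧ A` of the connection `d + A`. -/
def curv (A : (Fin n → ℂ) → (Fin n → ℂ) → Matrix (Fin r) (Fin r) ℂ) (y u v : Fin n → ℂ) :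
    Matrix (Fin r) (Fin r) ℂ :=
  dirDeriv (fun z => A z v) y u - dirDeriv (fun z => A z u) y v + (A y u * A y v - A y v * A y u)

/-- The 2-form `(∂̄ + θ)² = ∂̄θ + θ ∧ θ`. -/
def dbarCurv (θ : (Fin n → ℂ) → (Fin n → ℂ) → Matrix (Fin r) (Fin r) ℂ) (y u v : Fin n → ℂ) :
    Matrix (Fin r) (Fin r) ℂ :=
  dbarDeriv (fun z => θ z v) y u - dbarDeriv (fun z => θ z u) y v
    + (θ y u * θ y v - θ y v * θ y u)

end Local

/-! ### Complex vector bundles, connections, Hermitian metrics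

A smooth complex vector bundle of rank `r` over `X` is a fibre bundle `E` with fibre `ℂʳ` whose
trivializations are `ℂ`-linear on the fibres and whose transition functions are smooth over `ℝ`:
`[VectorBundle ℂ (Fin r → ℂ) E] [VectorBundle ℝ (Fin r → ℂ) E]
[ContMDiffVectorBundle ∞ (Fin r → ℂ) E 𝓘(ℝ, Fin n → ℂ)]`. -/

section BundleDefs

variable {n : ℕ} {X : Type*} [TopologicalSpace X] [ChartedSpace (Fin n → ℂ) X]
  {r : ℕ} {E : X → Type*} [∀ x, AddCommGroup (E x)] [∀ x, Module ℂ (E x)]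
  [TopologicalSpace (TotalSpace (Fin r → ℂ) E)] [∀ x, TopologicalSpace (E x)]
  [∀ x, IsTopologicalAddGroup (E x)] [∀ x, ContinuousSMul ℝ (E x)]
  [FiberBundle (Fin r → ℂ) E]

variable (n r E) in
/-- A smooth (complex linear) connection on `E`; `cov σ x v` is `(D_v σ)(x)`. -/
structure Connection [IsManifold 𝓘(ℂ, Fin n → ℂ) ω X] [VectorBundle ℝ (Fin r → ℂ) E] where
  cov : CovariantDerivative 𝓘(ℝ, Fin n → ℂ) (Fin r → ℂ) E
  smooth : cov.ContMDiffCovariantDerivative ∞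
  complex_linear : ∀ (c : ℂ) (σ : ∀ x, E x) (x : X),
    MDifferentiableAt 𝓘(ℝ, Fin n → ℂ) (𝓘(ℝ, Fin n → ℂ).prod 𝓘(ℝ, Fin r → ℂ))
      (fun y => TotalSpace.mk' (Fin r → ℂ) y (σ y)) x →
    ∀ v, cov (c • σ) x v = c • cov σ x v

/-- The local frame `σ_i` of `E` given by a trivialization. -/
def frame (e : Trivialization (Fin r → ℂ) (π (Fin r → ℂ) E)) (i : Fin r) (x : X) : E x :=
  e.symm x (Pi.single i 1)

variable (n r E) in
/-- A smooth Hermitian metric on `E` (conjugate-linear in the first slot). -/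
structure HermitianMetric where
  inner : ∀ x, E x →ₗ⋆[ℂ] E x →ₗ[ℂ] ℂ
  symm : ∀ x s t, inner x s t = (starRingEnd ℂ) (inner x t s)
  positive : ∀ x s, s ≠ 0 → 0 < (inner x s s).re
  smooth : ∀ (e : Trivialization (Fin r → ℂ) (π (Fin r → ℂ) E)) [MemTrivializationAtlas e] (i j),
    ContMDiffOn 𝓘(ℝ, Fin n → ℂ) 𝓘(ℝ, ℂ) ∞
      (fun x => inner x (frame e i x) (frame e j x)) e.baseSet

/-- The Gram matrix of the metric in the frame of `e`. -/
def HermitianMetric.gram (H : HermitianMetric n r E)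
    (e : Trivialization (Fin r → ℂ) (π (Fin r → ℂ) E)) (x : X) : Matrix (Fin r) (Fin r) ℂ :=
  Matrix.of fun i j => H.inner x (frame e i x) (frame e j x)

/-- The Gram matrix at `x` in the preferred frame at `x`. -/
def HermitianMetric.gramAt (H : HermitianMetric n r E) (x : X) : Matrix (Fin r) (Fin r) ℂ :=
  H.gram (trivializationAt (Fin r → ℂ) E x) x

/-- `tr h + tr h⁻¹` for `h = K⁻¹ H`. -/
def traceSum (K H : HermitianMetric n r E) (x : X) : ℝ :=
  (Matrix.trace (relEnd (K.gramAt x) (H.gramAt x))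
    + Matrix.trace ((relEnd (K.gramAt x) (H.gramAt x))⁻¹)).re

/-- `|log h|_K` for `h = K⁻¹ H`. -/
def logNorm (K H : HermitianMetric n r E) (x : X) : ℝ :=
  endNorm (K.gramAt x) (logRelEnd (K.gramAt x) (H.gramAt x))

variable [IsManifold 𝓘(ℂ, Fin n → ℂ) ω X] [VectorBundle ℝ (Fin r → ℂ) E]

/-- The connection form `A` of `D` in the chart `φ` and the frame `σ_i` of `e`:
`D σ_i = ∑ A_{ki} σ_k`. -/
def Connection.form (D : Connection n r E) (φ : OpenPartialHomeomorph X (Fin n → ℂ))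
    (e : Trivialization (Fin r → ℂ) (π (Fin r → ℂ) E)) (y u : Fin n → ℂ) :
    Matrix (Fin r) (Fin r) ℂ :=
  Matrix.of fun k i => (e ⟨φ.symm y, D.cov (frame e i) (φ.symm y) (chartVec φ y u)⟩).2 k

/-- The form `ψ_H` of the decomposition `D = D_H + ψ_H`. -/
def Connection.psi (D : Connection n r E) (H : HermitianMetric n r E)
    (φ : OpenPartialHomeomorph X (Fin n → ℂ))
    (e : Trivialization (Fin r → ℂ) (π (Fin r → ℂ) E)) (y u : Fin n → ℂ) :
    Matrix (Fin r) (Fin r) ℂ :=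
  selfAdjPart (H.gram e (φ.symm y)) (D.form φ e y u)
    (dirDeriv (fun z => H.gram e (φ.symm z)) y u)

/-- The form `θ` with `D''_H = ∂̄_H + ψ_H^{1,0} = ∂̄ + θ`, where `D_H = D - ψ_H` and `∂̄_H` is its
`(0,1)`-part. -/
def Connection.theta (D : Connection n r E) (H : HermitianMetric n r E)
    (φ : OpenPartialHomeomorph X (Fin n → ℂ))
    (e : Trivialization (Fin r → ℂ) (π (Fin r → ℂ) E)) (y u : Fin n → ℂ) :
    Matrix (Fin r) (Fin r) ℂ :=
  part01 (fun v => D.form φ e y v - D.psi H φ e y v) u + part10 (fun v => D.psi H φ e y v) u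

/-- The curvature `F_D` at `x`, in the preferred chart and frame at `x`. -/
def Connection.curvature (D : Connection n r E) (x : X) (u v : Fin n → ℂ) :
    Matrix (Fin r) (Fin r) ℂ :=
  curv (D.form (chartAt (Fin n → ℂ) x) (trivializationAt (Fin r → ℂ) E x))
    (chartAt (Fin n → ℂ) x x) u v

/-- The pseudo-curvature `G_H = (D''_H)²` at `x`, in the preferred chart and frame at `x`. -/
def Connection.pseudoCurvature (D : Connection n r E) (H : HermitianMetric n r E) (x : X)
    (u v : Fin n → ℂ) : Matrix (Fin r) (Fin r) ℂ :=
  dbarCurv (D.theta H (chartAt (Fin n → ℂ) x) (trivializationAt (Fin r → ℂ) E x))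
    (chartAt (Fin n → ℂ) x x) u v

/-- `D` is a non-Hermitian Yang-Mills connection: `F_D` is of type `(1,1)` and
`√-1 Λ_ω F_D = λ Id` for a real constant `λ`. -/
def Connection.IsNHYM (D : Connection n r E) (ω₀ : KahlerForm n X) : Prop :=
  (∀ x u v, D.curvature x (Complex.I • u) (Complex.I • v) = D.curvature x u v) ∧
  ∃ c : ℝ, ∀ x : X,
    ω₀.iLambda (chartAt (Fin n → ℂ) x) (chartAt (Fin n → ℂ) x x) (D.curvature x)
      = (c : ℂ) • (1 : Matrix (Fin r) (Fin r) ℂ)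

/-- `|√-1 Λ_ω G_H|_H` at `x`. -/
def Connection.normLambdaG (D : Connection n r E) (ω₀ : KahlerForm n X)
    (H : HermitianMetric n r E) (x : X) : ℝ :=
  endNorm (H.gramAt x)
    (ω₀.iLambda (chartAt (Fin n → ℂ) x) (chartAt (Fin n → ℂ) x x) (D.pseudoCurvature H x))

end BundleDefs

end NHYM

end

open NHYM

/-! Write `h = K⁻¹H` and let `β` be the difference of the connections adjoint to `D` with respect to
`H` and `K`, so that `β = -2(ψ_H - ψ_K)`. Because `√-1ΛF_D` is a real multiple of the identity, the
curvature drops out of the pseudo-curvature and `4√-1ΛG_M` is minus the trace of `∇ψ_M`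
(`four_smul_sum_diag11_dbarCurv`). Hence, for a polynomial `f` and `g(t) = t f'(t)`, the Laplacian
of `tr f(h)` is `4 Re tr(g(h)(√-1ΛG_H - √-1ΛG_K))` plus terms quadratic in `∇h`
(`LocalPair.frameSum_hess`). In a frame where `K` is the identity and `H` is diagonal, the quadratic
terms are sums of divided differences of `g` times squares. They are nonnegative when `g` increases,
and they dominate the squared gradient of `tr f(h)` (`LocalPair.traceHessianGrad_bound`).

For `f = X`, applied to `(K, H)` and to `(H, K)`, the quadratic terms absorb the negative gradient
term created by the logarithm; this is the first inequality. For `f` close to `log²` they absorb the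
one created by the square root, so `(tr f(h))^{1/2}` satisfies the same inequality. Since `|log h|`
need not be differentiable where `h` is the identity, it is approximated uniformly by such `C²`
functions (`exists_isLogSq`, `Connection.IsNHYM.exists_approx_logNorm`).

The supremum bound then follows from a mean value inequality for `C²` functions `f ≥ 0` with `Δf ≥
-β`, now for a constant `β` (`KahlerForm.le_integral`). It rests on the method of Alexandrov,
Bakelman and Pucci: around a maximum of value `M ≥ 1` the set `{f ≥ M/2}` has volume bounded below
by a constant depending only on `(X, ω)` and `β` (`exists_volume_lower_bound`), so the integral of
`f` controls `M`. Neither the rank nor the bundle enters the constants. -/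

namespace NHYM

open Filter Topology

/-! ### Entrywise calculus of matrix-valued functions, with no choice of a norm on matrices. -/

section MatrixCalculus

variable {n r : ℕ} {M N : (Fin n → ℂ) → Matrix (Fin r) (Fin r) ℂ} {y u v : Fin n → ℂ}

/-- Entrywise differentiability of a matrix-valued function. -/
def EntryDiff (M : (Fin n → ℂ) → Matrix (Fin r) (Fin r) ℂ) (y : Fin n → ℂ) : Prop :=
  ∀ i j, DifferentiableAt ℝ (fun z => M z i j) y

/-- Entrywise `C²` regularity of a matrix-valued function. -/
def EntryC2 (M : (Fin n → ℂ) → Matrix (Fin r) (Fin r) ℂ) (y : Fin n → ℂ) : Prop :=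
  ∀ i j, ContDiffAt ℝ 2 (fun z => M z i j) y

theorem EntryC2.diff (h : EntryC2 M y) : EntryDiff M y :=
  fun i j => (h i j).differentiableAt (by norm_num)

theorem EntryC2.eventually (h : EntryC2 M y) : ∀ᶠ z in 𝓝 y, EntryC2 M z := by
  simp only [EntryC2, eventually_all]
  exact fun i j => (h i j).eventually (by simp)

theorem EntryDiff.add (hM : EntryDiff M y) (hN : EntryDiff N y) :
    EntryDiff (fun z => M z + N z) y := fun i j => (hM i j).add (hN i j)

theorem EntryDiff.sub (hM : EntryDiff M y) (hN : EntryDiff N y) :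
    EntryDiff (fun z => M z - N z) y := fun i j => (hM i j).sub (hN i j)

theorem EntryDiff.smul (c : ℂ) (hM : EntryDiff M y) : EntryDiff (fun z => c • M z) y :=
  fun i j => (hM i j).const_smul c

theorem EntryDiff.conjTranspose (hM : EntryDiff M y) : EntryDiff (fun z => (M z)ᴴ) y :=
  fun i j => (hM j i).star

theorem EntryDiff.mul (hM : EntryDiff M y) (hN : EntryDiff N y) :
    EntryDiff (fun z => M z * N z) y := by
  intro i j
  simp only [Matrix.mul_apply]
  exact DifferentiableAt.fun_sum fun k _ => (hM i k).mul (hN k j)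

theorem EntryC2.mul (hM : EntryC2 M y) (hN : EntryC2 N y) :
    EntryC2 (fun z => M z * N z) y := by
  intro i j
  simp only [Matrix.mul_apply]
  exact ContDiffAt.sum fun k _ => (hM i k).mul (hN k j)

theorem EntryC2.det (hM : EntryC2 M y) : ContDiffAt ℝ 2 (fun z => (M z).det) y := by
  simp only [Matrix.det_apply]
  exact ContDiffAt.sum fun σ _ => (contDiffAt_prod fun i _ => hM _ _).const_smul _

/-- Cramer's rule: the entries of the adjugate are determinants with one row replaced by a basis
vector, hence polynomial in the entries of `M`. -/
theorem EntryC2.inv (hM : EntryC2 M y) (hu : IsUnit (M y).det) :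
    EntryC2 (fun z => (M z)⁻¹) y := by
  intro i j
  have h1 : ContDiffAt ℝ 2 (fun z => (M z).adjugate i j) y := by
    simp only [Matrix.adjugate_apply]
    refine EntryC2.det (M := fun z => (M z).updateRow j (Pi.single i 1)) fun k l => ?_
    by_cases hk : k = j
    · subst hk
      simp only [Matrix.updateRow_self]
      exact contDiffAt_const
    · simp only [Matrix.updateRow_ne hk]
      exact hM k l
  simp only [Matrix.inv_def, Matrix.smul_apply, Ring.inverse_eq_inv, smul_eq_mul]
  exact (hM.det.inv hu.ne_zero).mul h1

theorem EntryC2.entryDiff_dirDeriv (hM : EntryC2 M y) : EntryDiff (fun z => dirDeriv M z u) y := by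
  intro i j
  simp only [dirDeriv, Matrix.of_apply]
  exact (((hM i j).fderiv_right (m := 1) (by norm_num)).differentiableAt (by norm_num)).clm_apply
    (differentiableAt_const u)

theorem dirDeriv_congr (e : ∀ᶠ z in 𝓝 y, N z = M z) : dirDeriv N y u = dirDeriv M y u := by
  ext i j
  simp only [dirDeriv, Matrix.of_apply]
  rw [Filter.EventuallyEq.fderiv_eq (f₁ := fun z => N z i j) (f := fun z => M z i j)
    (e.mono fun z hz => congrFun (congrFun hz i) j)]

theorem dirDeriv_const (C : Matrix (Fin r) (Fin r) ℂ) : dirDeriv (fun _ => C) y u = 0 := by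
  ext i j; simp [dirDeriv]

theorem dirDeriv_add (hM : EntryDiff M y) (hN : EntryDiff N y) :
    dirDeriv (fun z => M z + N z) y u = dirDeriv M y u + dirDeriv N y u := by
  ext i j
  simp only [dirDeriv, Matrix.of_apply, Matrix.add_apply]
  rw [fderiv_fun_add (hM i j) (hN i j)]; rfl

theorem dirDeriv_sub (hM : EntryDiff M y) (hN : EntryDiff N y) :
    dirDeriv (fun z => M z - N z) y u = dirDeriv M y u - dirDeriv N y u := by
  ext i j
  simp only [dirDeriv, Matrix.of_apply, Matrix.sub_apply]
  rw [fderiv_fun_sub (hM i j) (hN i j)]; rfl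

theorem dirDeriv_smul (c : ℂ) (hM : EntryDiff M y) :
    dirDeriv (fun z => c • M z) y u = c • dirDeriv M y u := by
  ext i j
  simp only [dirDeriv, Matrix.of_apply, Matrix.smul_apply]
  rw [fderiv_fun_const_smul (hM i j)]; rfl

theorem dirDeriv_conjTranspose : dirDeriv (fun z => (M z)ᴴ) y u = (dirDeriv M y u)ᴴ := by
  ext i j
  simp only [dirDeriv, Matrix.of_apply, Matrix.conjTranspose_apply]
  rw [fderiv_star]; rfl

theorem dirDeriv_mul (hM : EntryDiff M y) (hN : EntryDiff N y) :
    dirDeriv (fun z => M z * N z) y u = dirDeriv M y u * N y + M y * dirDeriv N y u := by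
  ext i j
  simp only [dirDeriv, Matrix.of_apply, Matrix.mul_apply, Matrix.add_apply]
  rw [fderiv_fun_sum fun k _ => (hM i k).fun_mul (hN k j)]
  simp only [sum_apply]
  rw [← Finset.sum_add_distrib]
  refine Finset.sum_congr rfl fun k _ => ?_
  rw [fderiv_fun_mul (hM i k) (hN k j)]
  simp [add_comm, mul_comm]

/-- Differentiate `1 = M M⁻¹`, which holds near `y` because invertibility is an open condition. -/
theorem dirDeriv_inv (hM : EntryC2 M y) (hu : IsUnit (M y).det) :
    dirDeriv (fun z => (M z)⁻¹) y u = -((M y)⁻¹ * dirDeriv M y u * (M y)⁻¹) := by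
  have hev : ∀ᶠ z in 𝓝 y, (1 : Matrix (Fin r) (Fin r) ℂ) = M z * (M z)⁻¹ := by
    filter_upwards [hM.det.continuousAt.eventually_ne hu.ne_zero] with z hz
    rw [Matrix.mul_nonsing_inv _ (isUnit_iff_ne_zero.2 hz)]
  have h := dirDeriv_congr (u := u) hev
  rw [dirDeriv_const, dirDeriv_mul hM.diff (hM.inv hu).diff] at h
  have h2 : M y * dirDeriv (fun z => (M z)⁻¹) y u = -(dirDeriv M y u * (M y)⁻¹) :=
    eq_neg_of_add_eq_zero_right h.symm
  rw [← Matrix.nonsing_inv_mul_cancel_left (M y) (dirDeriv (fun z => (M z)⁻¹) y u) hu, h2,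
    mul_neg, mul_assoc]

theorem dirDeriv_comm (hM : EntryC2 M y) :
    dirDeriv (fun z => dirDeriv M z u) y v = dirDeriv (fun z => dirDeriv M z v) y u := by
  ext i j
  simp only [dirDeriv, Matrix.of_apply]
  have hd : DifferentiableAt ℝ (fderiv ℝ fun z => M z i j) y :=
    ((hM i j).fderiv_right (m := 1) (by norm_num)).differentiableAt (by norm_num)
  rw [fderiv_clm_apply hd (differentiableAt_const u), fderiv_clm_apply hd (differentiableAt_const v)]
  simpa using ((hM i j).isSymmSndFDerivAt (by simp)).eq v u

theorem EntryDiff.trace (hM : EntryDiff M y) : DifferentiableAt ℝ (fun z => (M z).trace) y :=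
  DifferentiableAt.fun_sum fun k _ => hM k k

theorem EntryC2.trace (hM : EntryC2 M y) : ContDiffAt ℝ 2 (fun z => (M z).trace) y :=
  ContDiffAt.sum fun k _ => hM k k

theorem fderiv_trace (hM : EntryDiff M y) :
    fderiv ℝ (fun z => (M z).trace) y u = (dirDeriv M y u).trace := by
  simp only [Matrix.trace, Matrix.diag_apply]
  rw [fderiv_fun_sum fun k _ => hM k k]
  simp [dirDeriv]

theorem dirDeriv_neg_dir : dirDeriv M y (-u) = -dirDeriv M y u := by
  ext i j; simp [dirDeriv]

end MatrixCalculus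

end NHYM

namespace NHYM

/-! ### Simultaneous diagonalization of two Hermitian metrics. -/

section SimultaneousDiagonalization

variable {r : ℕ} {K H P A G : Matrix (Fin r) (Fin r) ℂ} {l : Fin r → ℝ}

/-- The diagonal matrix with real entries `l`. -/
def realDiag (l : Fin r → ℝ) : Matrix (Fin r) (Fin r) ℂ := Matrix.diagonal fun i => (l i : ℂ)

theorem trace_realDiag_mul (l : Fin r → ℝ) (A : Matrix (Fin r) (Fin r) ℂ) :
    (realDiag l * A).trace = ∑ a, (l a : ℂ) * A a a := by
  simp [realDiag, Matrix.trace, Matrix.diagonal_mul]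

theorem realDiag_mul (l m : Fin r → ℝ) :
    realDiag l * realDiag m = realDiag fun i => l i * m i := by
  simp [realDiag, Matrix.diagonal_mul_diagonal]

theorem realDiag_one : realDiag (fun _ : Fin r => (1 : ℝ)) = 1 := by
  simp [realDiag]

/-- In the frame given by the columns of `P` the metric `K` is the identity and `H` is the diagonal
matrix with positive entries `l`. -/
structure SimDiag (K H P : Matrix (Fin r) (Fin r) ℂ) (l : Fin r → ℝ) : Prop where
  unit : IsUnit P.det
  pos : ∀ a, 0 < l a
  left : Pᴴ * K * P = 1
  right : Pᴴ * H * P = realDiag l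

/-- The frame is `P = K^{-1/2} U`, where the unitary `U` diagonalizes `K^{-1/2} H K^{-1/2}`. As
`logRelEnd` is defined through that same matrix, `P` diagonalizes it too. -/
theorem exists_simDiag (hK : K.PosDef) (hH : H.PosDef) : ∃ P l, SimDiag K H P l ∧
    logRelEnd K H = P * realDiag (fun a => Real.log (l a)) * P⁻¹ := by
  obtain ⟨h1, h2, h3⟩ := sqrt_spec hK
  set S := cfc Real.sqrt K with hS
  have hSu : IsUnit S⁻¹ := (Matrix.isUnit_nonsing_inv_iff).2 ((Matrix.isUnit_iff_isUnit_det S).2 h3)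
  have hS1 : (S⁻¹)ᴴ = S⁻¹ := by rw [Matrix.conjTranspose_nonsing_inv, h1]
  have hP : (S⁻¹ * H * S⁻¹).PosDef := by
    have h5 := (Matrix.IsUnit.posDef_star_right_conjugate_iff (x := H) hSu).2 hH
    rwa [Matrix.star_eq_conjTranspose, hS1] at h5
  set U : Matrix (Fin r) (Fin r) ℂ := hP.1.eigenvectorUnitary.1 with hU
  have hUU : Uᴴ * U = 1 := by
    rw [hU]; exact Matrix.UnitaryGroup.star_mul_self _
  have hUdet : IsUnit U.det := by
    have : (Uᴴ * U).det = 1 := by rw [hUU, Matrix.det_one]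
    rw [Matrix.det_mul] at this
    exact IsUnit.of_mul_eq_one_right _ this
  have hUinv : U⁻¹ = Uᴴ := Matrix.inv_eq_left_inv hUU
  have hspec : Uᴴ * (S⁻¹ * H * S⁻¹) * U = realDiag hP.1.eigenvalues := by
    have h6 := hP.1.spectral_theorem
    rw [Unitary.conjStarAlgAut_apply] at h6
    conv_lhs => rw [h6]
    rw [Matrix.star_eq_conjTranspose, ← hU]
    have : U⁻¹ * U = 1 := by rw [hUinv, hUU]
    rw [← mul_assoc, ← mul_assoc, hUU, one_mul, mul_assoc, hUU, mul_one]
    rfl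
  have hcfc : cfc Real.log (S⁻¹ * H * S⁻¹)
      = U * realDiag (fun a => Real.log (hP.1.eigenvalues a)) * Uᴴ := by
    rw [hP.1.cfc_eq, Matrix.IsHermitian.cfc, Unitary.conjStarAlgAut_apply]
    rfl
  refine ⟨S⁻¹ * U, hP.1.eigenvalues, ⟨?_, hP.eigenvalues_pos, ?_, ?_⟩, ?_⟩
  · rw [Matrix.det_mul]
    exact ((Matrix.isUnit_iff_isUnit_det _).1 hSu).mul hUdet
  · rw [Matrix.conjTranspose_mul, hS1, ← h2]
    have : Uᴴ * S⁻¹ * (S * S) * (S⁻¹ * U) = Uᴴ * ((S⁻¹ * S) * (S * S⁻¹)) * U := by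
      simp only [mul_assoc]
    rw [this, Matrix.nonsing_inv_mul _ h3, Matrix.mul_nonsing_inv _ h3, one_mul, mul_one, hUU]
  · rw [Matrix.conjTranspose_mul, hS1, ← hspec]
    simp only [mul_assoc]
  · simp only [logRelEnd, ← hS]
    rw [hcfc, Matrix.mul_inv_rev, Matrix.nonsing_inv_nonsing_inv _ h3, hUinv]
    simp only [mul_assoc]

namespace SimDiag

variable (h : SimDiag K H P l)
include h

theorem inv_mul : P⁻¹ * P = 1 := Matrix.nonsing_inv_mul _ h.unit

theorem mul_inv : P * P⁻¹ = 1 := Matrix.mul_nonsing_inv _ h.unit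

theorem left_inv : K⁻¹ = P * Pᴴ := by
  apply Matrix.inv_eq_left_inv
  have h1 : Pᴴ * K = P⁻¹ := by
    rw [← Matrix.mul_nonsing_inv_cancel_right P (Pᴴ * K) h.unit, h.left, one_mul]
  rw [mul_assoc, h1, h.mul_inv]

theorem left_eq : K = (P⁻¹)ᴴ * P⁻¹ := by
  have h1 : Pᴴ * K = P⁻¹ := by
    rw [← Matrix.mul_nonsing_inv_cancel_right P (Pᴴ * K) h.unit, h.left, one_mul]
  have h2 : (P⁻¹)ᴴ * Pᴴ = 1 := by rw [← Matrix.conjTranspose_mul, h.mul_inv, Matrix.conjTranspose_one]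
  rw [← one_mul K, ← h2, mul_assoc, h1]

theorem right_eq : H = (P⁻¹)ᴴ * realDiag l * P⁻¹ := by
  have h2 : (P⁻¹)ᴴ * Pᴴ = 1 := by rw [← Matrix.conjTranspose_mul, h.mul_inv, Matrix.conjTranspose_one]
  rw [← h.right, ← mul_assoc, ← mul_assoc, h2, one_mul, mul_assoc, h.mul_inv, mul_one]

theorem diag_inv : (realDiag l) * realDiag (fun a => (l a)⁻¹) = 1 := by
  rw [realDiag_mul, ← realDiag_one]
  congr 1
  ext a
  exact mul_inv_cancel₀ (h.pos a).ne'

theorem right_inv : H⁻¹ = P * realDiag (fun a => (l a)⁻¹) * Pᴴ := by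
  apply Matrix.inv_eq_right_inv
  have h2 : (P⁻¹)ᴴ * Pᴴ = 1 := by rw [← Matrix.conjTranspose_mul, h.mul_inv, Matrix.conjTranspose_one]
  conv_lhs => rw [h.right_eq]
  calc _ = (P⁻¹)ᴴ * realDiag l * (P⁻¹ * P) * realDiag (fun a => (l a)⁻¹) * Pᴴ := by
        simp only [mul_assoc]
    _ = 1 := by rw [h.inv_mul, mul_one, mul_assoc (P⁻¹)ᴴ, h.diag_inv, mul_one, h2]

theorem relEnd_eq : relEnd K H = P * realDiag l * P⁻¹ := by
  rw [relEnd, h.left_inv, ← h.right, mul_assoc P, mul_assoc P, mul_assoc _ P, h.mul_inv, mul_one]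

theorem isUnit_left : IsUnit K.det := by
  have := congrArg Matrix.det h.left
  rw [Matrix.det_mul, Matrix.det_mul, Matrix.det_one] at this
  exact IsUnit.of_mul_eq_one (P.det * Pᴴ.det) (by rw [← this]; ring)

/-- Polynomials stand in for a general functional calculus: they act on eigenvalues in the expected
way, and their smooth dependence on `h` is automatic. -/
theorem aeval_relEnd (g : Polynomial ℝ) :
    Polynomial.aeval (relEnd K H) g = P * realDiag (fun a => g.eval (l a)) * P⁻¹ := by
  rw [h.relEnd_eq]
  induction g using Polynomial.induction_on' with
  | add p q hp hq =>
    rw [map_add, hp, hq, ← add_mul, ← mul_add, realDiag, realDiag, Matrix.diagonal_add, realDiag]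
    simp
  | monomial k c =>
    have hk : (P * realDiag l * P⁻¹) ^ k = P * realDiag (fun a => l a ^ k) * P⁻¹ := by
      induction k with
      | zero => simp [realDiag_one, h.mul_inv]
      | succ k ih =>
        rw [pow_succ, ih]
        calc _ = P * realDiag (fun a => l a ^ k) * (P⁻¹ * P) * realDiag l * P⁻¹ := by
              simp only [mul_assoc]
          _ = _ := by
              rw [h.inv_mul, mul_one, mul_assoc P, realDiag_mul]
              simp only [pow_succ]
    rw [Polynomial.aeval_monomial, hk]
    simp only [Polynomial.eval_monomial]
    rw [Algebra.algebraMap_eq_smul_one, smul_mul_assoc, one_mul, ← smul_mul_assoc, ← mul_smul_comm]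
    congr 2
    ext i j
    by_cases hij : i = j <;> simp [realDiag, hij]

theorem conj_eq (A : Matrix (Fin r) (Fin r) ℂ) : A = P * (P⁻¹ * A * P) * P⁻¹ := by
  rw [← mul_assoc, ← mul_assoc, h.mul_inv, one_mul, mul_assoc, h.mul_inv, mul_one]

theorem trace_conj (A : Matrix (Fin r) (Fin r) ℂ) : (P * A * P⁻¹).trace = A.trace := by
  rw [Matrix.trace_mul_cycle, h.inv_mul, one_mul]

theorem adj_left (A : Matrix (Fin r) (Fin r) ℂ) : adj K (P * A * P⁻¹) = P * Aᴴ * P⁻¹ := by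
  rw [adj, h.left_inv]
  conv_lhs => enter [2]; rw [h.left_eq]
  simp only [Matrix.conjTranspose_mul]
  have h2 : Pᴴ * (P⁻¹)ᴴ = 1 := by rw [← Matrix.conjTranspose_mul, h.inv_mul, Matrix.conjTranspose_one]
  calc _ = P * (Pᴴ * (P⁻¹)ᴴ) * Aᴴ * (Pᴴ * (P⁻¹)ᴴ) * P⁻¹ := by simp only [mul_assoc]
    _ = _ := by rw [h2, mul_one, mul_one]

theorem adj_right (A : Matrix (Fin r) (Fin r) ℂ) : adj H (P * A * P⁻¹)
    = P * (realDiag (fun a => (l a)⁻¹) * Aᴴ * realDiag l) * P⁻¹ := by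
  rw [adj, h.right_inv]
  conv_lhs => enter [2]; rw [h.right_eq]
  simp only [Matrix.conjTranspose_mul]
  have h2 : Pᴴ * (P⁻¹)ᴴ = 1 := by rw [← Matrix.conjTranspose_mul, h.inv_mul, Matrix.conjTranspose_one]
  calc _ = P * realDiag (fun a => (l a)⁻¹) * (Pᴴ * (P⁻¹)ᴴ) * Aᴴ * (Pᴴ * (P⁻¹)ᴴ) * realDiag l * P⁻¹ := by
        simp only [mul_assoc]
    _ = _ := by rw [h2, mul_one, mul_one]; simp only [mul_assoc]

theorem endNorm_left (A : Matrix (Fin r) (Fin r) ℂ) :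
    endNorm K (P * A * P⁻¹) = Real.sqrt (∑ a, ∑ b, Complex.normSq (A a b)) := by
  rw [endNorm, h.adj_left]
  have : P * A * P⁻¹ * (P * Aᴴ * P⁻¹) = P * (A * Aᴴ) * P⁻¹ := by
    calc _ = P * A * (P⁻¹ * P) * Aᴴ * P⁻¹ := by simp only [mul_assoc]
      _ = _ := by rw [h.inv_mul, mul_one]; simp only [mul_assoc]
  rw [this, h.trace_conj]
  congr 1
  simp [Matrix.trace, Matrix.mul_apply, Complex.normSq_apply]

theorem endNorm_right (A : Matrix (Fin r) (Fin r) ℂ) :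
    endNorm H (P * A * P⁻¹)
      = Real.sqrt (∑ a, ∑ b, (l b)⁻¹ * l a * Complex.normSq (A a b)) := by
  rw [endNorm, h.adj_right]
  have : P * A * P⁻¹ * (P * (realDiag (fun a => (l a)⁻¹) * Aᴴ * realDiag l) * P⁻¹)
      = P * (A * (realDiag (fun a => (l a)⁻¹) * Aᴴ * realDiag l)) * P⁻¹ := by
    calc _ = P * A * (P⁻¹ * P) * (realDiag (fun a => (l a)⁻¹) * Aᴴ * realDiag l) * P⁻¹ := by
          simp only [mul_assoc]
      _ = _ := by rw [h.inv_mul, mul_one]; simp only [mul_assoc]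
  rw [this, h.trace_conj]
  congr 1
  have hent : ∀ b a, (realDiag (fun a => (l a)⁻¹) * Aᴴ * realDiag l) b a
      = (((l b)⁻¹ : ℝ) : ℂ) * star (A a b) * (l a : ℂ) := fun b a => by
    rw [realDiag, realDiag, Matrix.mul_diagonal, Matrix.diagonal_mul, Matrix.conjTranspose_apply]
  simp only [Matrix.trace, Matrix.diag_apply]
  simp only [Matrix.mul_apply (M := A), hent, Complex.re_sum]
  refine Finset.sum_congr rfl fun a _ => Finset.sum_congr rfl fun b _ => ?_
  have : A a b * ((((l b)⁻¹ : ℝ) : ℂ) * star (A a b) * (l a : ℂ))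
      = (((l b)⁻¹ * l a : ℝ) : ℂ) * (A a b * (starRingEnd ℂ) (A a b)) := by
    push_cast
    rw [starRingEnd_apply]
    ring
  rw [this, Complex.mul_conj, ← Complex.ofReal_mul, Complex.ofReal_re]

theorem sum_normSq_diag_le_left (A : Matrix (Fin r) (Fin r) ℂ) :
    Real.sqrt (∑ a, Complex.normSq (A a a)) ≤ endNorm K (P * A * P⁻¹) := by
  rw [h.endNorm_left]
  refine Real.sqrt_le_sqrt (Finset.sum_le_sum fun a _ => ?_)
  exact Finset.single_le_sum (f := fun b => Complex.normSq (A a b))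
    (fun b _ => Complex.normSq_nonneg _) (Finset.mem_univ a)

/-- In the frame `P` the `H`-norm weights the entry `(a, b)` by `l a / l b`, which is `1` on the
diagonal. The diagonal part is therefore seen alike by both metrics. -/
theorem sum_normSq_diag_le_right (A : Matrix (Fin r) (Fin r) ℂ) :
    Real.sqrt (∑ a, Complex.normSq (A a a)) ≤ endNorm H (P * A * P⁻¹) := by
  rw [h.endNorm_right]
  refine Real.sqrt_le_sqrt (Finset.sum_le_sum fun a _ => ?_)
  have := Finset.single_le_sum (f := fun b => (l b)⁻¹ * l a * Complex.normSq (A a b))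
    (fun b _ => mul_nonneg (mul_nonneg (inv_nonneg.2 (h.pos b).le) (h.pos a).le)
      (Complex.normSq_nonneg _)) (Finset.mem_univ a)
  simpa [(h.pos a).ne'] using this

/-- Pairing with `g(h)`, which is diagonal in the frame `P`, only involves the diagonal of `G`;
Cauchy–Schwarz then works with either metric. This is why `G_H` can be measured by `H` and `G_K` by
`K`. -/
theorem abs_trace_aeval_mul_le {M : Matrix (Fin r) (Fin r) ℂ} (hM : M = K ∨ M = H)
    (g : Polynomial ℝ) (G : Matrix (Fin r) (Fin r) ℂ) :
    |(Polynomial.aeval (relEnd K H) g * G).trace.re|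
      ≤ Real.sqrt (∑ a, g.eval (l a) ^ 2) * endNorm M G := by
  set A := P⁻¹ * G * P with hA
  have hG : G = P * A * P⁻¹ := h.conj_eq G
  have h1 : (Polynomial.aeval (relEnd K H) g * G).trace.re = ∑ a, g.eval (l a) * (A a a).re := by
    rw [h.aeval_relEnd, hG]
    have : P * realDiag (fun a => g.eval (l a)) * P⁻¹ * (P * A * P⁻¹)
        = P * (realDiag (fun a => g.eval (l a)) * A) * P⁻¹ := by
      calc _ = P * realDiag (fun a => g.eval (l a)) * (P⁻¹ * P) * A * P⁻¹ := by
            simp only [mul_assoc]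
        _ = _ := by rw [h.inv_mul, mul_one]; simp only [mul_assoc]
    rw [this, h.trace_conj, trace_realDiag_mul]
    simp
  have h2 : Real.sqrt (∑ a, Complex.normSq (A a a)) ≤ endNorm M G := by
    rw [hG]
    rcases hM with rfl | rfl
    · exact h.sum_normSq_diag_le_left A
    · exact h.sum_normSq_diag_le_right A
  rw [h1]
  refine le_trans ?_ (mul_le_mul_of_nonneg_left h2 (Real.sqrt_nonneg _))
  rw [← Real.sqrt_mul (Finset.sum_nonneg fun a _ => sq_nonneg _)]
  refine Real.abs_le_sqrt ((Finset.sum_mul_sq_le_sq_mul_sq _ _ _).trans ?_)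
  refine mul_le_mul_of_nonneg_left (Finset.sum_le_sum fun a _ => ?_)
    (Finset.sum_nonneg fun a _ => sq_nonneg _)
  rw [Complex.normSq_apply]
  nlinarith [sq_nonneg (A a a).im]

theorem trace_aeval (g : Polynomial ℝ) :
    (Polynomial.aeval (relEnd K H) g).trace.re = ∑ a, g.eval (l a) := by
  rw [h.aeval_relEnd, h.trace_conj]
  simp [realDiag, Matrix.trace]

theorem relEnd_inv : (relEnd K H)⁻¹ = relEnd H K := by
  rw [relEnd, relEnd, Matrix.mul_inv_rev, Matrix.nonsing_inv_nonsing_inv _ h.isUnit_left]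

end SimDiag

end SimultaneousDiagonalization

end NHYM

namespace NHYM

open Filter Topology

/-! ### The pseudo-curvature as the trace of the covariant derivative of `ψ`. -/

section Tension

variable {n r : ℕ}

/-- The component `α(Z, Z̄)` of a bilinear form, where `Z = (b - i J b)/2`. -/
noncomputable def diag11 {W : Type*} [AddCommGroup W] [Module ℂ W] (α : (Fin n → ℂ) → (Fin n → ℂ) → W)
    (b : Fin n → ℂ) : W :=
  (1 / 4 : ℂ) • (α b b + α (Complex.I • b) (Complex.I • b)
    + Complex.I • α b (Complex.I • b) - Complex.I • α (Complex.I • b) b)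

/-- The sum of `F` over the real frame `b₁, J b₁, …, bₙ, J bₙ`. -/
def frameSum {W : Type*} [AddCommMonoid W] (b : Fin n → Fin n → ℂ) (F : (Fin n → ℂ) → W) : W :=
  ∑ l, (F (b l) + F (Complex.I • b l))

variable (A : (Fin n → ℂ) → (Fin n → ℂ) → Matrix (Fin r) (Fin r) ℂ)
  (M H K : (Fin n → ℂ) → Matrix (Fin r) (Fin r) ℂ)

/-- The form `ψ` of the decomposition `d + A = D_M + ψ` of a connection on a trivial bundle. -/
noncomputable def localPsi (y u : Fin n → ℂ) : Matrix (Fin r) (Fin r) ℂ :=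
  selfAdjPart (M y) (A y u) (dirDeriv M y u)

/-- The form `θ` with `∂̄_M + ψ^{1,0} = ∂̄ + θ`. -/
noncomputable def localTheta (ψ : (Fin n → ℂ) → (Fin n → ℂ) → Matrix (Fin r) (Fin r) ℂ) (y u : Fin n → ℂ) :
    Matrix (Fin r) (Fin r) ℂ :=
  part01 (fun v => A y v - ψ y v) u + part10 (fun v => ψ y v) u

/-- The form of the connection adjoint to `d + A` with respect to `M`. -/
noncomputable def adjForm (y u : Fin n → ℂ) : Matrix (Fin r) (Fin r) ℂ :=
  (M y)⁻¹ * dirDeriv M y u - adj (M y) (A y u)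

/-- The covariant derivative of `ψ(v)` along `v`. -/
noncomputable def covDiag (ψ : (Fin n → ℂ) → (Fin n → ℂ) → Matrix (Fin r) (Fin r) ℂ) (y v : Fin n → ℂ) :
    Matrix (Fin r) (Fin r) ℂ :=
  dirDeriv (fun z => ψ z v) y v + (A y v * ψ y v - ψ y v * A y v)

variable {A M H K} {ψ : (Fin n → ℂ) → (Fin n → ℂ) → Matrix (Fin r) (Fin r) ℂ} {y : Fin n → ℂ}

theorem I_smul_I_smul (b : Fin n → ℂ) : Complex.I • (Complex.I • b) = -b := by
  rw [smul_smul, Complex.I_mul_I, neg_one_smul]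

theorem adjForm_eq (u : Fin n → ℂ) :
    adjForm A M y u = A y u - (2 : ℂ) • localPsi A M y u := by
  rw [adjForm, localPsi, selfAdjPart]
  module

theorem diag11_dbarCurv (θ : (Fin n → ℂ) → (Fin n → ℂ) → Matrix (Fin r) (Fin r) ℂ)
    (b : Fin n → ℂ) : diag11 (dbarCurv θ y) b
      = (Complex.I / 2) • dbarCurv θ y b (Complex.I • b) := by
  have h1 : ∀ u v, dbarCurv θ y u v = -dbarCurv θ y v u := fun u v => by
    simp only [dbarCurv]; abel
  have h2 : ∀ u, dbarCurv θ y u u = 0 := fun u => by simp only [dbarCurv]; abel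
  rw [diag11, h2, h2, h1 (Complex.I • b) b]
  module

theorem diag11_curv (b : Fin n → ℂ) : diag11 (curv A y) b
    = (Complex.I / 2) • curv A y b (Complex.I • b) := by
  have h1 : ∀ u v, curv A y u v = -curv A y v u := fun u v => by simp only [curv]; abel
  have h2 : ∀ u, curv A y u u = 0 := fun u => by simp only [curv]; abel
  rw [diag11, h2, h2, h1 (Complex.I • b) b]
  module

/-- On the complex line of `b` the form `θ` is explicit (`t1`, `t2`). After expansion the
derivatives of `ψ` separate into its divergence along `b` and `Jb`, and the rest is the difference
of the curvatures of `d + A` and of its adjoint connection `d + A - 2ψ`. Oddness of the forms is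
needed because `J² = -1`. -/
theorem diag11_dbarCurv_localTheta (hA : ∀ v, EntryDiff (fun z => A z v) y)
    (hψ : ∀ v, EntryDiff (fun z => ψ z v) y)
    (hAn : ∀ᶠ z in 𝓝 y, ∀ v, A z (-v) = -A z v) (hψn : ∀ᶠ z in 𝓝 y, ∀ v, ψ z (-v) = -ψ z v)
    (b : Fin n → ℂ) :
    (4 : ℂ) • diag11 (dbarCurv (localTheta A ψ) y) b
      = -(covDiag A ψ y b + covDiag A ψ y (Complex.I • b))
        + (diag11 (curv A y) b - diag11 (curv (fun z v => A z v - (2 : ℂ) • ψ z v) y) b) := by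
  rw [diag11_dbarCurv, diag11_curv, diag11_curv]
  set b' := Complex.I • b with hb'
  have hbb : Complex.I • b' = -b := I_smul_I_smul b
  have t1 : ∀ᶠ z in 𝓝 y, localTheta A ψ z b
      = (1 / 2 : ℂ) • (A z b + Complex.I • A z b') - Complex.I • ψ z b' := by
    filter_upwards with z
    simp only [localTheta, part01, part10, ← hb']
    module
  have t2 : ∀ᶠ z in 𝓝 y, localTheta A ψ z b'
      = (1 / 2 : ℂ) • (A z b' - Complex.I • A z b) + Complex.I • ψ z b := by
    filter_upwards [hAn, hψn] with z h1 h2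
    simp only [localTheta, part01, part10, hbb, h1, h2]
    module
  have d1 : ∀ u, dirDeriv (fun z => localTheta A ψ z b) y u
      = (1 / 2 : ℂ) • (dirDeriv (fun z => A z b) y u + Complex.I • dirDeriv (fun z => A z b') y u)
        - Complex.I • dirDeriv (fun z => ψ z b') y u := fun u => by
    rw [dirDeriv_congr t1, dirDeriv_sub (((hA b).add ((hA b').smul _)).smul _) ((hψ b').smul _),
      dirDeriv_smul _ ((hA b).add ((hA b').smul _)), dirDeriv_add (hA b) ((hA b').smul _),
      dirDeriv_smul _ (hA b'), dirDeriv_smul _ (hψ b')]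
  have d2 : ∀ u, dirDeriv (fun z => localTheta A ψ z b') y u
      = (1 / 2 : ℂ) • (dirDeriv (fun z => A z b') y u - Complex.I • dirDeriv (fun z => A z b) y u)
        + Complex.I • dirDeriv (fun z => ψ z b) y u := fun u => by
    rw [dirDeriv_congr t2, dirDeriv_add (((hA b').sub ((hA b).smul _)).smul _) ((hψ b).smul _),
      dirDeriv_smul _ ((hA b').sub ((hA b).smul _)), dirDeriv_sub (hA b') ((hA b).smul _),
      dirDeriv_smul _ (hA b), dirDeriv_smul _ (hψ b)]
  have d3 : ∀ v u, dirDeriv (fun z => A z v - (2 : ℂ) • ψ z v) y u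
      = dirDeriv (fun z => A z v) y u - (2 : ℂ) • dirDeriv (fun z => ψ z v) y u := fun v u => by
    rw [dirDeriv_sub (hA v) ((hψ v).smul _), dirDeriv_smul _ (hψ v)]
  simp only [dbarCurv, dbarDeriv, curv, covDiag, d1, d2, d3, t1.self_of_nhds, t2.self_of_nhds,
    hbb, dirDeriv_neg_dir, ← hb']
  simp only [mul_add, add_mul, mul_sub, sub_mul, smul_mul_assoc, mul_smul_comm, smul_add, smul_sub,
    smul_neg, smul_smul]
  match_scalars <;> ring_nf <;> simp [Complex.I_sq]

/-- The form is `M⁻¹(dM - A*M)`. In its curvature the second derivatives of `M` cancel by symmetry,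
the terms quadratic in `dM` cancel against the derivative of `M⁻¹`, and the adjoint of `F` remains
with a sign. -/
theorem curv_adjForm (hA : ∀ v, EntryDiff (fun z => A z v) y) (hM : EntryC2 M y)
    (hu : IsUnit (M y).det) (u v : Fin n → ℂ) :
    curv (adjForm A M) y u v = -adj (M y) (curv A y u v) := by
  have hMA : ∀ v, EntryDiff (fun z => (A z v)ᴴ * M z) y := fun v =>
    (hA v).conjTranspose.mul hM.diff
  have hB : ∀ v, EntryDiff (fun z => dirDeriv M z v - (A z v)ᴴ * M z) y := fun v =>
    hM.entryDiff_dirDeriv.sub (hMA v)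
  have d : ∀ v u, dirDeriv (fun z => adjForm A M z v) y u
      = -((M y)⁻¹ * dirDeriv M y u * (M y)⁻¹) * (dirDeriv M y v - (A y v)ᴴ * M y)
        + (M y)⁻¹ * (dirDeriv (fun z => dirDeriv M z v) y u
          - ((dirDeriv (fun z => A z v) y u)ᴴ * M y + (A y v)ᴴ * dirDeriv M y u)) := by
    intro v u
    have h1 : ∀ᶠ z in 𝓝 y, adjForm A M z v = (M z)⁻¹ * (dirDeriv M z v - (A z v)ᴴ * M z) := by
      filter_upwards with z
      rw [adjForm, adj, mul_sub, mul_assoc]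
    rw [dirDeriv_congr h1, dirDeriv_mul (hM.inv hu).diff (hB v), dirDeriv_inv hM hu,
      dirDeriv_sub hM.entryDiff_dirDeriv (hMA v),
      dirDeriv_mul (hA v).conjTranspose hM.diff, dirDeriv_conjTranspose]
  simp only [curv, d, dirDeriv_comm hM (u := v) (v := u)]
  simp only [adjForm, adj, Matrix.conjTranspose_add, Matrix.conjTranspose_sub,
    Matrix.conjTranspose_mul]
  have hc := fun B : Matrix (Fin r) (Fin r) ℂ => Matrix.mul_nonsing_inv_cancel_left (M y) B hu
  simp only [mul_add, add_mul, mul_sub, sub_mul, mul_assoc, hc, neg_mul]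
  abel

theorem covDiag_smul_sub (φ : (Fin n → ℂ) → (Fin n → ℂ) → Matrix (Fin r) (Fin r) ℂ) (c : ℂ)
    (v : Fin n → ℂ) (hψ : EntryDiff (fun z => ψ z v) y) (hφ : EntryDiff (fun z => φ z v) y) :
    covDiag A (fun z v => c • (ψ z v - φ z v)) y v = c • (covDiag A ψ y v - covDiag A φ y v) := by
  simp only [covDiag]
  rw [dirDeriv_smul _ (hψ.sub hφ), dirDeriv_sub hψ hφ]
  simp only [mul_sub, sub_mul, mul_smul_comm, smul_mul_assoc]
  module

theorem EntryDiff.localPsi (hA : ∀ v, EntryDiff (fun z => A z v) y) (hM : EntryC2 M y)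
    (hu : IsUnit (M y).det) (v : Fin n → ℂ) : EntryDiff (fun z => localPsi A M z v) y := by
  refine EntryDiff.smul _ (((hA v).add ?_).sub ((hM.inv hu).diff.mul hM.entryDiff_dirDeriv))
  exact ((hM.inv hu).diff.mul (hA v).conjTranspose).mul hM.diff

theorem localPsi_neg {z : Fin n → ℂ} (h : ∀ v, A z (-v) = -A z v) (v : Fin n → ℂ) :
    localPsi A M z (-v) = -localPsi A M z v := by
  simp only [localPsi, selfAdjPart, adj, h, dirDeriv_neg_dir, Matrix.conjTranspose_neg, mul_neg,
    neg_mul]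
  module

/-- If `√-1 Λ F` is a real multiple of the identity, then `4 √-1 Λ G_M = -tr ∇ψ`. -/
theorem four_smul_sum_diag11_dbarCurv (hA : ∀ v, EntryDiff (fun z => A z v) y)
    (hAn : ∀ᶠ z in 𝓝 y, ∀ v, A z (-v) = -A z v) (hM : EntryC2 M y) (hu : IsUnit (M y).det)
    (b : Fin n → Fin n → ℂ) {c : ℝ}
    (hF : ∑ l, diag11 (curv A y) (b l) = (c : ℂ) • (1 : Matrix (Fin r) (Fin r) ℂ)) :
    (4 : ℂ) • ∑ l, diag11 (dbarCurv (localTheta A (localPsi A M)) y) (b l)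
      = -frameSum b (covDiag A (localPsi A M) y) := by
  -- The sign from `curv_adjForm` is offset by the conjugation of the factor `i/2` in `diag11_curv`.
  have hB : ∀ l, diag11 (curv (fun z v => A z v - (2 : ℂ) • localPsi A M z v) y) (b l)
      = adj (M y) (diag11 (curv A y) (b l)) := by
    intro l
    have : (fun z v => A z v - (2 : ℂ) • localPsi A M z v) = adjForm A M := by
      funext z v; rw [adjForm_eq]
    rw [this, diag11_curv, diag11_curv, curv_adjForm hA hM hu]
    simp only [adj, Matrix.conjTranspose_smul, mul_smul_comm, smul_mul_assoc]
    rw [show star (Complex.I / 2) = -(Complex.I / 2) by simp; ring]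
    module
  -- A real multiple of the identity is its own adjoint for every metric, so the two curvature terms
  -- cancel.
  have hadj : ∑ l, adj (M y) (diag11 (curv A y) (b l)) = ∑ l, diag11 (curv A y) (b l) := by
    have : ∑ l, adj (M y) (diag11 (curv A y) (b l))
        = adj (M y) (∑ l, diag11 (curv A y) (b l)) := by
      simp only [adj, Matrix.conjTranspose_sum, Finset.mul_sum, Finset.sum_mul]
    rw [this, hF, adj]
    simp [Matrix.conjTranspose_smul, Matrix.nonsing_inv_mul _ hu]
  rw [Finset.smul_sum]
  simp only [diag11_dbarCurv_localTheta hA (fun v => EntryDiff.localPsi hA hM hu v) hAn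
    (hAn.mono fun z hz => localPsi_neg hz), hB]
  rw [Finset.sum_add_distrib, Finset.sum_sub_distrib, hadj, sub_self, add_zero, frameSum,
    Finset.sum_neg_distrib]

end Tension

end NHYM

namespace NHYM

open Filter Topology Polynomial

/-! ### Derivatives of polynomials in `h`, and the difference of the adjoint connections. -/

section TracePolynomial

variable {n r : ℕ} {A : (Fin n → ℂ) → (Fin n → ℂ) → Matrix (Fin r) (Fin r) ℂ}
  {M H K : (Fin n → ℂ) → Matrix (Fin r) (Fin r) ℂ} {y : Fin n → ℂ}

theorem EntryC2.const_smul (c : ℂ) (hM : EntryC2 M y) : EntryC2 (fun z => c • M z) y :=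
  fun i j => (hM i j).const_smul c

theorem EntryC2.pow (hM : EntryC2 M y) (k : ℕ) : EntryC2 (fun z => M z ^ k) y := by
  induction k with
  | zero =>
    simp only [pow_zero]
    exact fun i j => contDiffAt_const
  | succ k ih => simpa only [pow_succ] using ih.mul hM

theorem algebraMap_mul_eq_smul (c : ℝ) (B : Matrix (Fin r) (Fin r) ℂ) :
    algebraMap ℝ (Matrix (Fin r) (Fin r) ℂ) c * B = (c : ℂ) • B := by
  rw [Algebra.algebraMap_eq_smul_one, smul_mul_assoc, one_mul, Complex.coe_smul]

theorem EntryC2.aeval (hM : EntryC2 M y) (f : ℝ[X]) :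
    EntryC2 (fun z => Polynomial.aeval (M z) f) y := by
  induction f using Polynomial.induction_on' with
  | add p q hp hq =>
    intro i j
    simp only [map_add, Matrix.add_apply]
    exact (hp i j).add (hq i j)
  | monomial k c =>
    simp only [aeval_monomial, algebraMap_mul_eq_smul]
    exact (hM.pow k).const_smul _

theorem dirDeriv_pow_succ (hM : EntryC2 M y) (k : ℕ) (v : Fin n → ℂ) :
    dirDeriv (fun z => M z ^ (k + 1)) y v
      = dirDeriv M y v * M y ^ k + M y * dirDeriv (fun z => M z ^ k) y v := by
  simp only [pow_succ']
  exact dirDeriv_mul hM.diff (hM.pow k).diff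

theorem dirDeriv_aeval_add (hM : EntryC2 M y) (p q : ℝ[X]) (v : Fin n → ℂ) :
    dirDeriv (fun z => aeval (M z) (p + q)) y v
      = dirDeriv (fun z => aeval (M z) p) y v + dirDeriv (fun z => aeval (M z) q) y v := by
  simp only [map_add]
  exact dirDeriv_add (hM.aeval p).diff (hM.aeval q).diff

theorem dirDeriv_aeval_monomial (hM : EntryC2 M y) (k : ℕ) (c : ℝ) (v : Fin n → ℂ) :
    dirDeriv (fun z => aeval (M z) (monomial k c)) y v
      = (c : ℂ) • dirDeriv (fun z => M z ^ k) y v := by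
  simp only [aeval_monomial, algebraMap_mul_eq_smul]
  exact dirDeriv_smul _ (hM.pow k).diff

/-- Under the trace all terms of the Leibniz rule agree by cyclicity. The extra power `j` makes the
induction close; at `k = 0` the truncated exponent is harmless because its coefficient vanishes. -/
theorem trace_pow_mul_dirDeriv_pow (hM : EntryC2 M y) (k j : ℕ) (v : Fin n → ℂ) :
    (M y ^ j * dirDeriv (fun z => M z ^ k) y v).trace
      = k * (M y ^ (k - 1 + j) * dirDeriv M y v).trace := by
  induction k generalizing j with
  | zero => simp [dirDeriv_const]
  | succ k ih =>
    rw [dirDeriv_pow_succ hM, mul_add, Matrix.trace_add, ← mul_assoc (M y ^ j) (M y), ← pow_succ, ih,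
      ← mul_assoc, Matrix.trace_mul_cycle, ← pow_add]
    rcases k with _ | k
    · simp
    · simp only [Nat.add_sub_cancel]
      rw [show k + (j + 1) = k + 1 + j by ring]
      push_cast
      ring

theorem trace_dirDeriv_aeval (hM : EntryC2 M y) (f : ℝ[X]) (v : Fin n → ℂ) :
    (dirDeriv (fun z => aeval (M z) f) y v).trace
      = (aeval (M y) (derivative f) * dirDeriv M y v).trace := by
  induction f using Polynomial.induction_on' with
  | add p q hp hq =>
    rw [dirDeriv_aeval_add hM, Matrix.trace_add, hp, hq, map_add, map_add, add_mul, Matrix.trace_add]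
  | monomial k c =>
    have := trace_pow_mul_dirDeriv_pow hM k 0 v
    rw [pow_zero, one_mul, add_zero] at this
    rw [dirDeriv_aeval_monomial hM, Matrix.trace_smul, this, derivative_monomial, aeval_monomial,
      algebraMap_mul_eq_smul, smul_mul_assoc, Matrix.trace_smul]
    simp [mul_assoc]

/-- Commutation with a power series: the divided differences of a polynomial describe the
derivative of the polynomial of a matrix in an eigenbasis of the matrix. -/
theorem exists_dividedDifference (g : ℝ[X]) : ∃ d : ℝ → ℝ → ℝ,
    (∀ a b, d a b * (a - b) = g.eval a - g.eval b) ∧ (∀ a, d a a = (derivative g).eval a) ∧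
    ∀ {n r : ℕ} {M : (Fin n → ℂ) → Matrix (Fin r) (Fin r) ℂ} {y : Fin n → ℂ}
      {P B : Matrix (Fin r) (Fin r) ℂ} {l : Fin r → ℝ} (v : Fin n → ℂ), EntryC2 M y →
      IsUnit P.det → M y = P * realDiag l * P⁻¹ → ∀ a b,
      (P⁻¹ * (dirDeriv (fun z => aeval (M z) g) y v
        + (B * aeval (M y) g - aeval (M y) g * B)) * P) a b
        = d (l a) (l b) * (P⁻¹ * (dirDeriv M y v + (B * M y - M y * B)) * P) a b := by
  induction g using Polynomial.induction_on' with
  | add p q hp hq =>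
    obtain ⟨d, h1, h2, h3⟩ := hp
    obtain ⟨e, k1, k2, k3⟩ := hq
    refine ⟨fun a b => d a b + e a b, fun a b => ?_, fun a => ?_, ?_⟩
    · rw [add_mul, h1, k1, eval_add, eval_add]; ring
    · simp only [h2, k2, derivative_add, eval_add]
    · intro n r M y P B l v hM hP hd a b
      have e1 := h3 (B := B) v hM hP hd a b
      have e2 := k3 (B := B) v hM hP hd a b
      rw [Complex.ofReal_add, add_mul (d (l a) (l b) : ℂ), ← e1, ← e2, ← Matrix.add_apply,
        dirDeriv_aeval_add hM, map_add]
      refine congrFun (congrFun ?_ a) b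
      noncomm_ring
  | monomial k c =>
    suffices h : ∃ d : ℝ → ℝ → ℝ,
        (∀ a b, d a b * (a - b) = a ^ k - b ^ k) ∧ (∀ a, d a a = k * a ^ (k - 1)) ∧
        ∀ {n r : ℕ} {M : (Fin n → ℂ) → Matrix (Fin r) (Fin r) ℂ} {y : Fin n → ℂ}
          {P B : Matrix (Fin r) (Fin r) ℂ} {l : Fin r → ℝ} (v : Fin n → ℂ), EntryC2 M y →
          IsUnit P.det → M y = P * realDiag l * P⁻¹ → ∀ a b,
          (P⁻¹ * (dirDeriv (fun z => M z ^ k) y v + (B * M y ^ k - M y ^ k * B)) * P) a b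
            = d (l a) (l b) * (P⁻¹ * (dirDeriv M y v + (B * M y - M y * B)) * P) a b by
      obtain ⟨d, h1, h2, h3⟩ := h
      refine ⟨fun a b => c * d a b, fun a b => ?_, fun a => ?_, ?_⟩
      · rw [mul_assoc, h1, eval_monomial, eval_monomial]; ring
      · simp only [h2, derivative_monomial, eval_monomial]; ring
      · intro n r M y P B l v hM hP hd a b
        have e1 := h3 (B := B) v hM hP hd a b
        rw [Complex.ofReal_mul, mul_assoc (c : ℂ), ← e1,
          dirDeriv_aeval_monomial hM, aeval_monomial, algebraMap_mul_eq_smul]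
        simp only [mul_smul_comm, smul_mul_assoc, ← smul_sub, ← smul_add]
        rfl
    induction k with
    | zero =>
      refine ⟨fun _ _ => 0, by simp, by simp, ?_⟩
      intro n r M y P B l v hM hP hd a b
      simp [dirDeriv_const]
    | succ k ih =>
      obtain ⟨d, h1, h2, h3⟩ := ih
      -- The Leibniz rule for `M · M ^ k` in the eigenframe: differentiating the first factor leaves
      -- `b ^ k` on the right, differentiating the second leaves `a` on the left.
      refine ⟨fun a b => b ^ k + a * d a b, fun a b => ?_, fun a => ?_, ?_⟩
      · linear_combination a * h1 a b
      · simp only [h2]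
        rcases k with _ | k
        · simp
        · rw [Nat.add_sub_cancel, Nat.add_sub_cancel]
          push_cast
          ring
      · intro n r M y P B l v hM hP hd a b
        have hPP : P * P⁻¹ = 1 := Matrix.mul_nonsing_inv _ hP
        have hPP' : P⁻¹ * P = 1 := Matrix.nonsing_inv_mul _ hP
        have hleft : P⁻¹ * M y = realDiag l * P⁻¹ := by
          rw [hd, mul_assoc, ← mul_assoc, hPP', one_mul]
        have hpow : ∀ k : ℕ, M y ^ k * P = P * realDiag (fun a => l a ^ k) := by
          intro k
          induction k with
          | zero => simp [realDiag_one]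
          | succ k ih =>
            rw [pow_succ', mul_assoc, ih, hd]
            calc _ = P * realDiag l * (P⁻¹ * P) * realDiag (fun a => l a ^ k) := by
                  simp only [mul_assoc]
              _ = _ := by
                  rw [hPP', mul_one, mul_assoc, realDiag_mul]
                  simp only [pow_succ']
        have key : P⁻¹ * (dirDeriv (fun z => M z ^ (k + 1)) y v
              + (B * M y ^ (k + 1) - M y ^ (k + 1) * B)) * P
            = (P⁻¹ * (dirDeriv M y v + (B * M y - M y * B)) * P) * realDiag (fun a => l a ^ k)
              + realDiag l * (P⁻¹ * (dirDeriv (fun z => M z ^ k) y v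
                + (B * M y ^ k - M y ^ k * B)) * P) := by
          rw [dirDeriv_pow_succ hM, mul_assoc _ P, ← hpow, ← mul_assoc (realDiag l),
            ← mul_assoc (realDiag l), ← hleft, pow_succ']
          noncomm_ring
        rw [key, Matrix.add_apply, realDiag, realDiag, Matrix.mul_diagonal, Matrix.diagonal_mul,
          h3 (B := B) v hM hP hd a b]
        push_cast
        ring

/-- The Hermitian metrics and the connection form near a point of a trivial bundle. -/
structure LocalPair (A : (Fin n → ℂ) → (Fin n → ℂ) → Matrix (Fin r) (Fin r) ℂ)
    (K H : (Fin n → ℂ) → Matrix (Fin r) (Fin r) ℂ) (y : Fin n → ℂ) : Prop where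
  form_diff : ∀ v, EntryDiff (fun z => A z v) y
  form_neg : ∀ᶠ z in 𝓝 y, ∀ v, A z (-v) = -A z v
  left : EntryC2 K y
  right : EntryC2 H y
  left_pos : ∀ᶠ z in 𝓝 y, (K z).PosDef
  right_pos : ∀ᶠ z in 𝓝 y, (H z).PosDef

theorem LocalPair.symm (h : LocalPair A K H y) : LocalPair A H K y :=
  ⟨h.form_diff, h.form_neg, h.right, h.left, h.right_pos, h.left_pos⟩

theorem isUnit_det_of_posDef {B : Matrix (Fin r) (Fin r) ℂ} (h : B.PosDef) : IsUnit B.det :=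
  (Matrix.isUnit_iff_isUnit_det _).1 h.isUnit

/-- The difference `β` of the adjoint connections of `H` and `K`. -/
noncomputable def adjDiff (A : (Fin n → ℂ) → (Fin n → ℂ) → Matrix (Fin r) (Fin r) ℂ)
    (K H : (Fin n → ℂ) → Matrix (Fin r) (Fin r) ℂ) (y u : Fin n → ℂ) : Matrix (Fin r) (Fin r) ℂ :=
  adjForm A H y u - adjForm A K y u

theorem adjDiff_eq (z v : Fin n → ℂ) :
    adjDiff A K H z v = (-2 : ℂ) • (localPsi A H z v - localPsi A K z v) := by
  rw [adjDiff, adjForm_eq, adjForm_eq]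
  module

theorem dirDeriv_relEnd (hK : EntryC2 K y) (hH : EntryC2 H y) (hKu : IsUnit (K y).det)
    (v : Fin n → ℂ) : dirDeriv (fun z => relEnd (K z) (H z)) y v
      = (K y)⁻¹ * dirDeriv H y v - (K y)⁻¹ * dirDeriv K y v * (K y)⁻¹ * H y := by
  simp only [relEnd]
  rw [dirDeriv_mul (hK.inv hKu).diff hH.diff, dirDeriv_inv hK hKu]
  noncomm_ring

/-- The adjoint connections of `H` and `K` are conjugate by `h`, so `h β` is the derivative of `h`
for the adjoint connection of `K`. -/
theorem relEnd_mul_adjDiff (hK : EntryC2 K y) (hH : EntryC2 H y) (hKu : IsUnit (K y).det)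
    (hHu : IsUnit (H y).det) (v : Fin n → ℂ) :
    relEnd (K y) (H y) * adjDiff A K H y v
      = dirDeriv (fun z => relEnd (K z) (H z)) y v
        + (adjForm A K y v * relEnd (K y) (H y) - relEnd (K y) (H y) * adjForm A K y v) := by
  rw [dirDeriv_relEnd hK hH hKu]
  have hc := fun B : Matrix (Fin r) (Fin r) ℂ => Matrix.mul_nonsing_inv_cancel_left (K y) B hKu
  have hc' := fun B : Matrix (Fin r) (Fin r) ℂ => Matrix.mul_nonsing_inv_cancel_left (H y) B hHu
  simp only [adjDiff, adjForm, adj, relEnd]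
  simp only [mul_sub, sub_mul, mul_assoc, hc, hc']
  abel

/-- Since `h` is self-adjoint for `K`, taking adjoints turns its derivative under `D` into its
derivative under the adjoint connection, which is `h β`. Thus `β` is the adjoint of `∇h` up to a
factor `h⁻¹`, and products of `∇h` with `β` become sums of squares. -/
theorem adj_covDeriv_relEnd (hK : EntryC2 K y) (hH : EntryC2 H y) (hKp : ∀ᶠ z in 𝓝 y, (K z).PosDef)
    (hHp : ∀ᶠ z in 𝓝 y, (H z).PosDef) (v : Fin n → ℂ) :
    adj (K y) (dirDeriv (fun z => relEnd (K z) (H z)) y v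
      + (A y v * relEnd (K y) (H y) - relEnd (K y) (H y) * A y v))
      = relEnd (K y) (H y) * adjDiff A K H y v := by
  have hKu := isUnit_det_of_posDef hKp.self_of_nhds
  have hHu := isUnit_det_of_posDef hHp.self_of_nhds
  have hdK : (dirDeriv K y v)ᴴ = dirDeriv K y v := by
    rw [← dirDeriv_conjTranspose]
    exact dirDeriv_congr (hKp.mono fun z hz => hz.1)
  have hdH : (dirDeriv H y v)ᴴ = dirDeriv H y v := by
    rw [← dirDeriv_conjTranspose]
    exact dirDeriv_congr (hHp.mono fun z hz => hz.1)
  have hKH : (K y)ᴴ = K y := hKp.self_of_nhds.1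
  have hHH : (H y)ᴴ = H y := hHp.self_of_nhds.1
  rw [relEnd_mul_adjDiff hK hH hKu hHu, dirDeriv_relEnd hK hH hKu]
  have hc := fun B : Matrix (Fin r) (Fin r) ℂ => Matrix.mul_nonsing_inv_cancel_left (K y) B hKu
  simp only [adj, adjForm, relEnd, Matrix.conjTranspose_add, Matrix.conjTranspose_sub,
    Matrix.conjTranspose_mul, Matrix.conjTranspose_nonsing_inv, hKH, hHH, hdK, hdH]
  simp only [mul_add, add_mul, mul_sub, sub_mul, mul_assoc, hc, Matrix.nonsing_inv_mul _ hKu,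
    mul_one]
  abel

end TracePolynomial

end NHYM

namespace NHYM

open Filter Topology Polynomial

/-! ### First and second derivatives of `tr f(h)`. -/

section TraceHessian

variable {n r : ℕ} {A : (Fin n → ℂ) → (Fin n → ℂ) → Matrix (Fin r) (Fin r) ℂ}
  {H K : (Fin n → ℂ) → Matrix (Fin r) (Fin r) ℂ} {y : Fin n → ℂ}

theorem fderiv_re {F : (Fin n → ℂ) → ℂ} (hF : DifferentiableAt ℝ F y) (v : Fin n → ℂ) :
    fderiv ℝ (fun z => (F z).re) y v = (fderiv ℝ F y v).re := by
  have := (Complex.reCLM.hasFDerivAt.comp y hF.hasFDerivAt).fderiv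
  simp only [Function.comp_def, Complex.reCLM_apply] at this
  rw [this]
  rfl

theorem EntryC2.relEnd (hK : EntryC2 K y) (hH : EntryC2 H y) (hKu : IsUnit (K y).det) :
    EntryC2 (fun z => relEnd (K z) (H z)) y := (hK.inv hKu).mul hH

theorem EntryDiff.adjDiff (hA : ∀ v, EntryDiff (fun z => A z v) y) (hK : EntryC2 K y)
    (hH : EntryC2 H y) (hKu : IsUnit (K y).det) (hHu : IsUnit (H y).det) (v : Fin n → ℂ) :
    EntryDiff (fun z => adjDiff A K H z v) y := by
  simp only [adjDiff_eq]
  exact ((EntryDiff.localPsi hA hH hHu v).sub (EntryDiff.localPsi hA hK hKu v)).smul _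

/-- The derivative of `h` is `h β` minus a commutator with `h`, and `f'(h)` commutes with `h`, so
the commutator has no trace against it. -/
theorem fderiv_trace_aeval (hK : EntryC2 K y) (hH : EntryC2 H y) (hKu : IsUnit (K y).det)
    (hHu : IsUnit (H y).det) (f : ℝ[X]) (v : Fin n → ℂ) :
    fderiv ℝ (fun z => (aeval (relEnd (K z) (H z)) f).trace) y v
      = (aeval (relEnd (K y) (H y)) (derivative f * X) * adjDiff A K H y v).trace := by
  have hh := hK.relEnd hH hKu
  rw [fderiv_trace (hh.aeval f).diff, trace_dirDeriv_aeval hh,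
    eq_sub_of_add_eq (relEnd_mul_adjDiff (A := A) hK hH hKu hHu v).symm, map_mul, aeval_X]
  set h := NHYM.relEnd (K y) (H y)
  set F := aeval h (derivative f)
  have hc : F * h = h * F := by
    have h1 : F * h = aeval h (derivative f * X) := by rw [map_mul, aeval_X]
    rw [h1, mul_comm, map_mul, aeval_X]
  set B := adjForm A K y v
  have h2 : (F * (B * h - h * B)).trace = 0 := by
    rw [mul_sub, Matrix.trace_sub, ← mul_assoc, ← mul_assoc, hc, Matrix.trace_mul_comm, ← mul_assoc,
      sub_self]
  rw [mul_sub, Matrix.trace_sub, h2, sub_zero, mul_assoc]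

/-- The terms of the second derivative of `tr f(h)` that are quadratic in the derivative of `h`. -/
noncomputable def traceHessianGrad (A : (Fin n → ℂ) → (Fin n → ℂ) → Matrix (Fin r) (Fin r) ℂ)
    (K H : (Fin n → ℂ) → Matrix (Fin r) (Fin r) ℂ) (f : ℝ[X]) (y v : Fin n → ℂ) : ℝ :=
  ((dirDeriv (fun z => aeval (relEnd (K z) (H z)) (derivative f * X)) y v
    + (A y v * aeval (relEnd (K y) (H y)) (derivative f * X)
      - aeval (relEnd (K y) (H y)) (derivative f * X) * A y v)) * adjDiff A K H y v).trace.re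

theorem LocalPair.contDiffAt (h : LocalPair A K H y) (f : ℝ[X]) :
    ContDiffAt ℝ 2 (fun z => (aeval (relEnd (K z) (H z)) f).trace.re) y :=
  Complex.reCLM.contDiff.contDiffAt.comp y
    ((h.left.relEnd h.right (isUnit_det_of_posDef h.left_pos.self_of_nhds)).aeval f).trace

theorem LocalPair.fderiv_eq (h : LocalPair A K H y) (f : ℝ[X]) (v : Fin n → ℂ) :
    fderiv ℝ (fun z => (aeval (relEnd (K z) (H z)) f).trace.re) y v
      = (aeval (relEnd (K y) (H y)) (derivative f * X) * adjDiff A K H y v).trace.re := by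
  have hKu := isUnit_det_of_posDef h.left_pos.self_of_nhds
  have hHu := isUnit_det_of_posDef h.right_pos.self_of_nhds
  rw [fderiv_re ((h.left.relEnd h.right hKu).aeval f).diff.trace,
    fderiv_trace_aeval h.left h.right hKu hHu]

theorem LocalPair.hessian_eq (h : LocalPair A K H y) (f : ℝ[X]) (v : Fin n → ℂ) :
    fderiv ℝ (fun z' => fderiv ℝ (fun z => (aeval (relEnd (K z) (H z)) f).trace.re) z' v) y v
      = (aeval (relEnd (K y) (H y)) (derivative f * X)
          * covDiag A (adjDiff A K H) y v).trace.re + traceHessianGrad A K H f y v := by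
  have hKu := isUnit_det_of_posDef h.left_pos.self_of_nhds
  have hHu := isUnit_det_of_posDef h.right_pos.self_of_nhds
  have hev : (fun z' => fderiv ℝ (fun z => (aeval (relEnd (K z) (H z)) f).trace.re) z' v)
      =ᶠ[𝓝 y] fun z' =>
        (aeval (relEnd (K z') (H z')) (derivative f * X) * adjDiff A K H z' v).trace.re := by
    filter_upwards [h.left.eventually, h.right.eventually, h.left_pos, h.right_pos]
      with z h1 h2 h3 h4
    have h3' := isUnit_det_of_posDef h3
    rw [fderiv_re ((h1.relEnd h2 h3').aeval f).diff.trace,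
      fderiv_trace_aeval (A := A) h1 h2 h3' (isUnit_det_of_posDef h4)]
  have hg := ((h.left.relEnd h.right hKu).aeval (derivative f * X)).diff
  have hβ := EntryDiff.adjDiff h.form_diff h.left h.right hKu hHu v
  rw [hev.fderiv_eq, fderiv_re (hg.mul hβ).trace, fderiv_trace (hg.mul hβ), dirDeriv_mul hg hβ,
    traceHessianGrad, ← Complex.add_re, ← Matrix.trace_add, covDiag]
  congr 1
  set g := aeval (relEnd (K y) (H y)) (derivative f * X)
  -- The traceless commutator `[A, g β]` is added, so that the ordinary derivatives of `g(h)` and of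
  -- `β` both become covariant.
  have h0 : (A y v * g * adjDiff A K H y v - g * adjDiff A K H y v * A y v).trace = 0 := by
    rw [Matrix.trace_sub, mul_assoc, Matrix.trace_mul_comm (A y v), sub_self]
  rw [← add_zero (Matrix.trace _), ← h0, ← Matrix.trace_add]
  congr 1
  noncomm_ring

/-- With `D` the matrix of `∇h` in the eigenframe and `d` the divided difference of `g`, the
quadratic term is `∑ d(l a, l b) (l b)⁻¹ |D a b|²`, while the first derivative of `tr f(h)` only
sees `Re (D a a)`. Monotonicity of `g` gives the sign; Cauchy–Schwarz on the diagonal gives the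
gradient bound. -/
theorem LocalPair.traceHessianGrad_bound (h : LocalPair A K H y) (f : ℝ[X]) (v : Fin n → ℂ)
    {P : Matrix (Fin r) (Fin r) ℂ} {l : Fin r → ℝ} (hd : SimDiag (K y) (H y) P l) {κ : ℝ}
    (hκ : 0 ≤ κ) (hf : ∀ a, 0 ≤ f.eval (l a))
    (hmono : ∀ a b, 0 ≤ ((derivative f * X).eval (l a) - (derivative f * X).eval (l b))
      * (l a - l b))
    (hder : ∀ a, 0 ≤ (derivative (derivative f * X)).eval (l a))
    (hgrad : ∀ a, (derivative f * X).eval (l a) ^ 2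
      ≤ κ * f.eval (l a) * (l a * (derivative (derivative f * X)).eval (l a))) :
    0 ≤ traceHessianGrad A K H f y v ∧
    (fderiv ℝ (fun z => (aeval (relEnd (K z) (H z)) f).trace.re) y v) ^ 2
      ≤ κ * (aeval (relEnd (K y) (H y)) f).trace.re * traceHessianGrad A K H f y v := by
  have hKu := isUnit_det_of_posDef h.left_pos.self_of_nhds
  have hh := h.left.relEnd h.right hKu
  set g := derivative f * X with hgdef
  obtain ⟨d, d1, d2, d3⟩ := exists_dividedDifference g
  set D := P⁻¹ * (dirDeriv (fun z => relEnd (K z) (H z)) y v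
    + (A y v * relEnd (K y) (H y) - relEnd (K y) (H y) * A y v)) * P with hD
  set Y := P⁻¹ * (dirDeriv (fun z => aeval (relEnd (K z) (H z)) g) y v
    + (A y v * aeval (relEnd (K y) (H y)) g - aeval (relEnd (K y) (H y)) g * A y v)) * P with hY
  have hYD : ∀ a b, Y a b = d (l a) (l b) * D a b := fun a b =>
    d3 (B := A y v) v hh hd.unit hd.relEnd_eq a b
  -- In the eigenframe the `K`-adjoint is the conjugate transpose, so `h β = (∇h)*` can be solved
  -- for `β`.
  have hβ : adjDiff A K H y v = P * (realDiag (fun a => (l a)⁻¹) * Dᴴ) * P⁻¹ := by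
    have h1 := adj_covDeriv_relEnd (A := A) h.left h.right h.left_pos h.right_pos v
    rw [hd.conj_eq (dirDeriv _ _ _ + _), ← hD, hd.adj_left, hd.relEnd_eq] at h1
    have h2 : realDiag (fun a => (l a)⁻¹) * realDiag l = 1 := mul_eq_one_comm.1 hd.diag_inv
    calc adjDiff A K H y v
        = P * ((realDiag (fun a => (l a)⁻¹) * realDiag l)) * P⁻¹ * adjDiff A K H y v := by
          rw [h2, mul_one, hd.mul_inv, one_mul]
      _ = P * realDiag (fun a => (l a)⁻¹) * (P⁻¹ * P) * realDiag l * P⁻¹ * adjDiff A K H y v := by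
          rw [hd.inv_mul, mul_one]; simp only [mul_assoc]
      _ = P * realDiag (fun a => (l a)⁻¹) * P⁻¹ * (P * realDiag l * P⁻¹ * adjDiff A K H y v) := by
          simp only [mul_assoc]
      _ = P * realDiag (fun a => (l a)⁻¹) * (P⁻¹ * P) * Dᴴ * P⁻¹ := by
          rw [← h1]; simp only [mul_assoc]
      _ = _ := by rw [hd.inv_mul, mul_one]; simp only [mul_assoc]
  have hconj : ∀ Z : Matrix (Fin r) (Fin r) ℂ, (P * Z * P⁻¹ * adjDiff A K H y v).trace
      = ∑ a, ∑ b, Z a b * ((((l b)⁻¹ : ℝ) : ℂ) * star (D a b)) := by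
    intro Z
    have : P * Z * P⁻¹ * adjDiff A K H y v
        = P * (Z * (realDiag (fun a => (l a)⁻¹) * Dᴴ)) * P⁻¹ := by
      rw [hβ]
      calc _ = P * Z * (P⁻¹ * P) * (realDiag (fun a => (l a)⁻¹) * Dᴴ) * P⁻¹ := by
            simp only [mul_assoc]
        _ = _ := by rw [hd.inv_mul, mul_one]; simp only [mul_assoc]
    rw [this, hd.trace_conj]
    have hent : ∀ b a, (realDiag (fun a => (l a)⁻¹) * Dᴴ) b a
        = (((l b)⁻¹ : ℝ) : ℂ) * star (D a b) := fun b a => by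
      rw [realDiag, Matrix.diagonal_mul, Matrix.conjTranspose_apply]
    simp only [Matrix.trace, Matrix.diag_apply]
    simp only [Matrix.mul_apply (M := Z), hent]
  have hT : traceHessianGrad A K H f y v
      = ∑ a, ∑ b, d (l a) (l b) * (l b)⁻¹ * Complex.normSq (D a b) := by
    rw [traceHessianGrad, ← hgdef, hd.conj_eq (dirDeriv _ _ _ + _), ← hY, hconj]
    simp only [Complex.re_sum]
    refine Finset.sum_congr rfl fun a _ => Finset.sum_congr rfl fun b _ => ?_
    rw [hYD]
    have : (d (l a) (l b) : ℂ) * D a b * ((((l b)⁻¹ : ℝ) : ℂ) * star (D a b))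
        = ((d (l a) (l b) * (l b)⁻¹ : ℝ) : ℂ) * (D a b * (starRingEnd ℂ) (D a b)) := by
      push_cast
      rw [starRingEnd_apply]
      ring
    rw [this, Complex.mul_conj, ← Complex.ofReal_mul, Complex.ofReal_re]
  have hnn : ∀ a b, 0 ≤ d (l a) (l b) * (l b)⁻¹ * Complex.normSq (D a b) := by
    intro a b
    refine mul_nonneg (mul_nonneg ?_ (inv_nonneg.2 (hd.pos b).le)) (Complex.normSq_nonneg _)
    -- For equal eigenvalues the divided difference is the derivative; otherwise its sign comes from
    -- the monotonicity hypothesis.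
    by_cases hab : l a = l b
    · rw [hab, d2]; exact hder b
    · have h1 := hmono a b
      rw [← d1, mul_assoc] at h1
      exact nonneg_of_mul_nonneg_left h1 (mul_self_pos.2 (sub_ne_zero.2 hab))
  refine ⟨by rw [hT]; exact Finset.sum_nonneg fun a _ => Finset.sum_nonneg fun b _ => hnn a b, ?_⟩
  have hdiag : ∑ a, d (l a) (l a) * (l a)⁻¹ * Complex.normSq (D a a)
      ≤ traceHessianGrad A K H f y v := by
    rw [hT]
    exact Finset.sum_le_sum fun a _ => Finset.single_le_sum
      (f := fun b => d (l a) (l b) * (l b)⁻¹ * Complex.normSq (D a b))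
      (fun b _ => hnn a b) (Finset.mem_univ a)
  have hw : fderiv ℝ (fun z => (aeval (relEnd (K z) (H z)) f).trace.re) y v
      = ∑ a, g.eval (l a) * (l a)⁻¹ * (D a a).re := by
    rw [h.fderiv_eq, ← hgdef, hd.aeval_relEnd, hconj, Complex.re_sum]
    refine Finset.sum_congr rfl fun a _ => ?_
    rw [Finset.sum_eq_single a]
    · have : realDiag (fun a => g.eval (l a)) a a = ((g.eval (l a) : ℝ) : ℂ) := by
        simp [realDiag]
      rw [this, ← mul_assoc, ← Complex.ofReal_mul, Complex.re_ofReal_mul]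
      rfl
    · intro b _ hb
      have : realDiag (fun a => g.eval (l a)) a b = 0 := by
        rw [realDiag, Matrix.diagonal_apply_ne _ hb.symm]
      rw [this, zero_mul]
    · simp
  rw [hw, hd.trace_aeval]
  have hsum : 0 ≤ κ * ∑ a, f.eval (l a) := mul_nonneg hκ (Finset.sum_nonneg fun a _ => hf a)
  refine le_trans ?_ (mul_le_mul_of_nonneg_left hdiag hsum)
  rw [Finset.mul_sum Finset.univ (fun a => f.eval (l a)) κ]
  -- Cauchy–Schwarz over the eigenvalues, for which `hgrad` supplies the termwise inequality.
  refine Finset.sum_sq_le_sum_mul_sum_of_sq_le_mul _ (fun a _ => mul_nonneg hκ (hf a))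
    (fun a _ => hnn a a) fun a _ => ?_
  rw [d2]
  have hl := hd.pos a
  have h1 : (D a a).re ^ 2 ≤ Complex.normSq (D a a) := by
    rw [Complex.normSq_apply]; nlinarith [sq_nonneg (D a a).im]
  calc (g.eval (l a) * (l a)⁻¹ * (D a a).re) ^ 2
      = g.eval (l a) ^ 2 * ((l a)⁻¹ ^ 2 * (D a a).re ^ 2) := by ring
    _ ≤ κ * f.eval (l a) * (l a * (derivative g).eval (l a))
        * ((l a)⁻¹ ^ 2 * Complex.normSq (D a a)) := by
        have := hgrad a
        gcongr
        exact (sq_nonneg _).trans this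
    _ = _ := by field_simp

end TraceHessian

end NHYM

namespace NHYM

open Filter Topology Polynomial

/-! ### The two differential inequalities in local coordinates. -/

section LocalSubsolution

variable {n r : ℕ} {A : (Fin n → ℂ) → (Fin n → ℂ) → Matrix (Fin r) (Fin r) ℂ}
  {H K : (Fin n → ℂ) → Matrix (Fin r) (Fin r) ℂ} {y : Fin n → ℂ}

/-- The second derivative of `f` at `y` along `v`. -/
noncomputable def hess (f : (Fin n → ℂ) → ℝ) (y v : Fin n → ℂ) : ℝ :=
  fderiv ℝ (fun z => fderiv ℝ f z v) y v

theorem hess_congr {f g : (Fin n → ℂ) → ℝ} (h : f =ᶠ[𝓝 y] g) (v : Fin n → ℂ) :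
    hess f y v = hess g y v := by
  have h2 : (fun z => fderiv ℝ f z v) =ᶠ[𝓝 y] fun z => fderiv ℝ g z v := by
    filter_upwards [h.eventuallyEq_nhds] with z hz
    rw [hz.fderiv_eq]
  rw [hess, h2.fderiv_eq, hess]

theorem _root_.ContDiffAt.differentiableAt_fderiv_apply {f : (Fin n → ℂ) → ℝ} (hf : ContDiffAt ℝ 2 f y)
    (v : Fin n → ℂ) : DifferentiableAt ℝ (fun z => fderiv ℝ f z v) y :=
  ((hf.fderiv_right (m := 1) (by norm_num)).differentiableAt (by norm_num)).clm_apply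
    (differentiableAt_const v)

theorem hess_add {f g : (Fin n → ℂ) → ℝ} (hf : ContDiffAt ℝ 2 f y) (hg : ContDiffAt ℝ 2 g y)
    (v : Fin n → ℂ) : hess (fun z => f z + g z) y v = hess f y v + hess g y v := by
  have h : (fun z => fderiv ℝ (fun z => f z + g z) z v)
      =ᶠ[𝓝 y] fun z => fderiv ℝ f z v + fderiv ℝ g z v := by
    filter_upwards [hf.eventually (by simp), hg.eventually (by simp)] with z h1 h2
    rw [fderiv_fun_add (h1.differentiableAt (by norm_num)) (h2.differentiableAt (by norm_num))]
    rfl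
  rw [hess, h.fderiv_eq, fderiv_fun_add (hf.differentiableAt_fderiv_apply v)
    (hg.differentiableAt_fderiv_apply v)]
  rfl

theorem hess_comp {f : (Fin n → ℂ) → ℝ} {φ : ℝ → ℝ} (hf : ContDiffAt ℝ 2 f y)
    (hφ : ContDiffAt ℝ 2 φ (f y)) (v : Fin n → ℂ) :
    hess (fun z => φ (f z)) y v
      = deriv (deriv φ) (f y) * fderiv ℝ f y v ^ 2 + deriv φ (f y) * hess f y v := by
  have hf0 := hf.differentiableAt (by norm_num)
  have h : (fun z => fderiv ℝ (fun z => φ (f z)) z v)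
      =ᶠ[𝓝 y] fun z => deriv φ (f z) * fderiv ℝ f z v := by
    filter_upwards [hf.eventually (by simp),
      hf.continuousAt.eventually (hφ.eventually (by simp))] with z h1 h2
    have := ((h2.differentiableAt (by norm_num)).hasDerivAt.comp_hasFDerivAt z
      (h1.differentiableAt (by norm_num)).hasFDerivAt).fderiv
    simp only [Function.comp_def] at this
    rw [this]
    rfl
  have hd : DifferentiableAt ℝ (deriv φ) (f y) := by
    have h3 : ContDiffAt ℝ 1 (deriv φ) (f y) := by
      have := (hφ.fderiv_right (m := 1) (by norm_num)).clm_apply (contDiffAt_const (c := (1 : ℝ)))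
      simpa only [fderiv_apply_one_eq_deriv] using this
    exact h3.differentiableAt (by norm_num)
  have hc := hd.hasDerivAt.comp_hasFDerivAt y hf0.hasFDerivAt
  have h4 := (hc.mul (hf.differentiableAt_fderiv_apply v).hasFDerivAt).fderiv
  rw [hess, h.fderiv_eq]
  have h5 : (fun z => deriv φ (f z) * fderiv ℝ f z v)
      = (deriv φ ∘ f) * fun z => fderiv ℝ f z v := rfl
  rw [h5, h4, hess]
  simp only [add_apply, smul_apply, smul_eq_mul,
    Function.comp_apply]
  ring

theorem frameSum_add {W : Type*} [AddCommMonoid W] (b : Fin n → Fin n → ℂ)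
    (F G : (Fin n → ℂ) → W) : frameSum b (fun v => F v + G v) = frameSum b F + frameSum b G := by
  simp only [frameSum, ← Finset.sum_add_distrib]
  exact Finset.sum_congr rfl fun l _ => add_add_add_comm _ _ _ _

theorem frameSum_mul_left (b : Fin n → Fin n → ℂ) (c : ℝ) (F : (Fin n → ℂ) → ℝ) :
    frameSum b (fun v => c * F v) = c * frameSum b F := by
  simp only [frameSum, ← mul_add, Finset.mul_sum]

theorem frameSum_map {W W' : Type*} [AddCommMonoid W] [AddCommMonoid W'] (b : Fin n → Fin n → ℂ)
    (φ : W →+ W') (F : (Fin n → ℂ) → W) :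
    frameSum b (fun v => φ (F v)) = φ (frameSum b F) := by
  simp only [frameSum, map_sum, map_add]

theorem frameSum_mono (b : Fin n → Fin n → ℂ) {F G : (Fin n → ℂ) → ℝ} (h : ∀ v, F v ≤ G v) :
    frameSum b F ≤ frameSum b G :=
  Finset.sum_le_sum fun _ _ => add_le_add (h _) (h _)

/-- `√-1 Λ G_M` in terms of an adapted frame `b`. -/
noncomputable def localLambdaG (A : (Fin n → ℂ) → (Fin n → ℂ) → Matrix (Fin r) (Fin r) ℂ)
    (M : (Fin n → ℂ) → Matrix (Fin r) (Fin r) ℂ) (y : Fin n → ℂ) (b : Fin n → Fin n → ℂ) :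
    Matrix (Fin r) (Fin r) ℂ :=
  ∑ l, diag11 (dbarCurv (localTheta A (localPsi A M)) y) (b l)

theorem LocalPair.frameSum_hess (h : LocalPair A K H y) (b : Fin n → Fin n → ℂ) {c : ℝ}
    (hF : ∑ l, diag11 (curv A y) (b l) = (c : ℂ) • (1 : Matrix (Fin r) (Fin r) ℂ)) (f : ℝ[X]) :
    1 / 2 * frameSum b (hess (fun z => (aeval (relEnd (K z) (H z)) f).trace.re) y)
      = 4 * (aeval (relEnd (K y) (H y)) (derivative f * X)
          * (localLambdaG A H y b - localLambdaG A K y b)).trace.re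
        + 1 / 2 * frameSum b (traceHessianGrad A K H f y) := by
  have hKu := isUnit_det_of_posDef h.left_pos.self_of_nhds
  have hHu := isUnit_det_of_posDef h.right_pos.self_of_nhds
  have h1 : hess (fun z => (aeval (relEnd (K z) (H z)) f).trace.re) y
      = fun v => (aeval (relEnd (K y) (H y)) (derivative f * X)
          * covDiag A (adjDiff A K H) y v).trace.re + traceHessianGrad A K H f y v :=
    funext fun v => h.hessian_eq f v
  have h2 : covDiag A (adjDiff A K H) y
      = fun v => (-2 : ℂ) • (covDiag A (localPsi A H) y v - covDiag A (localPsi A K) y v) := by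
    funext v
    rw [← covDiag_smul_sub _ _ _ (EntryDiff.localPsi h.form_diff h.right hHu v)
      (EntryDiff.localPsi h.form_diff h.left hKu v)]
    congr 1
    funext z u
    rw [adjDiff_eq]
  have hH := four_smul_sum_diag11_dbarCurv h.form_diff h.form_neg h.right hHu b hF
  have hK := four_smul_sum_diag11_dbarCurv h.form_diff h.form_neg h.left hKu b hF
  rw [h1, frameSum_add, mul_add]
  congr 1
  set G := aeval (relEnd (K y) (H y)) (derivative f * X)
  let φ : Matrix (Fin r) (Fin r) ℂ →+ ℝ :=
    (Complex.reAddGroupHom.comp (Matrix.traceAddMonoidHom (Fin r) ℂ)).comp (AddMonoidHom.mulLeft G)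
  have h3 : (fun v => (G * covDiag A (adjDiff A K H) y v).trace.re)
      = fun v => φ (covDiag A (adjDiff A K H) y v) := rfl
  -- The factor is `(-2)·(-4)`: `β = -2(ψ_H - ψ_K)`, and the trace of `∇ψ` is `-4√-1ΛG`. The
  -- Laplacian is half the frame sum, which leaves `4`.
  have h4 : frameSum b (covDiag A (adjDiff A K H) y)
      = (8 : ℂ) • (localLambdaG A H y b - localLambdaG A K y b) := by
    rw [h2]
    simp only [localLambdaG]
    have : frameSum b (fun v =>
        (-2 : ℂ) • (covDiag A (localPsi A H) y v - covDiag A (localPsi A K) y v))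
        = (-2 : ℂ) • (frameSum b (covDiag A (localPsi A H) y)
          - frameSum b (covDiag A (localPsi A K) y)) := by
      simp only [frameSum, Finset.smul_sum, ← Finset.sum_sub_distrib]
      exact Finset.sum_congr rfl fun l _ => by module
    rw [this, ← neg_eq_iff_eq_neg.2 hH, ← neg_eq_iff_eq_neg.2 hK]
    module
  rw [h3, frameSum_map, h4]
  change 1 / 2 * (G * ((8 : ℂ) • _)).trace.re = _
  rw [mul_smul_comm, Matrix.trace_smul, smul_eq_mul]
  have : ∀ w : ℂ, (8 * w).re = 8 * w.re := fun w => by simp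
  rw [this]
  ring

theorem endNorm_nonneg (M B : Matrix (Fin r) (Fin r) ℂ) : 0 ≤ endNorm M B := Real.sqrt_nonneg _

theorem LocalPair.le_frameSum_hess (h : LocalPair A K H y) (b : Fin n → Fin n → ℂ) {c : ℝ}
    (hF : ∑ l, diag11 (curv A y) (b l) = (c : ℂ) • (1 : Matrix (Fin r) (Fin r) ℂ)) (f : ℝ[X])
    {P : Matrix (Fin r) (Fin r) ℂ} {l : Fin r → ℝ} (hd : SimDiag (K y) (H y) P l) {N : ℝ}
    (hN : Real.sqrt (∑ a, (derivative f * X).eval (l a) ^ 2) ≤ N) :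
    1 / 2 * frameSum b (traceHessianGrad A K H f y) - 4 * N * (endNorm (H y) (localLambdaG A H y b)
        + endNorm (K y) (localLambdaG A K y b))
      ≤ 1 / 2 * frameSum b (hess (fun z => (aeval (relEnd (K z) (H z)) f).trace.re) y) := by
  rw [h.frameSum_hess b hF f, mul_sub, Matrix.trace_sub, Complex.sub_re]
  have h1 := hd.abs_trace_aeval_mul_le (M := H y) (Or.inr rfl) (derivative f * X)
    (localLambdaG A H y b)
  have h2 := hd.abs_trace_aeval_mul_le (M := K y) (Or.inl rfl) (derivative f * X)
    (localLambdaG A K y b)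
  have h3 := mul_le_mul_of_nonneg_right hN (endNorm_nonneg (H y) (localLambdaG A H y b))
  have h4 := mul_le_mul_of_nonneg_right hN (endNorm_nonneg (K y) (localLambdaG A K y b))
  have h5 := neg_abs_le ((aeval (relEnd (K y) (H y)) (derivative f * X)
    * localLambdaG A H y b).trace.re)
  have h6 := le_abs_self ((aeval (relEnd (K y) (H y)) (derivative f * X)
    * localLambdaG A K y b).trace.re)
  linarith

/-- By Cauchy–Schwarz, two gradient bounds `f² ≤ w T` may be added. It is used for `tr h` and `tr
h⁻¹` together. -/
theorem add_sq_le_add_mul_add {f₁ f₂ w₁ w₂ T₁ T₂ : ℝ} (p₁ : 0 ≤ w₁) (p₂ : 0 ≤ w₂) (t₁ : 0 ≤ T₁)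
    (t₂ : 0 ≤ T₂) (q₁ : f₁ ^ 2 ≤ w₁ * T₁) (q₂ : f₂ ^ 2 ≤ w₂ * T₂) :
    (f₁ + f₂) ^ 2 ≤ (w₁ + w₂) * (T₁ + T₂) := by
  have h1 : 2 * (f₁ * f₂) ≤ w₁ * T₂ + w₂ * T₁ := by
    have h3 : (f₁ ^ 2) * (f₂ ^ 2) ≤ (w₁ * T₁) * (w₂ * T₂) :=
      mul_le_mul q₁ q₂ (sq_nonneg _) (mul_nonneg p₁ t₁)
    have h2 : (2 * (f₁ * f₂)) ^ 2 ≤ (w₁ * T₂ + w₂ * T₁) ^ 2 := by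
      linarith [sq_nonneg (w₁ * T₂ - w₂ * T₁), h3]
    exact abs_le_of_sq_le_sq' h2 (add_nonneg (mul_nonneg p₁ t₂) (mul_nonneg p₂ t₁)) |>.2
  linarith

theorem LocalPair.frameSum_hess_log_traceSum (h : LocalPair A K H y) (b : Fin n → Fin n → ℂ) {c : ℝ}
    (hF : ∑ l, diag11 (curv A y) (b l) = (c : ℂ) • (1 : Matrix (Fin r) (Fin r) ℂ)) :
    -4 * endNorm (H y) (localLambdaG A H y b) - 4 * endNorm (K y) (localLambdaG A K y b)
      ≤ 1 / 2 * frameSum b (hess (fun z => Real.log ((relEnd (K z) (H z)).trace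
        + ((relEnd (K z) (H z))⁻¹).trace).re) y) := by
  -- The inverse of `h` is `H⁻¹K`, so `tr h⁻¹` is the same kind of function with the metrics
  -- exchanged, and every estimate applies to it by symmetry.
  have hev : (fun z => Real.log ((relEnd (K z) (H z)).trace + ((relEnd (K z) (H z))⁻¹).trace).re)
      =ᶠ[𝓝 y] fun z => Real.log ((aeval (relEnd (K z) (H z)) (X : ℝ[X])).trace.re
        + (aeval (relEnd (H z) (K z)) (X : ℝ[X])).trace.re) := by
    filter_upwards [h.left_pos, h.right_pos] with z h1 h2
    obtain ⟨P, l, hd, -⟩ := exists_simDiag h1 h2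
    rw [hd.relEnd_inv, Complex.add_re, aeval_X, aeval_X]
  have hev2 : hess (fun z => Real.log ((relEnd (K z) (H z)).trace
        + ((relEnd (K z) (H z))⁻¹).trace).re) y = _ := funext fun v => hess_congr hev v
  rw [hev2]
  obtain ⟨P, l, hd, -⟩ := exists_simDiag h.left_pos.self_of_nhds h.right_pos.self_of_nhds
  obtain ⟨P', l', hd', -⟩ := exists_simDiag h.right_pos.self_of_nhds h.left_pos.self_of_nhds
  set w₁ := fun z => (aeval (relEnd (K z) (H z)) (X : ℝ[X])).trace.re with hw₁
  set w₂ := fun z => (aeval (relEnd (H z) (K z)) (X : ℝ[X])).trace.re with hw₂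
  have e₁ := endNorm_nonneg (H y) (localLambdaG A H y b)
  have e₂ := endNorm_nonneg (K y) (localLambdaG A K y b)
  have v₁ : w₁ y = ∑ a, l a := (hd.trace_aeval X).trans (by simp)
  have v₂ : w₂ y = ∑ a, l' a := (hd'.trace_aeval X).trans (by simp)
  -- In rank `0` the function is the constant `log 0 = 0`; otherwise the traces are positive.
  rcases Nat.eq_zero_or_pos r with rfl | hr
  · have : hess (fun z => Real.log (w₁ z + w₂ z)) y = fun v => 0 := by
      funext v
      simp [hw₁, hw₂, hess, Matrix.trace]
    rw [this]
    simp only [frameSum]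
    simp
    linarith
  have : Nonempty (Fin r) := ⟨⟨0, hr⟩⟩
  have p₁ : 0 < w₁ y := by
    rw [v₁]; exact Finset.sum_pos (fun a _ => hd.pos a) Finset.univ_nonempty
  have p₂ : 0 < w₂ y := by
    rw [v₂]; exact Finset.sum_pos (fun a _ => hd'.pos a) Finset.univ_nonempty
  -- For `f = X` also `g = X`, and the Euclidean norm of positive eigenvalues is at most their sum.
  -- The trace can therefore serve as the bound `N`, and dividing by it leaves the constant `4`.
  have hN : ∀ {l : Fin r → ℝ}, (∀ a, 0 < l a) →
      Real.sqrt (∑ a, (derivative (X : ℝ[X]) * X).eval (l a) ^ 2) ≤ ∑ a, l a := by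
    intro l hl
    rw [Real.sqrt_le_left (Finset.sum_nonneg fun a _ => (hl a).le)]
    simp only [derivative_X, one_mul, eval_X]
    exact Finset.sum_sq_le_sq_sum_of_nonneg fun a _ => (hl a).le
  have L₁ := h.le_frameSum_hess b hF X hd (N := w₁ y) (by rw [v₁]; exact hN hd.pos)
  have L₂ := h.symm.le_frameSum_hess b hF X hd' (N := w₂ y) (by rw [v₂]; exact hN hd'.pos)
  -- The value `κ = 1` is what the logarithm needs: the bound on `(dw)²` by `w T` cancels the loss
  -- `(dw)² / w²` against `T / w`.
  have Q₁ := fun v => h.traceHessianGrad_bound X v hd (κ := 1) zero_le_one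
    (fun a => by simpa using (hd.pos a).le) (fun a b => by simpa using mul_self_nonneg (l a - l b))
    (by simp) (fun a => by simp [sq])
  have Q₂ := fun v => h.symm.traceHessianGrad_bound X v hd' (κ := 1) zero_le_one
    (fun a => by simpa using (hd'.pos a).le)
    (fun a b => by simpa using mul_self_nonneg (l' a - l' b)) (by simp) (fun a => by simp [sq])
  have c₁ : ContDiffAt ℝ 2 w₁ y := h.contDiffAt X
  have c₂ : ContDiffAt ℝ 2 w₂ y := h.symm.contDiffAt X
  have hlog : ContDiffAt ℝ 2 Real.log (w₁ y + w₂ y) := Real.contDiffAt_log.2 (by positivity)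
  have hcomp : hess (fun z => Real.log (w₁ z + w₂ z)) y
      = fun v => -(w₁ y + w₂ y)⁻¹ ^ 2 * (fderiv ℝ w₁ y v + fderiv ℝ w₂ y v) ^ 2
        + (w₁ y + w₂ y)⁻¹ * (hess w₁ y v + hess w₂ y v) := by
    funext v
    rw [hess_comp (φ := Real.log) (c₁.add c₂) hlog, hess_add c₁ c₂,
      fderiv_fun_add (c₁.differentiableAt (by norm_num)) (c₂.differentiableAt (by norm_num)),
      Real.deriv_log', deriv_inv]
    simp
  have hv : ∀ v, (w₁ y + w₂ y)⁻¹ * (hess w₁ y v + hess w₂ y v)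
      - (w₁ y + w₂ y)⁻¹ * (traceHessianGrad A K H X y v + traceHessianGrad A H K X y v)
      ≤ hess (fun z => Real.log (w₁ z + w₂ z)) y v := by
    intro v
    rw [hcomp]
    obtain ⟨t₁, q₁⟩ := Q₁ v
    obtain ⟨t₂, q₂⟩ := Q₂ v
    change fderiv ℝ w₁ y v ^ 2 ≤ 1 * w₁ y * _ at q₁
    change fderiv ℝ w₂ y v ^ 2 ≤ 1 * w₂ y * _ at q₂
    set T₁ := traceHessianGrad A K H X y v
    set T₂ := traceHessianGrad A H K X y v
    set f₁ := fderiv ℝ w₁ y v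
    set f₂ := fderiv ℝ w₂ y v
    rw [one_mul] at q₁ q₂
    have key : (f₁ + f₂) ^ 2 ≤ (w₁ y + w₂ y) * (T₁ + T₂) :=
      add_sq_le_add_mul_add p₁.le p₂.le t₁ t₂ q₁ q₂
    have hp : 0 < w₁ y + w₂ y := by positivity
    have : (w₁ y + w₂ y)⁻¹ ^ 2 * (f₁ + f₂) ^ 2 ≤ (w₁ y + w₂ y)⁻¹ * (T₁ + T₂) := by
      calc _ ≤ (w₁ y + w₂ y)⁻¹ ^ 2 * ((w₁ y + w₂ y) * (T₁ + T₂)) := by gcongr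
        _ = _ := by field_simp
    linarith
  have hsum := frameSum_mono b hv
  have hsplit : frameSum b (fun v => (w₁ y + w₂ y)⁻¹ * (hess w₁ y v + hess w₂ y v)
      - (w₁ y + w₂ y)⁻¹ * (traceHessianGrad A K H X y v + traceHessianGrad A H K X y v))
      = (w₁ y + w₂ y)⁻¹ * ((frameSum b (hess w₁ y) + frameSum b (hess w₂ y))
        - (frameSum b (traceHessianGrad A K H X y) + frameSum b (traceHessianGrad A H K X y))) := by
    simp only [frameSum, ← Finset.sum_add_distrib, ← Finset.sum_sub_distrib, Finset.mul_sum]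
    exact Finset.sum_congr rfl fun _ _ => by ring
  rw [hsplit] at hsum
  have hp : 0 < w₁ y + w₂ y := by positivity
  have hfin : (w₁ y + w₂ y) * (-8 * (endNorm (H y) (localLambdaG A H y b)
      + endNorm (K y) (localLambdaG A K y b)))
      ≤ (frameSum b (hess w₁ y) + frameSum b (hess w₂ y))
        - (frameSum b (traceHessianGrad A K H X y) + frameSum b (traceHessianGrad A H K X y)) := by
    linarith
  have h9 := mul_le_mul_of_nonneg_left hfin (inv_nonneg.2 hp.le)
  rw [inv_mul_cancel_left₀ hp.ne'] at h9
  linarith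

/-- If `f` behaves like `log²` on the eigenvalues of `h`, then `(tr f(h))^{1/2}` satisfies the same
differential inequality as `|log h|`. -/
theorem LocalPair.frameSum_hess_sqrt (h : LocalPair A K H y) (b : Fin n → Fin n → ℂ) {c : ℝ}
    (hF : ∑ l, diag11 (curv A y) (b l) = (c : ℂ) • (1 : Matrix (Fin r) (Fin r) ℂ)) (f : ℝ[X])
    {P : Matrix (Fin r) (Fin r) ℂ} {l : Fin r → ℝ} (hd : SimDiag (K y) (H y) P l)
    (hf : ∀ a, 0 < f.eval (l a))
    (hmono : ∀ a b, 0 ≤ ((derivative f * X).eval (l a) - (derivative f * X).eval (l b))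
      * (l a - l b))
    (hder : ∀ a, 0 ≤ (derivative (derivative f * X)).eval (l a))
    (hgrad : ∀ a, (derivative f * X).eval (l a) ^ 2
      ≤ 2 * f.eval (l a) * (l a * (derivative (derivative f * X)).eval (l a)))
    (hfour : ∀ a, (derivative f * X).eval (l a) ^ 2 ≤ 4 * f.eval (l a)) :
    -4 * endNorm (H y) (localLambdaG A H y b) - 4 * endNorm (K y) (localLambdaG A K y b)
      ≤ 1 / 2 * frameSum b
        (hess (fun z => Real.sqrt (aeval (relEnd (K z) (H z)) f).trace.re) y) := by
  set w := fun z => (aeval (relEnd (K z) (H z)) f).trace.re with hw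
  have e₁ := endNorm_nonneg (H y) (localLambdaG A H y b)
  have e₂ := endNorm_nonneg (K y) (localLambdaG A K y b)
  rcases Nat.eq_zero_or_pos r with rfl | hr
  · have : hess (fun z => Real.sqrt (w z)) y = fun v => 0 := by
      funext v
      simp [hw, hess, Matrix.trace]
    rw [this]
    simp only [frameSum]
    simp
    linarith
  have : Nonempty (Fin r) := ⟨⟨0, hr⟩⟩
  have hwy : w y = ∑ a, f.eval (l a) := hd.trace_aeval f
  have hp : 0 < w y := by
    rw [hwy]; exact Finset.sum_pos (fun a _ => hf a) Finset.univ_nonempty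
  set s := Real.sqrt (w y) with hs
  have hs0 : 0 < s := Real.sqrt_pos.2 hp
  have hss : s ^ 2 = w y := Real.sq_sqrt hp.le
  -- The bound `2s` cancels against the factor `(2s)⁻¹` from differentiating the square root.
  have hN : Real.sqrt (∑ a, (derivative f * X).eval (l a) ^ 2) ≤ 2 * s := by
    rw [Real.sqrt_le_left (by positivity), mul_pow, hss, hwy, Finset.mul_sum]
    refine Finset.sum_le_sum fun a _ => (hfour a).trans_eq (by norm_num)
  have L := h.le_frameSum_hess b hF f hd hN
  have Q := fun v => h.traceHessianGrad_bound f v hd (κ := 2) zero_le_two (fun a => (hf a).le)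
    hmono hder hgrad
  have cw : ContDiffAt ℝ 2 w y := h.contDiffAt f
  have hcomp : hess (fun z => Real.sqrt (w z)) y
      = fun v => -(4 * s ^ 3)⁻¹ * fderiv ℝ w y v ^ 2 + (2 * s)⁻¹ * hess w y v := by
    funext v
    have hd1 : deriv Real.sqrt =ᶠ[𝓝 (w y)] fun x => (2 * Real.sqrt x)⁻¹ := by
      filter_upwards [lt_mem_nhds hp] with x hx
      rw [(Real.hasDerivAt_sqrt hx.ne').deriv, one_div]
    have hd2 : HasDerivAt (fun x => (2 * Real.sqrt x)⁻¹) (-(2 * (1 / (2 * s))) / (2 * s) ^ 2)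
        (w y) := ((Real.hasDerivAt_sqrt hp.ne').const_mul 2).inv (by positivity)
    rw [hess_comp (φ := Real.sqrt) cw (Real.contDiffAt_sqrt hp.ne'), hd1.deriv_eq, hd2.deriv,
      hd1.self_of_nhds]
    congr 2
    field_simp
    norm_num
  -- Here `κ = 2` suffices: the square root loses `(dw)² / (4s³)`, which is at most `T / (2s)`
  -- because `w = s²`.
  have hv : ∀ v, (2 * s)⁻¹ * (hess w y v - traceHessianGrad A K H f y v)
      ≤ hess (fun z => Real.sqrt (w z)) y v := by
    intro v
    rw [hcomp]
    obtain ⟨t, q⟩ := Q v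
    change fderiv ℝ w y v ^ 2 ≤ 2 * w y * _ at q
    rw [← hss] at q
    have : (4 * s ^ 3)⁻¹ * fderiv ℝ w y v ^ 2 ≤ (2 * s)⁻¹ * traceHessianGrad A K H f y v := by
      calc _ ≤ (4 * s ^ 3)⁻¹ * (2 * s ^ 2 * traceHessianGrad A K H f y v) := by gcongr
        _ = _ := by field_simp; norm_num
    linarith
  have hsum := frameSum_mono b hv
  have hsplit : frameSum b (fun v => (2 * s)⁻¹ * (hess w y v - traceHessianGrad A K H f y v))
      = (2 * s)⁻¹ * (frameSum b (hess w y) - frameSum b (traceHessianGrad A K H f y)) := by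
    simp only [frameSum, ← Finset.sum_sub_distrib, Finset.mul_sum]
    exact Finset.sum_congr rfl fun _ _ => by ring
  rw [hsplit] at hsum
  have hfin : (2 * s) * (-8 * (endNorm (H y) (localLambdaG A H y b)
      + endNorm (K y) (localLambdaG A K y b)))
      ≤ frameSum b (hess w y) - frameSum b (traceHessianGrad A K H f y) := by
    linarith
  have h9 := mul_le_mul_of_nonneg_left hfin (inv_nonneg.2 (by positivity : 0 ≤ 2 * s))
  rw [inv_mul_cancel_left₀ (by positivity)] at h9
  linarith

end LocalSubsolution

end NHYM

namespace NHYM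

open Filter Topology

/-! ### The sesquilinear `(1,1)`-part of a real bilinear form. -/

section Sesquilinear

variable {n : ℕ} {W : Type*} [AddCommGroup W] [Module ℂ W]

/-- Bilinearity over `ℝ`. -/
structure IsRealBilin (α : (Fin n → ℂ) → (Fin n → ℂ) → W) : Prop where
  add_left : ∀ u u' v, α (u + u') v = α u v + α u' v
  smul_left : ∀ (c : ℝ) u v, α ((c : ℂ) • u) v = (c : ℂ) • α u v
  add_right : ∀ u v v', α u (v + v') = α u v + α u v'
  smul_right : ∀ (c : ℝ) u v, α u ((c : ℂ) • v) = (c : ℂ) • α u v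

/-- The sesquilinear form `α(u^{1,0}, v^{0,1})`. -/
noncomputable def sesq (α : (Fin n → ℂ) → (Fin n → ℂ) → W) (u v : Fin n → ℂ) : W :=
  (1 / 4 : ℂ) • (α u v + α (Complex.I • u) (Complex.I • v)
    + Complex.I • α u (Complex.I • v) - Complex.I • α (Complex.I • u) v)

variable {α : (Fin n → ℂ) → (Fin n → ℂ) → W} (hα : IsRealBilin α)
include hα

theorem IsRealBilin.neg_left (u v : Fin n → ℂ) : α (-u) v = -α u v := by
  have := hα.smul_left (-1) u v
  simpa using this

theorem IsRealBilin.neg_right (u v : Fin n → ℂ) : α u (-v) = -α u v := by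
  have := hα.smul_right (-1) u v
  simpa using this

theorem IsRealBilin.sesq_add_left (u u' v : Fin n → ℂ) :
    sesq α (u + u') v = sesq α u v + sesq α u' v := by
  simp only [sesq, smul_add, hα.add_left]
  module

theorem IsRealBilin.sesq_add_right (u v v' : Fin n → ℂ) :
    sesq α u (v + v') = sesq α u v + sesq α u v' := by
  simp only [sesq, smul_add, hα.add_right]
  module

theorem IsRealBilin.sesq_I_left (u v : Fin n → ℂ) :
    sesq α (Complex.I • u) v = Complex.I • sesq α u v := by
  simp only [sesq, I_smul_I_smul, hα.neg_left]
  match_scalars <;> ring_nf <;> simp [Complex.I_sq] <;> norm_num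

theorem IsRealBilin.sesq_I_right (u v : Fin n → ℂ) :
    sesq α u (Complex.I • v) = -Complex.I • sesq α u v := by
  simp only [sesq, I_smul_I_smul, hα.neg_right]
  match_scalars <;> ring_nf <;> simp [Complex.I_sq] <;> norm_num

theorem IsRealBilin.sesq_real_left (c : ℝ) (u v : Fin n → ℂ) :
    sesq α ((c : ℂ) • u) v = (c : ℂ) • sesq α u v := by
  simp only [sesq, smul_comm Complex.I (c : ℂ), hα.smul_left]
  module

theorem IsRealBilin.sesq_real_right (c : ℝ) (u v : Fin n → ℂ) :
    sesq α u ((c : ℂ) • v) = (c : ℂ) • sesq α u v := by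
  simp only [sesq, smul_comm Complex.I (c : ℂ), hα.smul_right]
  module

theorem IsRealBilin.sesq_smul_left (c : ℂ) (u v : Fin n → ℂ) :
    sesq α (c • u) v = c • sesq α u v := by
  have h : c • u = (c.re : ℂ) • u + (c.im : ℂ) • (Complex.I • u) := by
    conv_lhs => rw [← Complex.re_add_im c]
    rw [add_smul, mul_smul]
  rw [h, hα.sesq_add_left, hα.sesq_real_left, hα.sesq_real_left, hα.sesq_I_left, ← mul_smul,
    ← add_smul, Complex.re_add_im]

theorem IsRealBilin.sesq_smul_right (c : ℂ) (u v : Fin n → ℂ) :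
    sesq α u (c • v) = (starRingEnd ℂ) c • sesq α u v := by
  have h : c • v = (c.re : ℂ) • v + (c.im : ℂ) • (Complex.I • v) := by
    conv_lhs => rw [← Complex.re_add_im c]
    rw [add_smul, mul_smul]
  have h2 : (starRingEnd ℂ) c = c.re + c.im * -Complex.I := by
    apply Complex.ext <;> simp
  rw [h, hα.sesq_add_right, hα.sesq_real_right, hα.sesq_real_right, hα.sesq_I_right, ← mul_smul,
    ← add_smul, h2]

/-- The complex linear map `u ↦ α(u^{1,0}, v^{0,1})`. -/
noncomputable def IsRealBilin.leftMap (v : Fin n → ℂ) : (Fin n → ℂ) →ₗ[ℂ] W where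
  toFun u := sesq α u v
  map_add' u u' := hα.sesq_add_left u u' v
  map_smul' c u := hα.sesq_smul_left c u v

/-- The conjugate linear map `v ↦ α(u^{1,0}, v^{0,1})`. -/
noncomputable def IsRealBilin.rightMap (u : Fin n → ℂ) : (Fin n → ℂ) →ₗ⋆[ℂ] W where
  toFun v := sesq α u v
  map_add' v v' := hα.sesq_add_right u v v'
  map_smul' c v := hα.sesq_smul_right c u v

/-- Both `comp11` and `diag11` are values of `sesq`, so this expansion passes from coordinate
components to an arbitrary frame. -/
theorem IsRealBilin.sesq_eq_sum (u v : Fin n → ℂ) :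
    sesq α u v = ∑ j, ∑ k, (u j * (starRingEnd ℂ) (v k)) • comp11 α j k := by
  have hu : ∀ w : Fin n → ℂ, w = ∑ j, w j • (Pi.single j 1 : Fin n → ℂ) := fun w =>
    pi_eq_sum_univ' w |>.trans (Finset.sum_congr rfl fun j _ => by congr 1)
  have h1 : sesq α u v = hα.leftMap v u := rfl
  have h2 : ∀ u, sesq α u v = hα.rightMap u v := fun _ => rfl
  rw [h1]
  conv_lhs => rw [hu u, map_sum]
  refine Finset.sum_congr rfl fun j _ => ?_
  rw [map_smul]
  change u j • sesq α _ v = _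
  rw [h2]
  conv_lhs => rw [hu v, map_sum, Finset.smul_sum]
  refine Finset.sum_congr rfl fun k _ => ?_
  rw [LinearMap.map_smulₛₗ, smul_smul]
  rfl

end Sesquilinear

/-! ### Unitary frames for `ω` and the contraction in such a frame. -/

section AdaptedFrame

variable {n : ℕ} {X : Type*} [TopologicalSpace X] [ChartedSpace (Fin n → ℂ) X]

/-- The form `ω` in a chart, with complex values. -/
noncomputable def KahlerForm.coord (ω₀ : KahlerForm n X)
    (φ : OpenPartialHomeomorph X (Fin n → ℂ)) (y u v : Fin n → ℂ) : ℂ :=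
  (chartForm ω₀.form φ y u v : ℂ)

theorem KahlerForm.isRealBilin_coord (ω₀ : KahlerForm n X)
    (φ : OpenPartialHomeomorph X (Fin n → ℂ)) (y : Fin n → ℂ) : IsRealBilin (ω₀.coord φ y) := by
  have hs : ∀ (c : ℝ) (u : Fin n → ℂ), chartVec φ y ((c : ℂ) • u) = c • chartVec φ y u := by
    intro c u
    rw [Complex.coe_smul]
    exact map_smul (mfderiv 𝓘(ℝ, Fin n → ℂ) 𝓘(ℝ, Fin n → ℂ) φ.symm y) c u
  have ha : ∀ u v : Fin n → ℂ, chartVec φ y (u + v) = chartVec φ y u + chartVec φ y v :=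
    fun u v => map_add (mfderiv 𝓘(ℝ, Fin n → ℂ) 𝓘(ℝ, Fin n → ℂ) φ.symm y) u v
  constructor
  · intro u u' v
    simp only [coord, chartForm, ha, map_add, LinearMap.add_apply, Complex.ofReal_add]
  · intro c u v
    simp only [coord, chartForm, hs, map_smul, LinearMap.smul_apply, smul_eq_mul,
      Complex.ofReal_mul]
  · intro u v v'
    simp only [coord, chartForm, ha, map_add, Complex.ofReal_add]
  · intro c u v
    simp only [coord, chartForm, hs, map_smul, smul_eq_mul, Complex.ofReal_mul]

/-- The Hermitian form of `ω` in a chart. -/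
noncomputable def KahlerForm.herm (ω₀ : KahlerForm n X)
    (φ : OpenPartialHomeomorph X (Fin n → ℂ)) (y u v : Fin n → ℂ) : ℂ :=
  -Complex.I * sesq (ω₀.coord φ y) u v

/-- A unitary frame of the tangent space, in a chart. -/
def KahlerForm.Adapted (ω₀ : KahlerForm n X) (φ : OpenPartialHomeomorph X (Fin n → ℂ))
    (y : Fin n → ℂ) (b : Fin n → Fin n → ℂ) : Prop :=
  ∀ l m, ω₀.herm φ y (b l) (b m) = if l = m then 1 else 0

variable {ω₀ : KahlerForm n X} {φ : OpenPartialHomeomorph X (Fin n → ℂ)} {y : Fin n → ℂ}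

theorem KahlerForm.herm_eq_sum (u v : Fin n → ℂ) : ω₀.herm φ y u v
    = ∑ j, ∑ k, u j * (starRingEnd ℂ) (v k) * ω₀.matrix φ y j k := by
  rw [herm, (ω₀.isRealBilin_coord φ y).sesq_eq_sum, Finset.mul_sum]
  refine Finset.sum_congr rfl fun j _ => ?_
  rw [Finset.mul_sum]
  refine Finset.sum_congr rfl fun k _ => ?_
  simp only [matrix, Matrix.of_apply, smul_eq_mul]
  change _ = u j * (starRingEnd ℂ) (v k) * (-Complex.I * comp11 (ω₀.coord φ y) j k)
  ring

theorem KahlerForm.herm_eq_mul (B C : Matrix (Fin n) (Fin n) ℂ) (l m : Fin n) :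
    ω₀.herm φ y (B l) (C m) = (B * ω₀.matrix φ y * Cᴴ) l m := by
  rw [herm_eq_sum, mul_assoc]
  simp only [Matrix.mul_apply, Matrix.conjTranspose_apply, Finset.mul_sum]
  refine Finset.sum_congr rfl fun j _ => Finset.sum_congr rfl fun k _ => ?_
  rw [starRingEnd_apply]
  ring

theorem KahlerForm.adapted_iff (b : Fin n → Fin n → ℂ) : ω₀.Adapted φ y b ↔
    Matrix.of b * ω₀.matrix φ y * (Matrix.of b)ᴴ = 1 := by
  rw [← Matrix.ext_iff]
  refine forall_congr' fun l => forall_congr' fun m => ?_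
  rw [← herm_eq_mul, Matrix.one_apply]
  rfl

theorem KahlerForm.Adapted.inv_eq {b : Fin n → Fin n → ℂ} (h : ω₀.Adapted φ y b) :
    (ω₀.matrix φ y)⁻¹ = (Matrix.of b)ᴴ * Matrix.of b := by
  rw [adapted_iff, mul_assoc] at h
  apply Matrix.inv_eq_right_inv
  rw [← mul_assoc]
  exact mul_eq_one_comm.1 h

/-- Unitarity says `g⁻¹ = b* b`, which turns contraction with `g⁻¹` into a trace over the frame. -/
theorem KahlerForm.Adapted.iLambda_eq {b : Fin n → Fin n → ℂ} (h : ω₀.Adapted φ y b)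
    {W : Type*} [AddCommGroup W] [Module ℂ W] {α : (Fin n → ℂ) → (Fin n → ℂ) → W}
    (hα : IsRealBilin α) : ω₀.iLambda φ y α = ∑ l, diag11 α (b l) := by
  have h1 : ∀ l, diag11 α (b l) = ∑ j, ∑ k, (b l j * (starRingEnd ℂ) (b l k)) • comp11 α j k :=
    fun l => hα.sesq_eq_sum (b l) (b l)
  simp only [h1, iLambda, h.inv_eq]
  conv_rhs => rw [Finset.sum_comm]
  refine Finset.sum_congr rfl fun j _ => ?_
  conv_rhs => rw [Finset.sum_comm]
  refine Finset.sum_congr rfl fun k _ => ?_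
  rw [← Finset.sum_smul, Matrix.mul_apply]
  congr 1
  refine Finset.sum_congr rfl fun l _ => ?_
  rw [Matrix.conjTranspose_apply, Matrix.of_apply, Matrix.of_apply, starRingEnd_apply, mul_comm]

/-- Expansion of a vector in an adapted frame. -/
theorem KahlerForm.Adapted.exists_expansion {b : Fin n → Fin n → ℂ} (h : ω₀.Adapted φ y b)
    (u : Fin n → ℂ) : ∃ c : Fin n → ℂ, u = ∑ l, c l • b l ∧
      ∑ l, Complex.normSq (c l) = (ω₀.herm φ y u u).re := by
  have hg := h.inv_eq
  rw [adapted_iff] at h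
  set g := ω₀.matrix φ y
  set B : Matrix (Fin n) (Fin n) ℂ := Matrix.of b
  have hB : B * (g * Bᴴ) = 1 := by rw [← mul_assoc, h]
  have hB' : g * Bᴴ * B = 1 := mul_eq_one_comm.1 hB
  have hu : u = (u ᵥ* (g * Bᴴ)) ᵥ* B := by rw [Matrix.vecMul_vecMul, hB', Matrix.vecMul_one]
  set c := u ᵥ* (g * Bᴴ)
  have hu' : u = ∑ l, c l • b l := by
    conv_lhs => rw [hu]
    ext j
    simp [Matrix.vecMul, dotProduct, B]
  refine ⟨c, hu', ?_⟩
  have h1 : ω₀.herm φ y u u = ∑ l, ∑ m, c l * (starRingEnd ℂ) (c m) * ω₀.herm φ y (b l) (b m) := by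
    have hb := ω₀.isRealBilin_coord φ y
    conv_lhs => rw [hu']
    rw [herm]
    have e1 : ∀ v, sesq (ω₀.coord φ y) (∑ l, c l • b l) v
        = ∑ l, c l • sesq (ω₀.coord φ y) (b l) v := fun v => by
      change hb.leftMap v _ = _
      rw [map_sum]
      simp only [map_smul]
      rfl
    have e2 : ∀ w, sesq (ω₀.coord φ y) w (∑ m, c m • b m)
        = ∑ m, (starRingEnd ℂ) (c m) • sesq (ω₀.coord φ y) w (b m) := fun w => by
      change hb.rightMap w _ = _
      rw [map_sum]
      simp only [LinearMap.map_smulₛₗ]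
      rfl
    rw [e1]
    simp only [e2, herm, Finset.mul_sum, smul_eq_mul]
    refine Finset.sum_congr rfl fun l _ => Finset.sum_congr rfl fun m _ => ?_
    ring
  have h2 : ω₀.Adapted φ y b := (adapted_iff b).2 h
  rw [h1, Complex.re_sum]
  refine Finset.sum_congr rfl fun l _ => ?_
  rw [Finset.sum_eq_single l]
  · rw [h2, if_pos rfl, mul_one, Complex.mul_conj, Complex.ofReal_re]
  · intro m _ hm
    rw [h2, if_neg hm.symm, mul_zero]
  · simp

theorem KahlerForm.Adapted.sum_normSq {b : Fin n → Fin n → ℂ} (h : ω₀.Adapted φ y b) :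
    ∑ l, ∑ j, Complex.normSq (b l j) = (ω₀.matrix φ y)⁻¹.trace.re := by
  rw [h.inv_eq, Matrix.trace, Complex.re_sum, Finset.sum_comm]
  refine Finset.sum_congr rfl fun j _ => ?_
  rw [Matrix.diag_apply, Matrix.mul_apply, Complex.re_sum]
  refine Finset.sum_congr rfl fun l _ => ?_
  rw [Matrix.conjTranspose_apply, Matrix.of_apply, ← starRingEnd_apply, mul_comm,
    Complex.mul_conj, Complex.ofReal_re]

theorem KahlerForm.matrix_eq_herm (j k : Fin n) :
    ω₀.matrix φ y j k = ω₀.herm φ y (Pi.single j 1) (Pi.single k 1) := by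
  simp only [matrix, Matrix.of_apply]
  rfl

end AdaptedFrame

end NHYM

namespace NHYM

open Filter Topology

/-! ### Change of holomorphic chart and positivity of the matrix of `ω`. -/

section Transition

variable {n : ℕ} {X : Type*} [TopologicalSpace X] [ChartedSpace (Fin n → ℂ) X]
  [IsManifold 𝓘(ℂ, Fin n → ℂ) ω X]
  {φ ψ : OpenPartialHomeomorph X (Fin n → ℂ)} {y : Fin n → ℂ}

theorem contDiffAt_transition (hφ : φ ∈ atlas (Fin n → ℂ) X) (hψ : ψ ∈ atlas (Fin n → ℂ) X)
    (hy : y ∈ φ.target) (hy' : φ.symm y ∈ ψ.source) : ContDiffAt ℂ ω (ψ ∘ φ.symm) y := by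
  have h := (contDiffGroupoid ω 𝓘(ℂ, Fin n → ℂ)).compatible hφ hψ
  rw [contDiffGroupoid, mem_groupoid_of_pregroupoid] at h
  have h1 : ContDiffOn ℂ ω (ψ ∘ φ.symm) (φ.symm ≫ₕ ψ).source := by
    simpa [contDiffPregroupoid] using h.1
  refine h1.contDiffAt ((φ.symm ≫ₕ ψ).open_source.mem_nhds ?_)
  simp [hy, hy']

theorem fderiv_real_I_smul {τ : (Fin n → ℂ) → (Fin n → ℂ)} (h : DifferentiableAt ℂ τ y)
    (u : Fin n → ℂ) : fderiv ℝ τ y (Complex.I • u) = Complex.I • fderiv ℝ τ y u := by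
  rw [h.fderiv_restrictScalars ℝ]
  simp

/-- The tangent space at a point is modelled on `ℂⁿ` through the preferred chart there, so a
coordinate vector is represented by the derivative of a transition map. -/
theorem chartVec_eq (hφ : φ ∈ atlas (Fin n → ℂ) X) (hy : y ∈ φ.target) (u : Fin n → ℂ) :
    chartVec φ y u = fderiv ℝ (chartAt (Fin n → ℂ) (φ.symm y) ∘ φ.symm) y u := by
  have hd : MDifferentiableAt 𝓘(ℝ, Fin n → ℂ) 𝓘(ℝ, Fin n → ℂ) φ.symm y := by
    have : IsManifold 𝓘(ℝ, Fin n → ℂ) 1 X := IsManifold.of_le (n := ∞) (by norm_num)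
    exact (mdifferentiable_of_mem_atlas hφ).mdifferentiableAt_symm hy
  refine (DFunLike.congr_fun hd.mfderiv u).trans ?_
  simp only [writtenInExtChartAt, mfld_simps, fderivWithin_univ]
  rfl

theorem chartVec_transition (hφ : φ ∈ atlas (Fin n → ℂ) X) (hψ : ψ ∈ atlas (Fin n → ℂ) X)
    (hy : y ∈ φ.target) (hy' : φ.symm y ∈ ψ.source) (u : Fin n → ℂ) :
    fderiv ℝ (chartAt (Fin n → ℂ) (φ.symm y) ∘ φ.symm) y u
      = fderiv ℝ (chartAt (Fin n → ℂ) (φ.symm y) ∘ ψ.symm) ((ψ ∘ φ.symm) y)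
        (fderiv ℝ (ψ ∘ φ.symm) y u) := by
  have h1 := ψ.map_source hy'
  have h2 := ψ.left_inv hy'
  set χ := chartAt (Fin n → ℂ) (φ.symm y)
  have hχ : χ ∈ atlas (Fin n → ℂ) X := chart_mem_atlas _ _
  have hev : χ ∘ φ.symm =ᶠ[𝓝 y] (χ ∘ ψ.symm) ∘ (ψ ∘ φ.symm) := by
    filter_upwards [(φ.continuousAt_symm hy).preimage_mem_nhds (ψ.open_source.mem_nhds hy')]
      with z hz
    simp only [Function.comp_apply]
    rw [ψ.left_inv hz]
  have d1 : DifferentiableAt ℝ (ψ ∘ φ.symm) y :=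
    ((contDiffAt_transition hφ hψ hy hy').differentiableAt (by simp)).restrictScalars ℝ
  have d2 : DifferentiableAt ℝ (χ ∘ ψ.symm) ((ψ ∘ φ.symm) y) :=
    ((contDiffAt_transition hψ hχ h1 (by rw [h2]; exact mem_chart_source _ _)).differentiableAt
      (by simp)).restrictScalars ℝ
  rw [hev.fderiv_eq, fderiv_comp y d2 d1]
  rfl

theorem fderiv_transition_comp (hφ : φ ∈ atlas (Fin n → ℂ) X) (hψ : ψ ∈ atlas (Fin n → ℂ) X)
    (hy : y ∈ φ.target) (hy' : φ.symm y ∈ ψ.source) (u : Fin n → ℂ) :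
    fderiv ℝ (φ ∘ ψ.symm) (ψ (φ.symm y)) (fderiv ℝ (ψ ∘ φ.symm) y u) = u := by
  have h1 := ψ.map_source hy'
  have h2 := ψ.left_inv hy'
  have hev : id =ᶠ[𝓝 y] (φ ∘ ψ.symm) ∘ (ψ ∘ φ.symm) := by
    filter_upwards [(φ.continuousAt_symm hy).preimage_mem_nhds (ψ.open_source.mem_nhds hy'),
      φ.open_target.mem_nhds hy] with z hz hz'
    simp only [Function.comp_apply]
    rw [ψ.left_inv hz, φ.right_inv hz', id]
  have d1 : DifferentiableAt ℝ (ψ ∘ φ.symm) y :=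
    ((contDiffAt_transition hφ hψ hy hy').differentiableAt (by simp)).restrictScalars ℝ
  have d2 : DifferentiableAt ℝ (φ ∘ ψ.symm) ((ψ ∘ φ.symm) y) :=
    ((contDiffAt_transition hψ hφ h1 (by rw [h2]; exact φ.map_target hy)).differentiableAt
      (by simp)).restrictScalars ℝ
  have := hev.fderiv_eq (𝕜 := ℝ)
  rw [fderiv_comp y d2 d1, fderiv_id] at this
  exact (DFunLike.congr_fun this u).symm

/-- Chart independence of the form `ω`. -/
theorem KahlerForm.coord_transition (ω₀ : KahlerForm n X) (hφ : φ ∈ atlas (Fin n → ℂ) X)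
    (hψ : ψ ∈ atlas (Fin n → ℂ) X) (hy : y ∈ φ.target) (hy' : φ.symm y ∈ ψ.source)
    (u v : Fin n → ℂ) :
    ω₀.coord φ y u v = ω₀.coord ψ (ψ (φ.symm y)) (fderiv ℝ (ψ ∘ φ.symm) y u)
      (fderiv ℝ (ψ ∘ φ.symm) y v) := by
  have h1 := ψ.map_source hy'
  have h2 := ψ.left_inv hy'
  let T : X → (Fin n → ℂ) → (Fin n → ℂ) → ℝ := fun x u v => ω₀.form x u v
  have e1 : ∀ u v, chartForm ω₀.form φ y u v = T (φ.symm y)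
      (fderiv ℝ (chartAt (Fin n → ℂ) (φ.symm y) ∘ φ.symm) y u)
      (fderiv ℝ (chartAt (Fin n → ℂ) (φ.symm y) ∘ φ.symm) y v) := fun u v => by
    rw [← chartVec_eq hφ hy, ← chartVec_eq hφ hy]; rfl
  have e2 : ∀ u v, chartForm ω₀.form ψ (ψ (φ.symm y)) u v = T (φ.symm y)
      (fderiv ℝ (chartAt (Fin n → ℂ) (φ.symm y) ∘ ψ.symm) (ψ (φ.symm y)) u)
      (fderiv ℝ (chartAt (Fin n → ℂ) (φ.symm y) ∘ ψ.symm) (ψ (φ.symm y)) v) := fun u v => by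
    have : chartForm ω₀.form ψ (ψ (φ.symm y)) u v = T (ψ.symm (ψ (φ.symm y)))
      (fderiv ℝ (chartAt (Fin n → ℂ) (ψ.symm (ψ (φ.symm y))) ∘ ψ.symm) (ψ (φ.symm y)) u)
      (fderiv ℝ (chartAt (Fin n → ℂ) (ψ.symm (ψ (φ.symm y))) ∘ ψ.symm) (ψ (φ.symm y)) v) := by
      rw [← chartVec_eq hψ h1, ← chartVec_eq hψ h1]; rfl
    rw [this, h2]
  rw [coord, coord, e1, e2, chartVec_transition hφ hψ hy hy' u, chartVec_transition hφ hψ hy hy' v]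
  rfl

/-- The derivative of a holomorphic transition map commutes with `J`, so the `(1,1)`-part transforms
like the form itself. -/
theorem KahlerForm.herm_transition (ω₀ : KahlerForm n X) (hφ : φ ∈ atlas (Fin n → ℂ) X)
    (hψ : ψ ∈ atlas (Fin n → ℂ) X) (hy : y ∈ φ.target) (hy' : φ.symm y ∈ ψ.source)
    (u v : Fin n → ℂ) :
    ω₀.herm φ y u v = ω₀.herm ψ (ψ (φ.symm y)) (fderiv ℝ (ψ ∘ φ.symm) y u)
      (fderiv ℝ (ψ ∘ φ.symm) y v) := by
  have hd := (contDiffAt_transition hφ hψ hy hy').differentiableAt (by simp)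
  simp only [herm, sesq, ω₀.coord_transition hφ hψ hy hy', fderiv_real_I_smul hd]

theorem KahlerForm.Adapted.transition {ω₀ : KahlerForm n X} {b : Fin n → Fin n → ℂ}
    (h : ω₀.Adapted φ y b) (hφ : φ ∈ atlas (Fin n → ℂ) X)
    (hψ : ψ ∈ atlas (Fin n → ℂ) X) (hy : y ∈ φ.target) (hy' : φ.symm y ∈ ψ.source) :
    ω₀.Adapted ψ (ψ (φ.symm y)) fun l => fderiv ℝ (ψ ∘ φ.symm) y (b l) := fun l m => by
  rw [← ω₀.herm_transition hφ hψ hy hy', h l m]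

theorem KahlerForm.herm_eq (ω₀ : KahlerForm n X) (hφ : φ ∈ atlas (Fin n → ℂ) X)
    (hy : y ∈ φ.target) (u v : Fin n → ℂ) : ω₀.herm φ y u v
      = (1 / 2 : ℂ) * (ω₀.coord φ y u (Complex.I • v) - Complex.I * ω₀.coord φ y u v) := by
  have hb := ω₀.isRealBilin_coord φ y
  have hd := (contDiffAt_transition hφ (chart_mem_atlas (Fin n → ℂ) (φ.symm y)) hy
    (mem_chart_source _ _)).differentiableAt (by simp)
  have hJ : ∀ u v, ω₀.coord φ y (Complex.I • u) (Complex.I • v) = ω₀.coord φ y u v := by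
    intro u v
    simp only [coord, chartForm]
    rw [← ω₀.type_one_one (φ.symm y) (chartVec φ y u) (chartVec φ y v)]
    have : ∀ w, chartVec φ y (Complex.I • w) = tangentJ (φ.symm y) (chartVec φ y w) := fun w => by
      rw [chartVec_eq hφ hy, chartVec_eq hφ hy, fderiv_real_I_smul hd]
      rfl
    rw [this, this]
  have h2 : ω₀.coord φ y (Complex.I • u) v = -ω₀.coord φ y u (Complex.I • v) := by
    have := hJ (Complex.I • u) v
    rw [I_smul_I_smul, hb.neg_left] at this
    rw [← this]
  rw [herm, sesq, hJ, h2]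
  simp only [smul_eq_mul]
  ring_nf
  simp only [Complex.I_sq]
  ring

theorem KahlerForm.matrix_posDef (ω₀ : KahlerForm n X) (hφ : φ ∈ atlas (Fin n → ℂ) X)
    (hy : y ∈ φ.target) : (ω₀.matrix φ y).PosDef := by
  have hb := ω₀.isRealBilin_coord φ y
  have hd := (contDiffAt_transition hφ (chart_mem_atlas (Fin n → ℂ) (φ.symm y)) hy
    (mem_chart_source _ _)).differentiableAt (by simp)
  have hJ : ∀ w, chartVec φ y (Complex.I • w) = tangentJ (φ.symm y) (chartVec φ y w) := fun w => by
    rw [chartVec_eq hφ hy, chartVec_eq hφ hy, fderiv_real_I_smul hd]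
    rfl
  have halt : ∀ u, ω₀.coord φ y u u = 0 := fun u => by
    simp [coord, chartForm, ω₀.alternating]
  have hanti : ∀ u v, ω₀.coord φ y u v = -ω₀.coord φ y v u := by
    intro u v
    have := halt (u + v)
    rw [hb.add_left, hb.add_right, hb.add_right, halt, halt, zero_add, add_zero] at this
    exact eq_neg_of_add_eq_zero_left this
  have hpos : ∀ u, u ≠ 0 → ∃ t : ℝ, 0 < t ∧ ω₀.herm φ y u u = t := by
    intro u hu
    refine ⟨1 / 2 * chartForm ω₀.form φ y u (Complex.I • u), ?_, ?_⟩
    · refine mul_pos (by norm_num) ?_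
      simp only [chartForm, hJ]
      refine ω₀.positive _ _ fun h0 => hu ?_
      rw [chartVec_eq hφ hy] at h0
      rw [← fderiv_transition_comp hφ (chart_mem_atlas (Fin n → ℂ) (φ.symm y)) hy
        (mem_chart_source _ _) u]
      rw [show fderiv ℝ (chartAt (Fin n → ℂ) (φ.symm y) ∘ φ.symm) y u = 0 from h0, map_zero]
    · rw [ω₀.herm_eq hφ hy, halt, coord]
      push_cast
      ring
  have hconj : ∀ u v, (starRingEnd ℂ) (ω₀.herm φ y u v) = ω₀.herm φ y v u := by
    intro u v
    rw [ω₀.herm_eq hφ hy, ω₀.herm_eq hφ hy]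
    have h1 : ω₀.coord φ y v (Complex.I • u) = ω₀.coord φ y u (Complex.I • v) := by
      have e1 := ω₀.herm_eq hφ hy u v
      have hJ' : ω₀.coord φ y (Complex.I • v) (Complex.I • (Complex.I • u))
          = ω₀.coord φ y v (Complex.I • u) := by
        simp only [coord, chartForm]
        rw [hJ v, hJ (Complex.I • u), ω₀.type_one_one]
      rw [I_smul_I_smul, hb.neg_right, hanti, neg_neg] at hJ'
      exact hJ'.symm
    rw [h1, hanti v u]
    simp only [coord, map_mul, map_sub, Complex.conj_ofReal, Complex.conj_I, map_div₀, map_one,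
      Complex.conj_ofNat]
    ring
  refine Matrix.PosDef.of_dotProduct_mulVec_pos ?_ ?_
  · ext j k
    rw [Matrix.conjTranspose_apply, matrix_eq_herm, matrix_eq_herm, ← starRingEnd_apply, hconj]
  · intro x hx
    -- The conjugate vector appears because `herm` is linear in its first slot and conjugate-linear
    -- in its second.
    have hx' : (star x : Fin n → ℂ) ≠ 0 := star_ne_zero.2 hx
    obtain ⟨t, ht, he⟩ := hpos (star x) hx'
    have : star x ⬝ᵥ (ω₀.matrix φ y *ᵥ x) = t := by
      rw [← he, herm_eq_sum]
      simp only [dotProduct, Matrix.mulVec, Finset.mul_sum]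
      refine Finset.sum_congr rfl fun j _ => Finset.sum_congr rfl fun k _ => ?_
      simp only [Pi.star_apply, starRingEnd_apply, star_star]
      ring
    rw [this]
    exact_mod_cast ht

/-- The rows of `g^{-1/2}` form a unitary frame. -/
theorem KahlerForm.exists_adapted (ω₀ : KahlerForm n X) (hφ : φ ∈ atlas (Fin n → ℂ) X)
    (hy : y ∈ φ.target) : ∃ b, ω₀.Adapted φ y b := by
  obtain ⟨h1, h2, h3⟩ := sqrt_spec (ω₀.matrix_posDef hφ hy)
  set S := cfc Real.sqrt (ω₀.matrix φ y)
  refine ⟨(S⁻¹ : Matrix (Fin n) (Fin n) ℂ), (KahlerForm.adapted_iff _).2 ?_⟩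
  change S⁻¹ * ω₀.matrix φ y * (S⁻¹)ᴴ = 1
  rw [Matrix.conjTranspose_nonsing_inv, h1, ← h2, Matrix.nonsing_inv_mul_cancel_left _ _ h3,
    Matrix.mul_nonsing_inv _ h3]

end Transition

end NHYM

namespace NHYM

open Filter Topology

/-! ### The Laplacian as a frame sum of second derivatives, in any holomorphic chart. -/

section Laplacian

variable {n : ℕ} {y : Fin n → ℂ}

theorem hess_eq_fderiv_fderiv {F : (Fin n → ℂ) → ℝ} (hF : ContDiffAt ℝ 2 F y) (u v : Fin n → ℂ) :
    fderiv ℝ (fun z => fderiv ℝ F z v) y u = fderiv ℝ (fderiv ℝ F) y u v := by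
  have hd : DifferentiableAt ℝ (fderiv ℝ F) y :=
    (hF.fderiv_right (m := 1) (by norm_num)).differentiableAt (by norm_num)
  rw [fderiv_clm_apply hd (differentiableAt_const v)]
  simp

theorem isRealBilin_ddc {F : (Fin n → ℂ) → ℝ} (hF : ContDiffAt ℝ 2 F y) :
    IsRealBilin (ddc F y) := by
  have e : ∀ u v, ddc F y u v = Complex.I * ((fderiv ℝ (fderiv ℝ F) y u (Complex.I • v)
      - fderiv ℝ (fderiv ℝ F) y v (Complex.I • u) : ℝ) : ℂ) := fun u v => by
    rw [ddc, hess_eq_fderiv_fderiv hF, hess_eq_fderiv_fderiv hF]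
  constructor
  · intro u u' v
    simp only [e, smul_add, map_add, add_apply]
    push_cast
    ring
  · intro c u v
    simp only [e, Complex.coe_smul, smul_comm Complex.I c, map_smul, smul_apply, smul_eq_mul]
    push_cast
    ring
  · intro u v v'
    simp only [e, smul_add, map_add, add_apply]
    push_cast
    ring
  · intro c u v
    simp only [e, Complex.coe_smul, smul_comm Complex.I c, map_smul, smul_apply, smul_eq_mul]
    push_cast
    ring

theorem diag11_ddc {F : (Fin n → ℂ) → ℝ} (hF : ContDiffAt ℝ 2 F y) (b : Fin n → ℂ) :
    diag11 (ddc F y) b = ((1 / 2 * (hess F y b + hess F y (Complex.I • b)) : ℝ) : ℂ) := by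
  simp only [diag11, ddc, hess, hess_eq_fderiv_fderiv hF, smul_eq_mul]
  simp only [I_smul_I_smul, map_neg]
  have hI : Complex.I * Complex.I = -1 := Complex.I_mul_I
  push_cast
  linear_combination (1 / 4 : ℂ) * (-2 * (fderiv ℝ (fderiv ℝ F) y b b : ℂ)
    - 2 * (fderiv ℝ (fderiv ℝ F) y (Complex.I • b) (Complex.I • b) : ℂ)) * hI

/-- The chain rule adds a term with the second derivative of `τ`. That derivative is complex
bilinear, so its values at `(b, b)` and `(Jb, Jb)` are opposite and the sum over the complex line is
free of first-order terms. -/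
theorem hess_comp_holomorphic {F : (Fin n → ℂ) → ℝ} {τ : (Fin n → ℂ) → (Fin n → ℂ)}
    (hτ : ContDiffAt ℂ ω τ y) (hF : ContDiffAt ℝ 2 F (τ y)) (b : Fin n → ℂ) :
    hess (F ∘ τ) y b + hess (F ∘ τ) y (Complex.I • b)
      = hess F (τ y) (fderiv ℝ τ y b) + hess F (τ y) (Complex.I • fderiv ℝ τ y b) := by
  have hτev : ∀ᶠ z in 𝓝 y, DifferentiableAt ℂ τ z :=
    ((hτ.of_le (m := 1) (by simp)).eventually (by simp)).mono fun z hz =>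
      hz.differentiableAt (by simp)
  have hτ2 : DifferentiableAt ℂ (fderiv ℂ τ) y :=
    (hτ.fderiv_right (m := 1) (by simp)).differentiableAt (by simp)
  have hσ : ∀ v, DifferentiableAt ℂ (fun z => fderiv ℂ τ z v) y := fun v =>
    hτ2.clm_apply (differentiableAt_const v)
  have hFd : DifferentiableAt ℝ (fderiv ℝ F) (τ y) :=
    (hF.fderiv_right (m := 1) (by norm_num)).differentiableAt (by norm_num)
  have hτd : DifferentiableAt ℝ τ y := hτev.self_of_nhds.restrictScalars ℝ
  have key : ∀ v, hess (F ∘ τ) y v = hess F (τ y) (fderiv ℝ τ y v)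
      + fderiv ℝ F (τ y) (fderiv ℂ (fun z => fderiv ℂ τ z v) y v) := by
    intro v
    have hev : (fun z => fderiv ℝ (F ∘ τ) z v)
        =ᶠ[𝓝 y] fun z => fderiv ℝ F (τ z) (fderiv ℂ τ z v) := by
      filter_upwards [hτev, hτ.continuousAt.eventually (hF.eventually (by simp))] with z h1 h2
      rw [fderiv_comp z (h2.differentiableAt (by norm_num)) (h1.restrictScalars ℝ),
        h1.fderiv_restrictScalars ℝ]
      rfl
    have h3 : HasFDerivAt (fun z => fderiv ℝ F (τ z))
        ((fderiv ℝ (fderiv ℝ F) (τ y)).comp (fderiv ℝ τ y)) y :=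
      hFd.hasFDerivAt.comp y hτd.hasFDerivAt
    have h4 := (h3.clm_apply ((hσ v).restrictScalars ℝ).hasFDerivAt).fderiv
    rw [hess, hev.fderiv_eq, h4, (hσ v).fderiv_restrictScalars ℝ, hess,
      hess_eq_fderiv_fderiv hF]
    simp only [add_apply, ContinuousLinearMap.comp_apply,
      ContinuousLinearMap.flip_apply, hτev.self_of_nhds.fderiv_restrictScalars ℝ,
      ContinuousLinearMap.coe_restrictScalars']
    ring
  have hneg : fderiv ℂ (fun z => fderiv ℂ τ z (Complex.I • b)) y (Complex.I • b)
      = -fderiv ℂ (fun z => fderiv ℂ τ z b) y b := by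
    simp only [map_smul]
    rw [fderiv_fun_const_smul (hσ b)]
    simp [smul_smul]
  rw [key, key, hneg, map_neg, fderiv_real_I_smul hτev.self_of_nhds]
  ring

variable {X : Type*} [TopologicalSpace X] [ChartedSpace (Fin n → ℂ) X]
  {φ : OpenPartialHomeomorph X (Fin n → ℂ)}

theorem KahlerForm.laplacian_eq_chartAt (ω₀ : KahlerForm n X) {f : X → ℝ} {x : X}
    (hf : ContDiffAt ℝ 2 (f ∘ (chartAt (Fin n → ℂ) x).symm) (chartAt (Fin n → ℂ) x x))
    {b : Fin n → Fin n → ℂ}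
    (hb : ω₀.Adapted (chartAt (Fin n → ℂ) x) (chartAt (Fin n → ℂ) x x) b) :
    ω₀.laplacian f x = 1 / 2 * frameSum b
      (hess (f ∘ (chartAt (Fin n → ℂ) x).symm) (chartAt (Fin n → ℂ) x x)) := by
  rw [laplacian]
  change (ω₀.iLambda _ _ (ddc (f ∘ (chartAt (Fin n → ℂ) x).symm) _)).re = _
  rw [hb.iLambda_eq (isRealBilin_ddc hf)]
  simp only [diag11_ddc hf, frameSum]
  rw [Complex.re_sum, Finset.mul_sum]
  simp only [Complex.ofReal_re]

theorem KahlerForm.laplacian_eq [IsManifold 𝓘(ℂ, Fin n → ℂ) ω X] (ω₀ : KahlerForm n X)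
    (hφ : φ ∈ atlas (Fin n → ℂ) X) {f : X → ℝ} {x : X} (hx : x ∈ φ.source)
    (hf : ContDiffAt ℝ 2 (f ∘ φ.symm) (φ x)) {b : Fin n → Fin n → ℂ}
    (hb : ω₀.Adapted φ (φ x) b) :
    ω₀.laplacian f x = 1 / 2 * frameSum b (hess (f ∘ φ.symm) (φ x)) := by
  have hψ := chart_mem_atlas (Fin n → ℂ) x
  set ψ := chartAt (Fin n → ℂ) x with hψdef
  have hxψ : x ∈ ψ.source := mem_chart_source _ x
  have hy : φ x ∈ φ.target := φ.map_source hx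
  have hi : φ.symm (φ x) = x := φ.left_inv hx
  have hiψ : ψ.symm (ψ x) = x := ψ.left_inv hxψ
  have hb' := hb.transition hφ hψ hy (by rwa [hi])
  rw [hi] at hb'
  have hτ : ContDiffAt ℂ ω (φ ∘ ψ.symm) (ψ x) :=
    contDiffAt_transition hψ hφ (ψ.map_source hxψ) (by rwa [hiψ])
  have hτx : (φ ∘ ψ.symm) (ψ x) = φ x := by simp only [Function.comp_apply, hiψ]
  have hev : f ∘ ψ.symm =ᶠ[𝓝 (ψ x)] (f ∘ φ.symm) ∘ (φ ∘ ψ.symm) := by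
    filter_upwards [(ψ.continuousAt_symm (ψ.map_source hxψ)).preimage_mem_nhds
      (φ.open_source.mem_nhds (by rwa [hiψ]))] with z hz
    simp only [Function.comp_apply]
    rw [φ.left_inv hz]
  have hf' : ContDiffAt ℝ 2 (f ∘ φ.symm) ((φ ∘ ψ.symm) (ψ x)) := by rwa [hτx]
  have hfψ : ContDiffAt ℝ 2 (f ∘ ψ.symm) (ψ x) :=
    (hf'.comp (ψ x) ((hτ.restrict_scalars ℝ).of_le (by simp))).congr_of_eventuallyEq hev
  rw [ω₀.laplacian_eq_chartAt hfψ hb']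
  congr 1
  refine Finset.sum_congr rfl fun l _ => ?_
  have hc := fderiv_transition_comp hφ hψ hy (by rwa [hi]) (b l)
  rw [hi] at hc
  rw [hess_congr hev, hess_congr hev, hess_comp_holomorphic hτ hf', hc, hτx]

end Laplacian

end NHYM

namespace NHYM

open Filter Topology Metric

/-! ### Second-order conditions and linear algebra for the maximum principle. -/

section Contact

/-- A positive second derivative would make the point a local minimum as well, so `g` would be
constant near it and its second derivative zero. -/
theorem deriv_deriv_nonpos_of_isLocalMax {g : ℝ → ℝ} {a : ℝ} (h : IsLocalMax g a)
    (hc : ContinuousAt g a) : deriv (deriv g) a ≤ 0 := by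
  by_contra! hpos
  have hmin : IsLocalMin g a := isLocalMin_of_deriv_deriv_pos hpos h.deriv_eq_zero hc
  have hev : g =ᶠ[𝓝 a] fun _ => g a := by
    filter_upwards [h, hmin] with x h1 h2 using le_antisymm h1 h2
  rw [hev.deriv.deriv_eq] at hpos
  simp at hpos

theorem fderiv_fderiv_nonpos_of_isLocalMax {E : Type*} [NormedAddCommGroup E] [NormedSpace ℝ E]
    {Φ : E → ℝ} {y : E} (hΦ : ContDiffAt ℝ 2 Φ y) (h : IsLocalMax Φ y) (u : E) :
    fderiv ℝ (fderiv ℝ Φ) y u u ≤ 0 := by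
  have hl : ∀ t : ℝ, HasDerivAt (fun t : ℝ => y + t • u) u t := fun t => by
    simpa using ((hasDerivAt_id t).smul_const u).const_add y
  have hy0 : y + (0 : ℝ) • u = y := by simp
  have hcont : Tendsto (fun t : ℝ => y + t • u) (𝓝 0) (𝓝 y) := by
    have := (hl 0).continuousAt.tendsto
    rwa [hy0] at this
  have hev : deriv (fun t : ℝ => Φ (y + t • u)) =ᶠ[𝓝 0] fun t => fderiv ℝ Φ (y + t • u) u := by
    filter_upwards [hcont.eventually (hΦ.eventually (by simp))] with t ht
    exact ((ht.differentiableAt (by norm_num)).hasFDerivAt.comp_hasDerivAt t (hl t)).deriv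
  have hd : HasFDerivAt (fderiv ℝ Φ) (fderiv ℝ (fderiv ℝ Φ) y) (y + (0 : ℝ) • u) := by
    rw [hy0]
    exact ((hΦ.fderiv_right (m := 1) (by norm_num)).differentiableAt (by norm_num)).hasFDerivAt
  have h1 := hd.comp_hasDerivAt (0 : ℝ) (hl 0)
  have h2 : HasDerivAt (fun t : ℝ => fderiv ℝ Φ (y + t • u) u) (fderiv ℝ (fderiv ℝ Φ) y u u) 0 := by
    simpa using h1.clm_apply (hasDerivAt_const (0 : ℝ) u)
  rw [← h2.deriv, ← hev.deriv_eq]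
  refine deriv_deriv_nonpos_of_isLocalMax ?_ ?_
  · have : IsLocalMax Φ (y + (0 : ℝ) • u) := by rwa [hy0]
    exact (hcont.eventually h).mono fun t ht => by simpa using ht
  · have : ContinuousAt Φ (y + (0 : ℝ) • u) := by rw [hy0]; exact hΦ.continuousAt
    exact ContinuousAt.comp (f := fun t : ℝ => y + t • u) this (hl 0).continuousAt

variable {n : ℕ}

/-- The real scalar product of `ℂⁿ`. -/
noncomputable def dotR (u w : Fin n → ℂ) : ℝ := ∑ j, ((u j).re * (w j).re + (u j).im * (w j).im)

/-- The norm of `Fin n → ℂ` is the supremum norm, whereas `dotR` is Euclidean; this and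
`norm_sq_le_dotR` compare the two. -/
theorem abs_dotR_le (u w : Fin n → ℂ) : |dotR u w| ≤ 2 * n * ‖u‖ * ‖w‖ := by
  refine (Finset.abs_sum_le_sum_abs _ _).trans ?_
  have : ∀ j ∈ Finset.univ, |(u j).re * (w j).re + (u j).im * (w j).im| ≤ 2 * ‖u‖ * ‖w‖ := by
    intro j _
    refine (abs_add_le _ _).trans ?_
    rw [abs_mul, abs_mul]
    have h1 := (Complex.abs_re_le_norm (u j)).trans (norm_le_pi_norm u j)
    have h2 := (Complex.abs_im_le_norm (u j)).trans (norm_le_pi_norm u j)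
    have h3 := (Complex.abs_re_le_norm (w j)).trans (norm_le_pi_norm w j)
    have h4 := (Complex.abs_im_le_norm (w j)).trans (norm_le_pi_norm w j)
    have h5 := mul_le_mul h1 h3 (abs_nonneg _) (norm_nonneg _)
    have h6 := mul_le_mul h2 h4 (abs_nonneg _) (norm_nonneg _)
    linarith
  refine (Finset.sum_le_sum this).trans_eq ?_
  simp
  ring

theorem norm_sq_le_dotR (u : Fin n → ℂ) : ‖u‖ ^ 2 ≤ dotR u u := by
  have h0 : 0 ≤ dotR u u := Finset.sum_nonneg fun j _ =>
    add_nonneg (mul_self_nonneg _) (mul_self_nonneg _)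
  rw [← Real.sqrt_le_sqrt_iff h0, Real.sqrt_sq (norm_nonneg _)]
  refine (pi_norm_le_iff_of_nonneg (Real.sqrt_nonneg _)).2 fun j => ?_
  rw [Complex.norm_eq_sqrt_sq_add_sq]
  refine Real.sqrt_le_sqrt ?_
  rw [sq, sq]
  exact Finset.single_le_sum (f := fun j => (u j).re * (u j).re + (u j).im * (u j).im)
    (fun j _ => add_nonneg (mul_self_nonneg _) (mul_self_nonneg _)) (Finset.mem_univ j)

/-- The scalar product with a fixed vector. -/
noncomputable def dotCLM (u : Fin n → ℂ) : (Fin n → ℂ) →L[ℝ] ℝ :=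
  ∑ j, ((u j).re • (Complex.reCLM.comp (ContinuousLinearMap.proj j))
    + (u j).im • (Complex.imCLM.comp (ContinuousLinearMap.proj j)))

theorem dotCLM_apply (u w : Fin n → ℂ) : dotCLM u w = dotR u w := by
  simp [dotCLM, dotR, sum_apply]

/-- The scalar product as a bilinear map. -/
noncomputable def dotCLM₂ : (Fin n → ℂ) →L[ℝ] (Fin n → ℂ) →L[ℝ] ℝ :=
  ∑ j, ((Complex.reCLM.comp (ContinuousLinearMap.proj j)).smulRight
      (Complex.reCLM.comp (ContinuousLinearMap.proj (R := ℝ) (φ := fun _ : Fin n => ℂ) j))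
    + (Complex.imCLM.comp (ContinuousLinearMap.proj j)).smulRight
      (Complex.imCLM.comp (ContinuousLinearMap.proj (R := ℝ) (φ := fun _ : Fin n => ℂ) j)))

theorem dotCLM₂_apply (u : Fin n → ℂ) : dotCLM₂ u = dotCLM u := by
  ext w
  simp [dotCLM₂, dotCLM, sum_apply]

theorem dotR_comm (u w : Fin n → ℂ) : dotR u w = dotR w u :=
  Finset.sum_congr rfl fun j _ => by ring

theorem contDiff_dotR (y₀ : Fin n → ℂ) : ContDiff ℝ 2 fun z => dotR (z - y₀) (z - y₀) := by
  simp only [← dotCLM_apply, ← dotCLM₂_apply]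
  exact (dotCLM₂.contDiff.comp (contDiff_id.sub contDiff_const)).clm_apply
    (contDiff_id.sub contDiff_const)

theorem fderiv_dotR (y₀ z : Fin n → ℂ) :
    fderiv ℝ (fun z => dotR (z - y₀) (z - y₀)) z = (2 : ℝ) • dotCLM₂ (z - y₀) := by
  have hs : HasFDerivAt (fun z : Fin n → ℂ => z - y₀) (ContinuousLinearMap.id ℝ _) z :=
    (hasFDerivAt_id z).sub_const y₀
  have h := (dotCLM₂.hasFDerivAt.comp z hs).clm_apply hs
  have e : (fun z : Fin n → ℂ => dotR (z - y₀) (z - y₀))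
      = fun z => (dotCLM₂ ∘ fun z => z - y₀) z (z - y₀) := by
    funext z
    simp [dotCLM₂_apply, dotCLM_apply]
  rw [e, h.fderiv]
  ext w
  have e1 : dotCLM₂ w (z - y₀) = dotCLM₂ (z - y₀) w := by
    rw [dotCLM₂_apply, dotCLM₂_apply, dotCLM_apply, dotCLM_apply, dotR_comm]
  simp [-map_sub, e1]
  ring

theorem fderiv_fderiv_dotR (y₀ z : Fin n → ℂ) :
    fderiv ℝ (fderiv ℝ fun z => dotR (z - y₀) (z - y₀)) z = (2 : ℝ) • dotCLM₂ := by
  have e : (fderiv ℝ fun z => dotR (z - y₀) (z - y₀)) = fun z => (2 : ℝ) • dotCLM₂ (z - y₀) :=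
    funext fun z => fderiv_dotR y₀ z
  have hs : HasFDerivAt (fun z : Fin n → ℂ => z - y₀) (ContinuousLinearMap.id ℝ _) z :=
    (hasFDerivAt_id z).sub_const y₀
  rw [e]
  exact ((dotCLM₂.hasFDerivAt.comp z hs).const_smul (2 : ℝ)).fderiv

/-- The image of the unit ball lies in the ball of radius `‖L‖`; compare volumes in real dimension
`2n`. -/
theorem abs_det_le_norm_pow (L : (Fin n → ℂ) →L[ℝ] (Fin n → ℂ)) : |L.det| ≤ ‖L‖ ^ (2 * n) := by
  have hfin : Module.finrank ℝ (Fin n → ℂ) = 2 * n := by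
    rw [Module.finrank_pi_fintype]
    simp [Complex.finrank_real_complex, mul_comm]
  have h1 : volume (L '' closedBall 0 1) ≤ volume (closedBall (0 : Fin n → ℂ) ‖L‖) := by
    refine measure_mono ?_
    rintro _ ⟨x, hx, rfl⟩
    rw [mem_closedBall_zero_iff] at hx ⊢
    exact (L.le_opNorm x).trans (mul_le_of_le_one_right (norm_nonneg _) hx)
  rw [Measure.addHaar_image_continuousLinearMap, Measure.addHaar_closedBall' _ _ (norm_nonneg _),
    hfin] at h1
  have h2 : volume (closedBall (0 : Fin n → ℂ) 1) ≠ 0 :=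
    (measure_closedBall_pos volume _ zero_lt_one).ne'
  have h3 : volume (closedBall (0 : Fin n → ℂ) 1) ≠ ⊤ := measure_closedBall_lt_top.ne
  rw [ENNReal.mul_le_mul_iff_left h2 h3] at h1
  exact (ENNReal.ofReal_le_ofReal_iff (by positivity)).1 h1

/-- For a positive semidefinite form, `P(∑ aᵢ vᵢ) ≤ (∑ aᵢ²) (∑ P(vᵢ))`. -/
theorem posSemidef_apply_sum_le {E ι : Type*} [NormedAddCommGroup E] [NormedSpace ℝ E] [Fintype ι]
    (P : E →L[ℝ] E →L[ℝ] ℝ) (hP : ∀ u, 0 ≤ P u u) (a : ι → ℝ) (v : ι → E) :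
    P (∑ i, a i • v i) (∑ i, a i • v i) ≤ (∑ i, a i ^ 2) * ∑ i, P (v i) (v i) := by
  -- As in Lagrange's identity, half of this sum is the difference of the two sides of the claim.
  have h : 0 ≤ ∑ i, ∑ j, P (a i • v j - a j • v i) (a i • v j - a j • v i) :=
    Finset.sum_nonneg fun i _ => Finset.sum_nonneg fun j _ => hP _
  have e1 : ∀ i j, P (a i • v j - a j • v i) (a i • v j - a j • v i)
      = a i ^ 2 * P (v j) (v j) + P (v i) (v i) * a j ^ 2
        - a i * a j * P (v i) (v j) - a i * a j * P (v j) (v i) := by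
    intro i j
    simp only [map_sub, map_smul, sub_apply, smul_apply, smul_eq_mul]
    ring
  have e2 : P (∑ i, a i • v i) (∑ i, a i • v i) = ∑ i, ∑ j, a i * a j * P (v i) (v j) := by
    simp only [map_sum, map_smul, sum_apply, smul_apply, smul_eq_mul, Finset.mul_sum]
    rw [Finset.sum_comm]
    exact Finset.sum_congr rfl fun i _ => Finset.sum_congr rfl fun j _ => by ring
  have e3 : ∑ i, ∑ j, a i * a j * P (v j) (v i) = ∑ i, ∑ j, a i * a j * P (v i) (v j) := by
    rw [Finset.sum_comm]
    exact Finset.sum_congr rfl fun i _ => Finset.sum_congr rfl fun j _ => by ring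
  have e4 : ∑ i, ∑ j, P (v i) (v i) * a j ^ 2 = ∑ i, ∑ j, a i ^ 2 * P (v j) (v j) := by
    rw [Finset.sum_comm]
    exact Finset.sum_congr rfl fun i _ => Finset.sum_congr rfl fun j _ => by ring
  simp only [e1, Finset.sum_sub_distrib, Finset.sum_add_distrib] at h
  rw [e3, e4, ← Finset.sum_mul_sum] at h
  rw [e2]
  linarith

/-- Expand `P` at `u ± ‖u‖ w`: its positivity bounds the mixed term by the two diagonal ones. -/
theorem abs_le_of_posSemidef {E : Type*} [NormedAddCommGroup E] [NormedSpace ℝ E]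
    (P : E →L[ℝ] E →L[ℝ] ℝ) (hP : ∀ u, 0 ≤ P u u) (hs : ∀ u w, P u w = P w u) {Q : ℝ}
    (hQ : ∀ u, P u u ≤ Q * ‖u‖ ^ 2) (u w : E) (hw : ‖w‖ ≤ 1) : |P u w| ≤ Q * ‖u‖ := by
  rcases eq_or_ne u 0 with rfl | hu
  · simp
  have hu' : 0 < ‖u‖ := norm_pos_iff.2 hu
  have hQ0 : 0 ≤ Q := by
    have := (hP u).trans (hQ u)
    exact nonneg_of_mul_nonneg_left this (by positivity)
  have hw2 : P w w ≤ Q := (hQ w).trans (mul_le_of_le_one_right hQ0 (pow_le_one₀ (norm_nonneg _) hw))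
  have h1 := hP (u + ‖u‖ • w)
  have h2 := hP (u - ‖u‖ • w)
  simp only [map_sub, map_add, map_smul, add_apply, sub_apply, smul_apply, smul_eq_mul,
    hs w u] at h1 h2
  have hu2 := hQ u
  have h3 : ‖u‖ * (‖u‖ * P w w) ≤ ‖u‖ * (‖u‖ * Q) := by gcongr
  rw [abs_le]
  constructor
  · refine le_of_mul_le_mul_left ?_ hu'
    nlinarith
  · refine le_of_mul_le_mul_left ?_ hu'
    nlinarith

end Contact

end NHYM

namespace NHYM

open Filter Topology Metric

/-! ### The contact set and the Alexandrov–Bakelman–Pucci estimate. -/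

section Contact

variable {n : ℕ}

theorem dotR_self (u : Fin n → ℂ) : dotR u u = ∑ j, Complex.normSq (u j) := rfl

/-- The vector of partial derivatives, from a real linear form on `ℂⁿ`. -/
noncomputable def gradCLM (n : ℕ) : ((Fin n → ℂ) →L[ℝ] ℝ) →L[ℝ] (Fin n → ℂ) :=
  ContinuousLinearMap.pi fun j =>
    Complex.ofRealCLM.comp (ContinuousLinearMap.apply ℝ ℝ (Pi.single j 1 : Fin n → ℂ))
    + Complex.I • Complex.ofRealCLM.comp
      (ContinuousLinearMap.apply ℝ ℝ (Pi.single j Complex.I : Fin n → ℂ))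

theorem gradCLM_apply (L : (Fin n → ℂ) →L[ℝ] ℝ) (j : Fin n) :
    gradCLM n L j = (L (Pi.single j 1) : ℂ) + Complex.I * (L (Pi.single j Complex.I) : ℂ) := by
  simp [gradCLM]

theorem gradCLM_dotCLM (ξ : Fin n → ℂ) : gradCLM n (dotCLM ξ) = ξ := by
  funext j
  rw [gradCLM_apply, dotCLM_apply, dotCLM_apply]
  have h1 : dotR ξ (Pi.single j 1) = (ξ j).re := by
    rw [dotR, Finset.sum_eq_single j]
    · simp
    · intro k _ hk
      simp [hk]
    · simp
  have h2 : dotR ξ (Pi.single j Complex.I) = (ξ j).im := by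
    rw [dotR, Finset.sum_eq_single j]
    · simp
    · intro k _ hk
      simp [hk]
    · simp
  rw [h1, h2, mul_comm, Complex.re_add_im]

theorem norm_pi_single_le (j : Fin n) (c : ℂ) (hc : ‖c‖ ≤ 1) :
    ‖(Pi.single j c : Fin n → ℂ)‖ ≤ 1 := by
  refine (pi_norm_le_iff_of_nonneg zero_le_one).2 fun k => ?_
  rcases eq_or_ne k j with rfl | h
  · simpa using hc
  · simp [h]

theorem norm_gradCLM_comp_le (P : (Fin n → ℂ) →L[ℝ] (Fin n → ℂ) →L[ℝ] ℝ) {Q : ℝ} (hQ : 0 ≤ Q)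
    (hP : ∀ u w, ‖w‖ ≤ 1 → |P u w| ≤ Q * ‖u‖) : ‖(gradCLM n).comp P‖ ≤ 2 * Q := by
  refine ContinuousLinearMap.opNorm_le_bound _ (by positivity) fun u => ?_
  refine (pi_norm_le_iff_of_nonneg (by positivity)).2 fun j => ?_
  rw [ContinuousLinearMap.comp_apply, gradCLM_apply]
  refine (norm_add_le _ _).trans ?_
  rw [norm_mul, Complex.norm_I, one_mul, Complex.norm_real, Complex.norm_real, Real.norm_eq_abs,
    Real.norm_eq_abs]
  have h1 := hP u (Pi.single j 1) (norm_pi_single_le j 1 (by simp))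
  have h2 := hP u (Pi.single j Complex.I) (norm_pi_single_le j _ (by simp))
  linarith

/-- A negative form on `ℂⁿ` is bounded by its trace in a frame. -/
theorem apply_le_of_frameSum (P : (Fin n → ℂ) →L[ℝ] (Fin n → ℂ) →L[ℝ] ℝ) (hP : ∀ u, 0 ≤ P u u)
    (b : Fin n → Fin n → ℂ) {C Q : ℝ}
    (hb : ∀ u : Fin n → ℂ, ∃ c : Fin n → ℂ,
      u = ∑ l, c l • b l ∧ ∑ l, Complex.normSq (c l) ≤ C * ‖u‖ ^ 2)
    (hQ : frameSum b (fun u => P u u) ≤ Q) (u : Fin n → ℂ) : P u u ≤ C * Q * ‖u‖ ^ 2 := by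
  obtain ⟨c, hu, hc⟩ := hb u
  have h0 : 0 ≤ frameSum b (fun u => P u u) :=
    Finset.sum_nonneg fun l _ => add_nonneg (hP _) (hP _)
  -- The real and imaginary parts of the complex coordinates are the coefficients in the real frame
  -- `b`, `Jb`.
  have hu' : u = ∑ i : Fin n ⊕ Fin n, Sum.elim (fun l => (c l).re) (fun l => (c l).im) i
      • Sum.elim b (fun l => Complex.I • b l) i := by
    rw [Fintype.sum_sum_type, hu, ← Finset.sum_add_distrib]
    refine Finset.sum_congr rfl fun l _ => ?_
    funext k
    simp only [Sum.elim_inl, Sum.elim_inr, Pi.add_apply, Pi.smul_apply, smul_eq_mul,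
      Complex.real_smul]
    conv_lhs => rw [← Complex.re_add_im (c l)]
    ring
  have h := posSemidef_apply_sum_le P hP
    (Sum.elim (fun l => (c l).re) (fun l => (c l).im)) (Sum.elim b (fun l => Complex.I • b l))
  rw [← hu', Fintype.sum_sum_type, Fintype.sum_sum_type] at h
  simp only [Sum.elim_inl, Sum.elim_inr, ← Finset.sum_add_distrib] at h
  have hs : ∑ l, ((c l).re ^ 2 + (c l).im ^ 2) = ∑ l, Complex.normSq (c l) :=
    Finset.sum_congr rfl fun l _ => by rw [Complex.normSq_apply]; ring
  rw [hs] at h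
  have hcn : 0 ≤ C * ‖u‖ ^ 2 :=
    le_trans (Finset.sum_nonneg fun l _ => Complex.normSq_nonneg _) hc
  calc P u u ≤ _ := h
    _ ≤ C * ‖u‖ ^ 2 * Q := mul_le_mul hc hQ h0 hcn
    _ = _ := by ring

/-- The frame `b` of `ℂⁿ` and its inverse are bounded by `C`. -/
structure FrameBound (b : Fin n → Fin n → ℂ) (C : ℝ) : Prop where
  expansion : ∀ u : Fin n → ℂ, ∃ c : Fin n → ℂ,
    u = ∑ l, c l • b l ∧ ∑ l, Complex.normSq (c l) ≤ C * ‖u‖ ^ 2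
  sum_le : ∑ l, ∑ j, Complex.normSq (b l j) ≤ C

theorem FrameBound.frameSum_dotR_le {b : Fin n → Fin n → ℂ} {C : ℝ} (h : FrameBound b C) :
    frameSum b (fun u => dotR u u) ≤ 2 * C := by
  have : frameSum b (fun u => dotR u u) = 2 * ∑ l, ∑ j, Complex.normSq (b l j) := by
    rw [frameSum, Finset.mul_sum]
    refine Finset.sum_congr rfl fun l _ => ?_
    rw [dotR_self, dotR_self]
    simp [Complex.normSq_mul, two_mul]
  rw [this]
  linarith [h.sum_le]

theorem finrank_complex_pi : Module.finrank ℝ (Fin n → ℂ) = 2 * n := by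
  rw [Module.finrank_pi_fintype]
  simp [Complex.finrank_real_complex, mul_comm]

variable {F : (Fin n → ℂ) → ℝ} {y₀ : Fin n → ℂ} {ρ C β : ℝ}

/-- The function to which the maximum principle is applied. -/
noncomputable def capped (F : (Fin n → ℂ) → ℝ) (y₀ : Fin n → ℂ) (κ : ℝ) (z : Fin n → ℂ) : ℝ :=
  F z - κ * dotR (z - y₀) (z - y₀)

theorem contDiffAt_capped {κ : ℝ} {y : Fin n → ℂ} (hF : ContDiffAt ℝ 2 F y) :
    ContDiffAt ℝ 2 (capped F y₀ κ) y :=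
  hF.sub (contDiffAt_const.mul (contDiff_dotR y₀).contDiffAt)

theorem fderiv_fderiv_capped {κ : ℝ} {y : Fin n → ℂ} (hF : ContDiffAt ℝ 2 F y) :
    fderiv ℝ (fderiv ℝ (capped F y₀ κ)) y
      = fderiv ℝ (fderiv ℝ F) y - (2 * κ) • dotCLM₂ := by
  have hd : ∀ z, DifferentiableAt ℝ (fun z => dotR (z - y₀) (z - y₀)) z := fun z =>
    (contDiff_dotR y₀).contDiffAt.differentiableAt (by norm_num)
  have hev : fderiv ℝ (capped F y₀ κ)
      =ᶠ[𝓝 y] fun z => fderiv ℝ F z - κ • fderiv ℝ (fun z => dotR (z - y₀) (z - y₀)) z := by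
    filter_upwards [hF.eventually (by simp)] with z hz
    have h1 := (hz.differentiableAt (by norm_num)).hasFDerivAt.sub ((hd z).hasFDerivAt.const_mul κ)
    exact h1.fderiv
  have h2 : HasFDerivAt (fderiv ℝ F) (fderiv ℝ (fderiv ℝ F) y) y :=
    ((hF.fderiv_right (m := 1) (by norm_num)).differentiableAt (by norm_num)).hasFDerivAt
  have h3 : HasFDerivAt (fderiv ℝ fun z => dotR (z - y₀) (z - y₀)) ((2 : ℝ) • dotCLM₂) y := by
    rw [← fderiv_fderiv_dotR y₀ y]
    refine (DifferentiableAt.hasFDerivAt ?_)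
    exact ((contDiff_dotR y₀).contDiffAt.fderiv_right (m := 1) (by norm_num)).differentiableAt
      (by norm_num)
  have h4 := (h2.sub (h3.const_smul κ)).fderiv
  rw [smul_smul, mul_comm κ] at h4
  rw [hev.fderiv_eq]
  exact h4

/-- The set where the capped function is concave. -/
def contactSet (F : (Fin n → ℂ) → ℝ) (y₀ : Fin n → ℂ) (ρ κ m : ℝ) : Set (Fin n → ℂ) :=
  {y | y ∈ ball y₀ ρ ∧ m ≤ F y ∧ ∀ u, fderiv ℝ (fderiv ℝ (capped F y₀ κ)) y u u ≤ 0}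

/-- The height and concavity conditions are closed on the closed ball, where `F` and the second
derivative are continuous; intersect with the open ball. -/
theorem measurableSet_contactSet {κ m : ℝ} (hF : ∀ y ∈ closedBall y₀ ρ, ContDiffAt ℝ 2 F y) :
    MeasurableSet (contactSet F y₀ ρ κ m) := by
  have hc1 : ContinuousOn F (closedBall y₀ ρ) := fun y hy => (hF y hy).continuousAt.continuousWithinAt
  have hc2 : ContinuousOn (fderiv ℝ (fderiv ℝ (capped F y₀ κ))) (closedBall y₀ ρ) := fun y hy =>
    (((contDiffAt_capped (hF y hy)).fderiv_right (m := 1) (by norm_num)).fderiv_right (m := 0)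
      (by norm_num)).continuousAt.continuousWithinAt
  have hT : IsClosed {B : (Fin n → ℂ) →L[ℝ] (Fin n → ℂ) →L[ℝ] ℝ | ∀ u, B u u ≤ 0} := by
    simp only [ofPred_forall]
    exact isClosed_iInter fun u => isClosed_le (by fun_prop) continuous_const
  have e : contactSet F y₀ ρ κ m = ball y₀ ρ ∩ ((closedBall y₀ ρ ∩ F ⁻¹' Ici m)
      ∩ (closedBall y₀ ρ ∩ fderiv ℝ (fderiv ℝ (capped F y₀ κ)) ⁻¹'
        {B : (Fin n → ℂ) →L[ℝ] (Fin n → ℂ) →L[ℝ] ℝ | ∀ u, B u u ≤ 0})) := by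
    ext y
    constructor
    · rintro ⟨h1, h2, h3⟩
      exact ⟨h1, ⟨ball_subset_closedBall h1, h2⟩, ball_subset_closedBall h1, h3⟩
    · rintro ⟨h1, ⟨-, h2⟩, -, h3⟩
      exact ⟨h1, h2, h3⟩
  rw [e]
  exact measurableSet_ball.inter
    ((hc1.preimage_isClosed_of_isClosed isClosed_closedBall isClosed_Ici).measurableSet.inter
      (hc2.preimage_isClosed_of_isClosed isClosed_closedBall hT).measurableSet)

/-- Every small slope is attained on the contact set. -/
theorem closedBall_subset_image_contactSet (hρ : 0 < ρ)
    (hF : ∀ y ∈ closedBall y₀ ρ, ContDiffAt ℝ 2 F y) (h0 : 0 < F y₀)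
    (hle : ∀ y ∈ closedBall y₀ ρ, F y ≤ F y₀) :
    closedBall 0 (F y₀ / (4 * (n + 1) * ρ)) ⊆
      (fun y => gradCLM n (fderiv ℝ (capped F y₀ (F y₀ / ρ ^ 2)) y)) ''
        contactSet F y₀ ρ (F y₀ / ρ ^ 2) (F y₀ / 2) := by
  intro ξ hξ
  rw [mem_closedBall_zero_iff] at hξ
  -- With this choice the paraboloid costs at least the full height `F y₀` on the boundary of the
  -- ball.
  set κ := F y₀ / ρ ^ 2 with hκ
  have hκ0 : 0 < κ := by positivity
  set w : (Fin n → ℂ) → ℝ := fun z => capped F y₀ κ z - dotCLM ξ (z - y₀) with hw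
  -- The factor `4(n + 1)` in the slope bound outweighs the `2n` of `abs_dotR_le`, so the tilt over
  -- the ball is at most half the height.
  have hslope : ∀ z ∈ closedBall y₀ ρ, |dotR ξ (z - y₀)| ≤ F y₀ / 2 := by
    intro z hz
    rw [mem_closedBall, dist_eq_norm] at hz
    refine (abs_dotR_le _ _).trans ?_
    calc 2 * (n : ℝ) * ‖ξ‖ * ‖z - y₀‖ ≤ 2 * n * (F y₀ / (4 * (n + 1) * ρ)) * ρ := by gcongr
      _ = F y₀ / 2 * (n / (n + 1)) := by field_simp; ring
      _ ≤ F y₀ / 2 * 1 := by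
          gcongr
          rw [div_le_one (by positivity)]
          linarith
      _ = _ := mul_one _
  have hwc : ∀ y ∈ closedBall y₀ ρ, ContDiffAt ℝ 2 w y := fun y hy =>
    (contDiffAt_capped (hF y hy)).sub
      ((dotCLM ξ).contDiff.contDiffAt.comp y (contDiffAt_id.sub contDiffAt_const))
  obtain ⟨y, hy, hmax⟩ := (isCompact_closedBall y₀ ρ).exists_isMaxOn
    (nonempty_closedBall.2 hρ.le) (fun y hy => (hwc y hy).continuousAt.continuousWithinAt)
  have hw0 : w y₀ = F y₀ := by simp [hw, capped, dotR]
  have hwy : F y₀ ≤ F y - κ * dotR (y - y₀) (y - y₀) - dotR ξ (y - y₀) := by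
    have := hmax (mem_closedBall_self hρ.le)
    rw [mem_ofPred_eq, hw0] at this
    simpa [hw, capped, dotCLM_apply] using this
  -- The maximum is interior: on the boundary the tilted function is at most half of its value at
  -- the centre.
  have hF0 : F y ≤ F y₀ → y ∈ ball y₀ ρ := by
    intro hle
    rw [mem_ball, dist_eq_norm]
    by_contra! hge
    have h1 : ρ ^ 2 ≤ dotR (y - y₀) (y - y₀) :=
      (pow_le_pow_left₀ hρ.le hge 2).trans (norm_sq_le_dotR _)
    have h2 : κ * ρ ^ 2 = F y₀ := by rw [hκ]; field_simp
    have h3 := mul_le_mul_of_nonneg_left h1 hκ0.le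
    have h4 := neg_le_of_abs_le (hslope y hy)
    linarith
  have hyb := hF0 (hle y hy)
  have hloc : IsLocalMax w y :=
    Filter.eventually_of_mem (closedBall_mem_nhds_of_mem hyb) fun z hz => hmax hz
  have hlin : ∀ z, HasFDerivAt (fun z => dotCLM ξ (z - y₀)) (dotCLM ξ) z := fun z =>
    (dotCLM ξ).hasFDerivAt.comp z ((hasFDerivAt_id z).sub_const y₀)
  have hfd : fderiv ℝ w =ᶠ[𝓝 y] fun z => fderiv ℝ (capped F y₀ κ) z - dotCLM ξ := by
    filter_upwards [(contDiffAt_capped (y₀ := y₀) (κ := κ) (hF y hy)).eventually (by simp)]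
      with z hz
    exact ((hz.differentiableAt (by norm_num)).hasFDerivAt.sub (hlin z)).fderiv
  refine ⟨y, ⟨hyb, ?_, fun u => ?_⟩, ?_⟩
  · have h1 : 0 ≤ κ * dotR (y - y₀) (y - y₀) :=
      mul_nonneg hκ0.le ((sq_nonneg _).trans (norm_sq_le_dotR _))
    have h4 := neg_le_of_abs_le (hslope y hy)
    linarith
  · have h1 := fderiv_fderiv_nonpos_of_isLocalMax (hwc y hy) hloc u
    rw [hfd.fderiv_eq, fderiv_sub_const] at h1
    exact h1
  · have h1 := hloc.fderiv_eq_zero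
    rw [hfd.self_of_nhds, sub_eq_zero] at h1
    change gradCLM n (fderiv ℝ (capped F y₀ κ) y) = ξ
    rw [h1, gradCLM_dotCLM]

/-- On the contact set minus the Hessian is positive semidefinite, so its trace bounds it. The
differential inequality gives `2β` of that trace and the paraboloid at most `2κ · 2C`. The outer `C`
passes from frame to coordinates, and the `2` counts the two real partial derivatives per
coordinate. -/
theorem norm_gradCLM_comp_le_of_mem_contactSet {κ m : ℝ} (hκ : 0 ≤ κ) (hC : 0 ≤ C) (hβ : 0 ≤ β)
    (hF : ∀ y ∈ closedBall y₀ ρ, ContDiffAt ℝ 2 F y) {y : Fin n → ℂ}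
    (hy : y ∈ contactSet F y₀ ρ κ m) {b : Fin n → Fin n → ℂ} (hb : FrameBound b C)
    (hsub : -β ≤ 1 / 2 * frameSum b (hess F y)) :
    ‖(gradCLM n).comp (fderiv ℝ (fderiv ℝ (capped F y₀ κ)) y)‖ ≤ 2 * (C * (2 * β + 4 * κ * C)) := by
  have hFy := hF y (ball_subset_closedBall hy.1)
  have hv := contDiffAt_capped (y₀ := y₀) (κ := κ) hFy
  set P : (Fin n → ℂ) →L[ℝ] (Fin n → ℂ) →L[ℝ] ℝ :=
    (-1 : ℝ) • fderiv ℝ (fderiv ℝ (capped F y₀ κ)) y with hPdef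
  have hP : ∀ u, 0 ≤ P u u := fun u => by
    have := hy.2.2 u
    rw [hPdef, smul_apply, smul_apply, smul_eq_mul]
    linarith
  have hs : ∀ u w, P u w = P w u := fun u w => by
    rw [hPdef, smul_apply, smul_apply, smul_apply, smul_apply]
    rw [(hv.isSymmSndFDerivAt (by simp)).eq]
  have hQ0 : 0 ≤ 2 * β + 4 * κ * C := by positivity
  have hfs : frameSum b (fun u => P u u) ≤ 2 * β + 4 * κ * C := by
    have e : (fun u => P u u) = fun u => (2 * κ) * dotR u u + (-1) * hess F y u := by
      funext u
      rw [hPdef, fderiv_fderiv_capped hFy, hess, hess_eq_fderiv_fderiv hFy]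
      simp only [sub_apply, smul_apply, dotCLM₂_apply, dotCLM_apply, smul_eq_mul]
      ring
    rw [e, frameSum_add, frameSum_mul_left, frameSum_mul_left]
    have := mul_le_mul_of_nonneg_left hb.frameSum_dotR_le (by positivity : 0 ≤ 2 * κ)
    linarith
  have h1 := norm_gradCLM_comp_le P (mul_nonneg hC hQ0)
    (abs_le_of_posSemidef P hP hs (apply_le_of_frameSum P hP b hb.expansion hfs))
  rwa [hPdef, ContinuousLinearMap.comp_smul, norm_smul, norm_neg, norm_one, one_mul] at h1

/-- The measure-theoretic maximum principle of Alexandrov, Bakelman and Pucci. -/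
theorem exists_volume_lower_bound (n : ℕ) {C β ρ : ℝ} (hC : 0 ≤ C) (hβ : 0 ≤ β) (hρ : 0 < ρ) :
    ∃ c : ENNReal, 0 < c ∧ ∀ (y₀ : Fin n → ℂ) (F : (Fin n → ℂ) → ℝ),
      (∀ y ∈ closedBall y₀ ρ, ContDiffAt ℝ 2 F y) → (∀ y ∈ closedBall y₀ ρ, F y ≤ F y₀) →
      1 ≤ F y₀ →
      (∀ y ∈ ball y₀ ρ, ∃ b, FrameBound b C ∧ -β ≤ 1 / 2 * frameSum b (hess F y)) →
      ∃ Γ, MeasurableSet Γ ∧ Γ ⊆ ball y₀ ρ ∧ (∀ y ∈ Γ, F y₀ / 2 ≤ F y) ∧ c ≤ volume Γ := by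
  -- The Hessian bound at height `1`, increased by `1` to be positive. At height `M ≥ 1` the bound
  -- is at most `M C₃`.
  set C₃ : ℝ := 2 * (C * (2 * β + 4 * (1 / ρ ^ 2) * C)) + 1 with hC₃
  have hC₃0 : 0 < C₃ := by positivity
  set q : ℝ := 1 / (4 * (n + 1) * ρ) / C₃ with hq
  have hq0 : 0 < q := by positivity
  have hV : 0 < volume (closedBall (0 : Fin n → ℂ) 1) := measure_closedBall_pos _ _ zero_lt_one
  refine ⟨ENNReal.ofReal (q ^ (2 * n)) * volume (closedBall (0 : Fin n → ℂ) 1),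
    ENNReal.mul_pos (by positivity) hV.ne', ?_⟩
  intro y₀ F hF hmax hM hsub
  set M := F y₀ with hMdef
  have hM0 : 0 < M := zero_lt_one.trans_le hM
  refine ⟨contactSet F y₀ ρ (M / ρ ^ 2) (M / 2), measurableSet_contactSet hF, fun y hy => hy.1,
    fun y hy => hy.2.1, ?_⟩
  have himage := closedBall_subset_image_contactSet hρ hF hM0 hmax
  rw [← hMdef] at himage
  set Γ := contactSet F y₀ ρ (M / ρ ^ 2) (M / 2)
  set v := capped F y₀ (M / ρ ^ 2)
  have hderiv : ∀ y ∈ Γ, HasFDerivWithinAt (fun y => gradCLM n (fderiv ℝ v y))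
      ((gradCLM n).comp (fderiv ℝ (fderiv ℝ v) y)) Γ y := by
    intro y hy
    have hv : ContDiffAt ℝ 2 v y := contDiffAt_capped (hF y (ball_subset_closedBall hy.1))
    have h2 : HasFDerivAt (fderiv ℝ v) (fderiv ℝ (fderiv ℝ v) y) y :=
      ((hv.fderiv_right (m := 1) (by norm_num)).differentiableAt (by norm_num)).hasFDerivAt
    exact ((gradCLM n).hasFDerivAt.comp y h2).hasFDerivWithinAt
  have hdet : ∀ y ∈ Γ, ENNReal.ofReal |((gradCLM n).comp (fderiv ℝ (fderiv ℝ v) y)).det|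
      ≤ ENNReal.ofReal ((M * C₃) ^ (2 * n)) := by
    intro y hy
    obtain ⟨b, hb, hsb⟩ := hsub y hy.1
    refine ENNReal.ofReal_le_ofReal ((abs_det_le_norm_pow _).trans ?_)
    refine pow_le_pow_left₀ (norm_nonneg _) ?_ _
    refine (norm_gradCLM_comp_le_of_mem_contactSet (by positivity) hC hβ hF hy hb hsb).trans ?_
    have h1 : 2 * (C * (2 * β + 4 * (M / ρ ^ 2) * C))
        ≤ M * (2 * (C * (2 * β + 4 * (1 / ρ ^ 2) * C))) := by
      have : 2 * (C * (2 * β)) ≤ M * (2 * (C * (2 * β))) :=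
        le_mul_of_one_le_left (by positivity) hM
      calc 2 * (C * (2 * β + 4 * (M / ρ ^ 2) * C))
          = 2 * (C * (2 * β)) + M * (2 * (C * (4 * (1 / ρ ^ 2) * C))) := by ring
        _ ≤ M * (2 * (C * (2 * β))) + M * (2 * (C * (4 * (1 / ρ ^ 2) * C))) := by gcongr
        _ = _ := by ring
    rw [hC₃, mul_add]
    linarith
  -- Area formula: the gradient map covers a ball of radius proportional to `M`, with Jacobian at
  -- most `(M C₃) ^ (2n)`. The powers of `M` cancel, so the volume bound does not depend on the
  -- height.
  have h1 := (measure_mono himage).trans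
    (addHaar_image_le_lintegral_abs_det_fderiv volume (measurableSet_contactSet hF) hderiv)
  have h2 := h1.trans (setLIntegral_mono_ae measurable_const.aemeasurable
    (Eventually.of_forall hdet))
  rw [setLIntegral_const, Measure.addHaar_closedBall' _ _ (by positivity), finrank_complex_pi] at h2
  have hpos : 0 < (M * C₃) ^ (2 * n) := by positivity
  rw [← ENNReal.mul_le_mul_iff_right (a := ENNReal.ofReal ((M * C₃) ^ (2 * n)))
    (by positivity) ENNReal.ofReal_ne_top, ← mul_assoc, ← ENNReal.ofReal_mul hpos.le]
  have e : (M * C₃) ^ (2 * n) * q ^ (2 * n) = (M / (4 * (n + 1) * ρ)) ^ (2 * n) := by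
    rw [← mul_pow, hq]
    congr 1
    field_simp
  rw [e]
  exact h2

end Contact

end NHYM

namespace NHYM

open Filter Topology Metric

/-! ### The volume measure and the mean value inequality on a compact manifold. -/

section Volume

variable {n : ℕ} {X : Type*} [TopologicalSpace X] [ChartedSpace (Fin n → ℂ) X]
  [IsManifold 𝓘(ℂ, Fin n → ℂ) ω X]
  {φ ψ : OpenPartialHomeomorph X (Fin n → ℂ)} {y : Fin n → ℂ} (ω₀ : KahlerForm n X)

theorem det_real_eq_normSq (L : (Fin n → ℂ) →L[ℂ] (Fin n → ℂ)) :
    (L.restrictScalars ℝ).det = Complex.normSq (LinearMap.det (L : (Fin n → ℂ) →ₗ[ℂ] (Fin n → ℂ))) := by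
  have h := LinearMap.det_restrictScalars (R := ℝ) (f := (L : (Fin n → ℂ) →ₗ[ℂ] (Fin n → ℂ)))
  rw [Algebra.norm_complex_apply] at h
  exact h

/-- The matrices of `ω` are related by `g = B g' B*` with `B` the transposed complex Jacobian, and
the real Jacobian determinant is `|det B|²`. So the chart densities agree on overlaps. -/
theorem KahlerForm.abs_det_mul_det_matrix (hφ : φ ∈ atlas (Fin n → ℂ) X)
    (hψ : ψ ∈ atlas (Fin n → ℂ) X) (hy : y ∈ φ.target) (hy' : φ.symm y ∈ ψ.source) :
    |(fderiv ℝ (ψ ∘ φ.symm) y).det| * (ω₀.matrix ψ (ψ (φ.symm y))).det.re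
      = (ω₀.matrix φ y).det.re := by
  have hd := (contDiffAt_transition hφ hψ hy hy').differentiableAt (by simp)
  set L := fderiv ℂ (ψ ∘ φ.symm) y with hL
  have hLr : fderiv ℝ (ψ ∘ φ.symm) y = L.restrictScalars ℝ := hd.fderiv_restrictScalars ℝ
  set B : Matrix (Fin n) (Fin n) ℂ := (LinearMap.toMatrix' (L : (Fin n → ℂ) →ₗ[ℂ] (Fin n → ℂ)))ᵀ
    with hB
  have hBrow : ∀ j, B j = L (Pi.single j 1) := fun j => by
    funext k
    rw [hB, Matrix.transpose_apply, LinearMap.toMatrix'_apply]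
    congr 2
  have hg : ω₀.matrix φ y = B * ω₀.matrix ψ (ψ (φ.symm y)) * Bᴴ := by
    ext j k
    rw [← KahlerForm.herm_eq_mul, KahlerForm.matrix_eq_herm, ω₀.herm_transition hφ hψ hy hy', hLr,
      hBrow, hBrow]
    rfl
  have hdet : B.det = LinearMap.det (L : (Fin n → ℂ) →ₗ[ℂ] (Fin n → ℂ)) := by
    rw [hB, Matrix.det_transpose, LinearMap.det_toMatrix']
  rw [hLr, det_real_eq_normSq, ← hdet, hg, Matrix.det_mul, Matrix.det_mul, Matrix.det_conjTranspose,
    abs_of_nonneg (Complex.normSq_nonneg _)]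
  have : B.det * (ω₀.matrix ψ (ψ (φ.symm y))).det * star B.det
      = (Complex.normSq B.det : ℂ) * (ω₀.matrix ψ (ψ (φ.symm y))).det := by
    rw [← Complex.mul_conj, starRingEnd_apply]
    ring
  rw [this, Complex.re_ofReal_mul]

omit [IsManifold 𝓘(ℂ, Fin n → ℂ) ω X] in
theorem KahlerForm.continuousOn_matrix (hφ : φ ∈ atlas (Fin n → ℂ) X) :
    ContinuousOn (ω₀.matrix φ) φ.target := by
  refine continuousOn_pi.2 fun j => continuousOn_pi.2 fun k => ?_
  have h : ∀ u v, ContinuousOn (fun y => ((chartForm ω₀.form φ y u v : ℝ) : ℂ)) φ.target :=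
    fun u v => Complex.continuous_ofReal.comp_continuousOn (ω₀.smooth φ hφ u v).continuousOn
  simp only [matrix, Matrix.of_apply, comp11]
  have h1 := h (Pi.single j 1) (Pi.single k 1)
  have h2 := h (Complex.I • Pi.single j 1) (Complex.I • Pi.single k 1)
  have h3 := h (Pi.single j 1) (Complex.I • Pi.single k 1)
  have h4 := h (Complex.I • Pi.single j 1) (Pi.single k 1)
  fun_prop

omit [IsManifold 𝓘(ℂ, Fin n → ℂ) ω X] in
theorem KahlerForm.continuousOn_det (hφ : φ ∈ atlas (Fin n → ℂ) X) :
    ContinuousOn (fun y => (ω₀.matrix φ y).det.re) φ.target :=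
  (Complex.continuous_re.comp continuous_id.matrix_det).comp_continuousOn
    (ω₀.continuousOn_matrix hφ)

theorem KahlerForm.det_pos (hφ : φ ∈ atlas (Fin n → ℂ) X) (hy : y ∈ φ.target) :
    0 < (ω₀.matrix φ y).det.re :=
  (Complex.pos_iff.1 (ω₀.matrix_posDef hφ hy).det_pos).1

theorem KahlerForm.exists_frameBound (hφ : φ ∈ atlas (Fin n → ℂ) X) {B : Set (Fin n → ℂ)}
    (hB : IsCompact B) (hBt : B ⊆ φ.target) :
    ∃ C : ℝ, 0 ≤ C ∧ ∀ y ∈ B, ∀ b, ω₀.Adapted φ y b → FrameBound b C := by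
  have hg := (ω₀.continuousOn_matrix hφ).mono hBt
  have hentry : ∀ j k, ContinuousOn (fun y => ω₀.matrix φ y j k) B := fun j k =>
    continuousOn_pi.1 (continuousOn_pi.1 hg j) k
  have h1 : ContinuousOn (fun y => ∑ j, ∑ k, ‖ω₀.matrix φ y j k‖) B :=
    continuousOn_finsetSum _ fun j _ => continuousOn_finsetSum _ fun k _ => (hentry j k).norm
  have hdet : ContinuousOn (fun y => (ω₀.matrix φ y).det) B :=
    continuous_id.matrix_det.comp_continuousOn hg
  have h2 : ContinuousOn (fun y => (ω₀.matrix φ y)⁻¹.trace.re) B := by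
    have e : (fun y => (ω₀.matrix φ y)⁻¹.trace.re)
        = fun y => ((ω₀.matrix φ y).det⁻¹ * (ω₀.matrix φ y).adjugate.trace).re := by
      funext y
      rw [Matrix.inv_def, Ring.inverse_eq_inv, Matrix.trace_smul, smul_eq_mul]
    rw [e]
    refine Complex.continuous_re.comp_continuousOn ((hdet.inv₀ fun y hy h0 => ?_).mul
      ((continuous_id.matrix_adjugate.matrix_trace).comp_continuousOn hg))
    have := ω₀.det_pos hφ (hBt hy)
    rw [h0] at this
    simp at this
  obtain ⟨C₁, hC₁⟩ := hB.bddAbove_image h1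
  obtain ⟨C₂, hC₂⟩ := hB.bddAbove_image h2
  refine ⟨max 0 (max C₁ C₂), le_max_left _ _, fun y hy b hb => ⟨fun u => ?_, ?_⟩⟩
  · obtain ⟨c, hc1, hc2⟩ := hb.exists_expansion u
    refine ⟨c, hc1, ?_⟩
    rw [hc2, KahlerForm.herm_eq_sum]
    refine (Complex.re_le_norm _).trans ?_
    have h3 : ‖∑ j, ∑ k, u j * (starRingEnd ℂ) (u k) * ω₀.matrix φ y j k‖
        ≤ (∑ j, ∑ k, ‖ω₀.matrix φ y j k‖) * ‖u‖ ^ 2 := by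
      rw [Finset.sum_mul]
      refine (norm_sum_le _ _).trans (Finset.sum_le_sum fun j _ => ?_)
      rw [Finset.sum_mul]
      refine (norm_sum_le _ _).trans (Finset.sum_le_sum fun k _ => ?_)
      rw [norm_mul, norm_mul, RCLike.norm_conj, mul_comm, sq]
      gcongr
      · exact norm_le_pi_norm u j
      · exact norm_le_pi_norm u k
    refine h3.trans ?_
    gcongr
    exact (hC₁ (mem_image_of_mem _ hy)).trans ((le_max_left _ _).trans (le_max_right _ _))
  · rw [hb.sum_normSq]
    exact (hC₂ (mem_image_of_mem _ hy)).trans ((le_max_right _ _).trans (le_max_right _ _))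

variable [MeasurableSpace X] [BorelSpace X]

omit [ChartedSpace (Fin n → ℂ) X] [IsManifold 𝓘(ℂ, Fin n → ℂ) ω X] in
theorem aemeasurable_symm (φ : OpenPartialHomeomorph X (Fin n → ℂ)) (f : (Fin n → ℂ) → ENNReal) :
    AEMeasurable φ.symm (((volume : Measure (Fin n → ℂ)).restrict φ.target).withDensity f) :=
  (φ.continuousOn_symm.aemeasurable φ.open_target.measurableSet).mono_ac
    (withDensity_absolutelyContinuous _ _)

omit [IsManifold 𝓘(ℂ, Fin n → ℂ) ω X] in
theorem KahlerForm.chartVolume_apply {S : Set X} (hS : MeasurableSet S) : ω₀.chartVolume φ S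
    = ∫⁻ y in φ.target ∩ φ.symm ⁻¹' S, ENNReal.ofReal (2 ^ n * (ω₀.matrix φ y).det.re) := by
  rw [chartVolume, Measure.map_apply_of_aemeasurable (aemeasurable_symm φ _) hS, withDensity_apply',
    Measure.restrict_restrict' φ.open_target.measurableSet, inter_comm]

/-- The volume is finite near every point of `X`, even at the boundary of the chart. -/
theorem KahlerForm.chartVolume_lt_top_near (hφ : φ ∈ atlas (Fin n → ℂ) X) (p : X) :
    ∃ U ∈ 𝓝 p, ω₀.chartVolume φ U < ⊤ := by
  set ψ := chartAt (Fin n → ℂ) p with hψdef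
  have hψ : ψ ∈ atlas (Fin n → ℂ) X := chart_mem_atlas _ p
  have hp : p ∈ ψ.source := mem_chart_source _ p
  obtain ⟨ε, hε, hball⟩ := nhds_basis_closedBall.mem_iff.1 (ψ.open_target.mem_nhds (ψ.map_source hp))
  have hUo : IsOpen (ψ.source ∩ ψ ⁻¹' ball (ψ p) ε) := ψ.isOpen_inter_preimage isOpen_ball
  refine ⟨ψ.source ∩ ψ ⁻¹' ball (ψ p) ε, hUo.mem_nhds ⟨hp, mem_ball_self hε⟩, ?_⟩
  set V := ball (ψ p) ε ∩ (ψ.target ∩ ψ.symm ⁻¹' φ.source) with hV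
  have hVo : IsOpen V := isOpen_ball.inter (ψ.isOpen_inter_preimage_symm φ.open_source)
  set τ := φ ∘ ψ.symm
  have himage : φ.target ∩ φ.symm ⁻¹' (ψ.source ∩ ψ ⁻¹' ball (ψ p) ε) = τ '' V := by
    ext y
    constructor
    · rintro ⟨h1, h2, h3⟩
      refine ⟨ψ (φ.symm y), ⟨h3, ψ.map_source h2, ?_⟩, ?_⟩
      · rw [mem_preimage, ψ.left_inv h2]
        exact φ.map_target h1
      · simp only [τ, Function.comp_apply]
        rw [ψ.left_inv h2, φ.right_inv h1]
    · rintro ⟨z, ⟨h1, h2, h3⟩, rfl⟩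
      refine ⟨φ.map_source h3, ?_⟩
      simp only [τ, Function.comp_apply, mem_preimage]
      rw [φ.left_inv h3]
      refine ⟨ψ.map_target h2, ?_⟩
      rw [mem_preimage, ψ.right_inv h2]
      exact h1
  have hinj : InjOn τ V := by
    intro z hz z' hz' h
    exact ψ.symm.injOn hz.2.1 hz'.2.1 (φ.injOn hz.2.2 hz'.2.2 h)
  have hder : ∀ z ∈ V, HasFDerivWithinAt τ (fderiv ℝ τ z) V z := fun z hz =>
    (((contDiffAt_transition hψ hφ hz.2.1 hz.2.2).differentiableAt
      (by simp)).restrictScalars ℝ).hasFDerivAt.hasFDerivWithinAt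
  rw [ω₀.chartVolume_apply hUo.measurableSet, himage,
    lintegral_image_eq_lintegral_abs_det_fderiv_mul volume hVo.measurableSet hder hinj]
  obtain ⟨C, hC⟩ := (isCompact_closedBall (ψ p) ε).bddAbove_image
    ((ω₀.continuousOn_det hψ).mono hball)
  -- After the change of variables the density is that of the chart at `p`, bounded on a compact
  -- ball, even where `φ` itself degenerates.
  have hle : ∀ z ∈ V, ENNReal.ofReal |(fderiv ℝ τ z).det|
      * ENNReal.ofReal (2 ^ n * (ω₀.matrix φ (τ z)).det.re) ≤ ENNReal.ofReal (2 ^ n * C) := by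
    intro z hz
    rw [← ENNReal.ofReal_mul (abs_nonneg _)]
    refine ENNReal.ofReal_le_ofReal ?_
    have h := ω₀.abs_det_mul_det_matrix hψ hφ hz.2.1 hz.2.2
    have h2 := hC (mem_image_of_mem _ (ball_subset_closedBall hz.1))
    calc _ = 2 ^ n * (|(fderiv ℝ (φ ∘ ψ.symm) z).det|
          * (ω₀.matrix φ (φ (ψ.symm z))).det.re) := by
          simp only [τ, Function.comp_apply]; ring
      _ ≤ _ := by rw [h]; gcongr
  refine (setLIntegral_mono_ae measurable_const.aemeasurable (Eventually.of_forall hle)).trans_lt ?_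
  rw [setLIntegral_const]
  exact ENNReal.mul_lt_top ENNReal.ofReal_lt_top
    ((measure_mono inter_subset_left).trans_lt measure_ball_lt_top)

variable [CompactSpace X]

theorem KahlerForm.isFiniteMeasure_chartVolume (hφ : φ ∈ atlas (Fin n → ℂ) X) :
    IsFiniteMeasure (ω₀.chartVolume φ) := by
  have : IsLocallyFiniteMeasure (ω₀.chartVolume φ) := ⟨ω₀.chartVolume_lt_top_near hφ⟩
  infer_instance

/-- The charts cover `X`, so the weights `1/N` are at most `1` and each summand is dominated by a
finite chart volume. -/
instance KahlerForm.isFiniteMeasure_volumeMeasure : IsFiniteMeasure ω₀.volumeMeasure := by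
  classical
  constructor
  simp only [volumeMeasure, Measure.finsetSum_apply]
  refine ENNReal.sum_lt_top.2 fun x hx => ?_
  have := ω₀.isFiniteMeasure_chartVolume (chart_mem_atlas (Fin n → ℂ) x)
  refine lt_of_le_of_lt ?_ (measure_lt_top (ω₀.chartVolume (chartAt (Fin n → ℂ) x)) univ)
  conv_rhs => rw [← withDensity_one (μ := ω₀.chartVolume (chartAt (Fin n → ℂ) x))]
  refine withDensity_mono (Eventually.of_forall fun p => ?_) univ
  rw [Pi.one_apply, ENNReal.inv_le_one, Nat.one_le_cast]
  obtain ⟨z, hz, hpz⟩ := (exists_chart_cover n X).choose_spec p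
  exact Finset.card_pos.2 ⟨z, Finset.mem_filter.2 ⟨hz, hpz⟩⟩

-- The weights `1/N` are at least the inverse of the total number of charts, so a single chart
-- already gives a lower bound.
omit [IsManifold 𝓘(ℂ, Fin n → ℂ) ω X] [BorelSpace X] in
theorem KahlerForm.chartVolume_le_volumeMeasure {z : X} (hz : z ∈ (exists_chart_cover n X).choose)
    {S : Set X} (hS : MeasurableSet S) :
    ((exists_chart_cover n X).choose.card : ENNReal)⁻¹ * ω₀.chartVolume (chartAt (Fin n → ℂ) z) S
      ≤ ω₀.volumeMeasure S := by
  classical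
  simp only [volumeMeasure, Measure.finsetSum_apply]
  refine le_trans ?_ (Finset.single_le_sum (fun _ _ => zero_le) hz)
  rw [withDensity_apply _ hS, ← setLIntegral_const]
  refine lintegral_mono fun p => ENNReal.inv_le_inv.2 (Nat.cast_le.2 ?_)
  convert Finset.card_filter_le _ _

/-- `f` is twice continuously differentiable on the manifold. -/
def IsC2 (n : ℕ) {X : Type*} [TopologicalSpace X] [ChartedSpace (Fin n → ℂ) X] (f : X → ℝ) : Prop :=
  ∀ φ ∈ atlas (Fin n → ℂ) X, ∀ y ∈ φ.target, ContDiffAt ℝ 2 (f ∘ φ.symm) y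

omit [IsManifold 𝓘(ℂ, Fin n → ℂ) ω X] [MeasurableSpace X] [BorelSpace X] [CompactSpace X] in
theorem IsC2.continuous {f : X → ℝ} (hf : IsC2 n f) : Continuous f := by
  rw [continuous_iff_continuousAt]
  intro p
  set φ := chartAt (Fin n → ℂ) p
  have hp : p ∈ φ.source := mem_chart_source _ p
  have h := (hf φ (chart_mem_atlas _ p) _ (φ.map_source hp)).continuousAt
  refine (ContinuousAt.comp (g := f ∘ φ.symm) h (φ.continuousAt hp)).congr ?_
  filter_upwards [φ.open_source.mem_nhds hp] with q hq
  simp only [Function.comp_apply]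
  rw [φ.left_inv hq]

theorem KahlerForm.exists_volume_lower_bound_near {β : ℝ} (hβ : 0 ≤ β) (p₀ : X) :
    ∃ U ∈ 𝓝 p₀, ∃ c : ENNReal, 0 < c ∧ ∀ f : X → ℝ, IsC2 n f → (∀ p, -β ≤ ω₀.laplacian f p) →
      ∀ p ∈ U, (∀ q, f q ≤ f p) → 1 ≤ f p → c ≤ ω₀.volumeMeasure {q | f p / 2 ≤ f q} := by
  obtain ⟨z, hz, hpz⟩ := (exists_chart_cover n X).choose_spec p₀
  set φ := chartAt (Fin n → ℂ) z with hφdef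
  have hφ : φ ∈ atlas (Fin n → ℂ) X := chart_mem_atlas _ z
  obtain ⟨ε, hε, hball⟩ :=
    nhds_basis_closedBall.mem_iff.1 (φ.open_target.mem_nhds (φ.map_source hpz))
  -- Half the radius, so that the ball about any `φ p` with `p` in the neighbourhood stays in the
  -- fixed compact ball and all constants are uniform in `p`.
  set ρ := ε / 2 with hρdef
  have hρ : 0 < ρ := half_pos hε
  have hB : IsCompact (closedBall (φ p₀) ε) := isCompact_closedBall _ _
  obtain ⟨C, hC, hframe⟩ := ω₀.exists_frameBound hφ hB hball
  obtain ⟨ym, hym, hmin⟩ := hB.exists_isMinOn (nonempty_closedBall.2 hε.le)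
    ((ω₀.continuousOn_det hφ).mono hball)
  set m := (ω₀.matrix φ ym).det.re with hm
  have hm0 : 0 < m := ω₀.det_pos hφ (hball hym)
  obtain ⟨c, hc, hABP⟩ := exists_volume_lower_bound n hC hβ hρ
  have hcard : ((exists_chart_cover n X).choose.card : ENNReal)⁻¹ ≠ 0 :=
    ENNReal.inv_ne_zero.2 (ENNReal.natCast_ne_top _)
  refine ⟨φ.source ∩ φ ⁻¹' ball (φ p₀) ρ,
    (φ.isOpen_inter_preimage isOpen_ball).mem_nhds ⟨hpz, mem_ball_self hρ⟩,
    ((exists_chart_cover n X).choose.card : ENNReal)⁻¹ * (ENNReal.ofReal (2 ^ n * m) * c),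
    ENNReal.mul_pos hcard (mul_ne_zero (by positivity) hc.ne'), ?_⟩
  rintro f hf hlap p ⟨hp, hpb⟩ hmaxf hfp
  have hsub : closedBall (φ p) ρ ⊆ closedBall (φ p₀) ε := by
    refine closedBall_subset_closedBall' ?_
    have : dist (φ p) (φ p₀) < ρ := hpb
    linarith
  have hFp : (f ∘ φ.symm) (φ p) = f p := by rw [Function.comp_apply, φ.left_inv hp]
  obtain ⟨Γ, hΓm, hΓb, hΓf, hΓc⟩ := hABP (φ p) (f ∘ φ.symm)
    (fun y hy => hf φ hφ y (hball (hsub hy)))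
    (fun y _ => by rw [hFp]; exact hmaxf _) (by rwa [hFp]) (fun y hy => by
      have hy' := hsub (ball_subset_closedBall hy)
      have hyt := hball hy'
      obtain ⟨b, hb⟩ := ω₀.exists_adapted hφ hyt
      refine ⟨b, hframe y hy' b hb, ?_⟩
      have h1 := hlap (φ.symm y)
      have h2 := φ.right_inv hyt
      rw [ω₀.laplacian_eq hφ (φ.map_target hyt) (b := b) (by rw [h2]; exact hf φ hφ y hyt)
        (by rwa [h2]), h2] at h1
      exact h1)
  have hS : MeasurableSet {q | f p / 2 ≤ f q} :=
    (isClosed_le continuous_const hf.continuous).measurableSet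
  refine le_trans ?_ (ω₀.chartVolume_le_volumeMeasure hz hS)
  gcongr
  rw [ω₀.chartVolume_apply hS]
  calc ENNReal.ofReal (2 ^ n * m) * c ≤ ENNReal.ofReal (2 ^ n * m) * volume Γ := by gcongr
    _ = ∫⁻ _ in Γ, ENNReal.ofReal (2 ^ n * m) := (setLIntegral_const _ _).symm
    _ ≤ ∫⁻ y in Γ, ENNReal.ofReal (2 ^ n * (ω₀.matrix φ y).det.re) := by
        refine setLIntegral_mono' hΓm fun y hy => ENNReal.ofReal_le_ofReal ?_
        have := hmin (hsub (ball_subset_closedBall (hΓb hy)))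
        rw [mem_ofPred_eq] at this
        gcongr
    _ ≤ _ := by
        refine lintegral_mono_set fun y hy => ⟨hball (hsub (ball_subset_closedBall (hΓb hy))), ?_⟩
        have := hΓf y hy
        rwa [hFp] at this

/-- Finitely many neighbourhoods with their local constants suffice by compactness; take the
smallest constant. -/
theorem KahlerForm.exists_volume_lower_bound {β : ℝ} (hβ : 0 ≤ β) :
    ∃ c : ENNReal, 0 < c ∧ ∀ f : X → ℝ, IsC2 n f → (∀ p, -β ≤ ω₀.laplacian f p) →
      ∀ p, (∀ q, f q ≤ f p) → 1 ≤ f p → c ≤ ω₀.volumeMeasure {q | f p / 2 ≤ f q} := by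
  have h := (isCompact_univ (X := X)).induction_on
    (p := fun U => ∃ c : ENNReal, 0 < c ∧ ∀ f : X → ℝ, IsC2 n f →
      (∀ p, -β ≤ ω₀.laplacian f p) → ∀ p ∈ U, (∀ q, f q ≤ f p) → 1 ≤ f p →
        c ≤ ω₀.volumeMeasure {q | f p / 2 ≤ f q})
    ⟨1, one_pos, by simp⟩
    (fun U V hUV ⟨c, hc, h⟩ => ⟨c, hc, fun f hf hl p hp => h f hf hl p (hUV hp)⟩)
    (fun U V ⟨c, hc, h⟩ ⟨c', hc', h'⟩ => ⟨min c c', lt_min hc hc', fun f hf hl p hp hm h1 => by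
      rcases hp with hp | hp
      · exact (min_le_left _ _).trans (h f hf hl p hp hm h1)
      · exact (min_le_right _ _).trans (h' f hf hl p hp hm h1)⟩)
    (fun p₀ _ => by
      obtain ⟨U, hU, c, hc, h⟩ := ω₀.exists_volume_lower_bound_near hβ p₀
      exact ⟨U, mem_nhdsWithin_of_mem_nhds hU, c, hc, h⟩)
  obtain ⟨c, hc, h⟩ := h
  exact ⟨c, hc, fun f hf hl p => h f hf hl p (mem_univ p)⟩

/-- The mean value inequality: a nonnegative function with `Δ f ≥ -β` is bounded by its integral. -/
theorem KahlerForm.le_integral {β : ℝ} (hβ : 0 ≤ β) :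
    ∃ C : ℝ, 0 < C ∧ ∀ f : X → ℝ, IsC2 n f → (∀ p, 0 ≤ f p) → (∀ p, -β ≤ ω₀.laplacian f p) →
      ∀ p, f p ≤ C * ∫ q, f q ∂ω₀.volumeMeasure + 1 := by
  obtain ⟨c, hc, h⟩ := ω₀.exists_volume_lower_bound hβ
  -- The constant is capped to be finite, so that it can be read as a real number.
  set c' := min c 1 with hc'
  have hc'0 : 0 < c' := lt_min hc one_pos
  have hc't : c' ≠ ⊤ := ((min_le_right _ _).trans_lt ENNReal.one_lt_top).ne
  have hr : 0 < c'.toReal := ENNReal.toReal_pos hc'0.ne' hc't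
  refine ⟨2 / c'.toReal, by positivity, fun f hf h0 hl p => ?_⟩
  obtain ⟨q, -, hq⟩ := isCompact_univ.exists_isMaxOn ⟨p, mem_univ p⟩ hf.continuous.continuousOn
  have hq' : ∀ z, f z ≤ f q := fun z => hq (mem_univ z)
  have hI : 0 ≤ ∫ q, f q ∂ω₀.volumeMeasure := integral_nonneg h0
  refine (hq' p).trans ?_
  -- If the maximum is at least `1`, Markov's inequality at level `f q / 2` applies to the volume
  -- bound; otherwise the summand `1` of the claim suffices.
  rcases le_or_gt 1 (f q) with h1 | h1
  · have h2 := (min_le_left c 1).trans (h f hf hl q hq' h1)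
    have hint : Integrable f ω₀.volumeMeasure :=
      hf.continuous.integrable_of_hasCompactSupport (HasCompactSupport.of_compactSpace f)
    have h3 := mul_meas_ge_le_integral_of_nonneg (Eventually.of_forall h0) hint (f q / 2)
    have h4 : c'.toReal ≤ ω₀.volumeMeasure.real {z | f q / 2 ≤ f z} :=
      ENNReal.toReal_mono (measure_ne_top _ _) h2
    have h5 : f q / 2 * c'.toReal ≤ ∫ q, f q ∂ω₀.volumeMeasure :=
      (mul_le_mul_of_nonneg_left h4 (by linarith)).trans h3
    have h6 : f q ≤ 2 / c'.toReal * ∫ q, f q ∂ω₀.volumeMeasure := by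
      rw [div_mul_eq_mul_div, le_div_iff₀ hr]
      linarith
    linarith
  · have : 0 ≤ 2 / c'.toReal * ∫ q, f q ∂ω₀.volumeMeasure := by positivity
    linarith

end Volume

end NHYM

namespace NHYM

open Filter Topology

/-! ### Smoothness of the connection form. -/

section Bundle

variable {n : ℕ} {X : Type*} [TopologicalSpace X] [ChartedSpace (Fin n → ℂ) X]
  [IsManifold 𝓘(ℂ, Fin n → ℂ) ω X]
  {r : ℕ} {E : X → Type*} [∀ x, AddCommGroup (E x)] [∀ x, Module ℂ (E x)]
  [TopologicalSpace (TotalSpace (Fin r → ℂ) E)] [∀ x, TopologicalSpace (E x)]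
  [∀ x, IsTopologicalAddGroup (E x)] [∀ x, ContinuousSMul ℝ (E x)]
  [FiberBundle (Fin r → ℂ) E] [VectorBundle ℝ (Fin r → ℂ) E]
  [ContMDiffVectorBundle ∞ (Fin r → ℂ) E 𝓘(ℝ, Fin n → ℂ)]
  {φ : OpenPartialHomeomorph X (Fin n → ℂ)} {y : Fin n → ℂ}
  {e : Trivialization (Fin r → ℂ) (π (Fin r → ℂ) E)} [MemTrivializationAtlas e]

omit [IsManifold 𝓘(ℂ, Fin n → ℂ) ω X] [∀ x, IsTopologicalAddGroup (E x)]
  [∀ x, ContinuousSMul ℝ (E x)] in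
theorem contMDiffOn_frame (i : Fin r) :
    ContMDiffOn 𝓘(ℝ, Fin n → ℂ) (𝓘(ℝ, Fin n → ℂ).prod 𝓘(ℝ, Fin r → ℂ)) ∞
      (fun p => TotalSpace.mk' (Fin r → ℂ) p (frame e i p)) e.baseSet := by
  rw [e.contMDiffOn_section_baseSet_iff]
  refine (contMDiffOn_const (c := (Pi.single i 1 : Fin r → ℂ))).congr fun p hp => ?_
  rw [frame, e.apply_mk_symm hp]

theorem contMDiffAt_chart_symm (hφ : φ ∈ atlas (Fin n → ℂ) X) (hy : y ∈ φ.target) :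
    ContMDiffAt 𝓘(ℝ, Fin n → ℂ) 𝓘(ℝ, Fin n → ℂ) ∞ φ.symm y :=
  contMDiffAt_symm_of_mem_maximalAtlas (IsManifold.subset_maximalAtlas hφ) hy

/-- A coordinate vector field of a chart is smooth. -/
theorem contMDiffAt_chartVec (hφ : φ ∈ atlas (Fin n → ℂ) X) (hy : y ∈ φ.target) (v : Fin n → ℂ) :
    ContMDiffAt 𝓘(ℝ, Fin n → ℂ) (𝓘(ℝ, Fin n → ℂ).prod 𝓘(ℝ, Fin n → ℂ)) ∞
      (fun z => TotalSpace.mk' (Fin n → ℂ) (E := TangentSpace 𝓘(ℝ, Fin n → ℂ)) (φ.symm z)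
        (chartVec φ z v)) y := by
  have : IsManifold 𝓘(ℝ, Fin n → ℂ) 1 X := IsManifold.of_le (n := ∞) (by norm_num)
  have h1 : ContMDiffOn 𝓘(ℝ, Fin n → ℂ) 𝓘(ℝ, Fin n → ℂ) ∞ φ.symm φ.target :=
    contMDiffOn_symm_of_mem_maximalAtlas (IsManifold.subset_maximalAtlas hφ)
  have h2 := h1.contMDiffOn_tangentMapWithin (m := ∞) (by norm_num) φ.open_target.uniqueMDiffOn
  have h3 : ContMDiff 𝓘(ℝ, Fin n → ℂ) (𝓘(ℝ, Fin n → ℂ).prod 𝓘(ℝ, Fin n → ℂ)) ∞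
      (fun z : Fin n → ℂ => TotalSpace.mk' (Fin n → ℂ)
        (E := TangentSpace 𝓘(ℝ, Fin n → ℂ)) z (v : TangentSpace 𝓘(ℝ, Fin n → ℂ) z)) := by
    exact contMDiff_vectorSpace_iff_contDiff.2 contDiff_const
  have h4 := (h2.comp (s := φ.target) h3.contMDiffOn (fun z hz => hz)).contMDiffAt
    (φ.open_target.mem_nhds hy)
  refine h4.congr_of_eventuallyEq ?_
  filter_upwards [φ.open_target.mem_nhds hy] with z hz
  simp only [Function.comp_apply, tangentMapWithin, chartVec]
  rw [mfderivWithin_of_isOpen φ.open_target hz]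

omit [∀ x, IsTopologicalAddGroup (E x)] [∀ x, ContinuousSMul ℝ (E x)] in
/-- Near a point of the domain of `e`, the section `σ_i` is given by a global smooth section. -/
theorem exists_global_section [T2Space X] {p : X} (hp : p ∈ e.baseSet) (i : Fin r) :
    ∃ σ : ∀ x, E x, ContMDiff 𝓘(ℝ, Fin n → ℂ) (𝓘(ℝ, Fin n → ℂ).prod 𝓘(ℝ, Fin r → ℂ)) ∞
      (fun x => TotalSpace.mk' (Fin r → ℂ) x (σ x)) ∧ ∀ᶠ x in 𝓝 p, σ x = frame e i x := by
  -- A bump function supported in the domain of `e` extends the frame section by zero.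
  obtain ⟨f, -, hf⟩ := (SmoothBumpFunction.nhds_basis_tsupport (I := 𝓘(ℝ, Fin n → ℂ)) p).mem_iff.1
    (e.open_baseSet.mem_nhds hp)
  refine ⟨fun x => f x • frame e i x, ?_, ?_⟩
  · exact ContMDiffOn.smul_section_of_tsupport f.contMDiff.contMDiffOn e.open_baseSet hf
      (contMDiffOn_frame i)
  · filter_upwards [f.eventuallyEq_one] with x hx
    rw [hx, Pi.one_apply, one_smul]

/-- Smoothness of a covariant derivative is known on global smooth sections. A frame section agrees
with one near the point, and covariant derivatives are local. -/
theorem Connection.contDiffAt_form [T2Space X] (D : Connection n r E)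
    (hφ : φ ∈ atlas (Fin n → ℂ) X) (hy : y ∈ φ.target) (he : φ.symm y ∈ e.baseSet)
    (v : Fin n → ℂ) (k i : Fin r) : ContDiffAt ℝ ∞ (fun z => D.form φ e z v k i) y := by
  have : IsManifold 𝓘(ℝ, Fin n → ℂ) 1 X := IsManifold.of_le (n := ∞) (by norm_num)
  obtain ⟨σ, hσ, hσe⟩ := exists_global_section (n := n) he i
  have h1 := D.smooth.contMDiff.contMDiff (σ := σ) (by simpa using hσ.contMDiffOn)
  rw [contMDiffOn_univ] at h1
  have h2 := (h1 (φ.symm y)).comp y (contMDiffAt_chart_symm hφ hy)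
  have h3 := ContMDiffAt.clm_bundle_apply (b := φ.symm) h2 (contMDiffAt_chartVec hφ hy v)
  have h4 := ((e.contMDiffAt_iff (by rwa [e.mem_source])).1 h3).2
  rw [contMDiffAt_iff_contDiffAt] at h4
  have h5 := contDiffAt_pi.1 h4 k
  refine h5.congr_of_eventuallyEq ?_
  have hc := (φ.continuousAt_symm hy).eventually
    (hσe.eventually_nhds.and (e.open_baseSet.mem_nhds he))
  filter_upwards [hc] with z hz
  simp only [form, Matrix.of_apply]
  have hs : D.cov (frame e i) (φ.symm z) = D.cov σ (φ.symm z) := by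
    refine D.cov.isCovariantDerivativeOnUniv.congr_of_eventuallyEq ?_ ?_ univ_mem
      (hz.1.mono fun x hx => hx.symm)
    · exact ((contMDiffOn_frame i).contMDiffAt (e.open_baseSet.mem_nhds hz.2)).mdifferentiableAt
        (by simp)
    · exact (hσ _).mdifferentiableAt (by simp)
  rw [hs]

end Bundle

end NHYM

namespace NHYM

open Filter Topology

/-! ### Real bilinearity of curvature forms, needed to contract them in adapted frames. -/

section FormLinear

variable {n r : ℕ} {M : (Fin n → ℂ) → Matrix (Fin r) (Fin r) ℂ} {y : Fin n → ℂ}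
  {A θ ψ : (Fin n → ℂ) → (Fin n → ℂ) → Matrix (Fin r) (Fin r) ℂ}

/-- Real linearity of a matrix-valued 1-form at a point. -/
structure RealLinear (a : (Fin n → ℂ) → Matrix (Fin r) (Fin r) ℂ) : Prop where
  add : ∀ u v, a (u + v) = a u + a v
  smul : ∀ (c : ℝ) u, a ((c : ℂ) • u) = (c : ℂ) • a u

theorem dirDeriv_realLinear (M : (Fin n → ℂ) → Matrix (Fin r) (Fin r) ℂ) (y : Fin n → ℂ) :
    RealLinear (dirDeriv M y) := by
  constructor
  · intro u v
    ext i j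
    simp [dirDeriv]
  · intro c u
    ext i j
    simp [dirDeriv, Complex.coe_smul]

theorem RealLinear.neg {a : (Fin n → ℂ) → Matrix (Fin r) (Fin r) ℂ} (h : RealLinear a)
    (u : Fin n → ℂ) : a (-u) = -a u := by
  simpa using h.smul (-1) u

theorem RealLinear.comp_I {a : (Fin n → ℂ) → Matrix (Fin r) (Fin r) ℂ} (h : RealLinear a) :
    RealLinear fun u => a (Complex.I • u) :=
  ⟨fun u v => by rw [smul_add, h.add], fun c u => by rw [smul_comm, h.smul]⟩

theorem RealLinear.const_smul {a : (Fin n → ℂ) → Matrix (Fin r) (Fin r) ℂ} (h : RealLinear a)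
    (c : ℂ) : RealLinear fun u => c • a u :=
  ⟨fun u v => by rw [h.add, smul_add], fun t u => by rw [h.smul, smul_comm]⟩

theorem RealLinear.add' {a b : (Fin n → ℂ) → Matrix (Fin r) (Fin r) ℂ} (h : RealLinear a)
    (h' : RealLinear b) : RealLinear fun u => a u + b u :=
  ⟨fun u v => by rw [h.add, h'.add]; abel, fun t u => by rw [h.smul, h'.smul, smul_add]⟩

theorem RealLinear.sub {a b : (Fin n → ℂ) → Matrix (Fin r) (Fin r) ℂ} (h : RealLinear a)
    (h' : RealLinear b) : RealLinear fun u => a u - b u :=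
  ⟨fun u v => by rw [h.add, h'.add]; abel, fun t u => by rw [h.smul, h'.smul, smul_sub]⟩

theorem RealLinear.part10 {a : (Fin n → ℂ) → Matrix (Fin r) (Fin r) ℂ} (h : RealLinear a) :
    RealLinear (part10 a) :=
  (h.sub (h.comp_I.const_smul _)).const_smul _

theorem RealLinear.part01 {a : (Fin n → ℂ) → Matrix (Fin r) (Fin r) ℂ} (h : RealLinear a) :
    RealLinear (part01 a) :=
  (h.add' (h.comp_I.const_smul _)).const_smul _

theorem RealLinear.localPsi (h : RealLinear (A y)) : RealLinear (localPsi A M y) := by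
  have hd := dirDeriv_realLinear M y
  constructor
  · intro u v
    simp only [NHYM.localPsi, selfAdjPart, adj, h.add, hd.add, Matrix.conjTranspose_add, mul_add,
      add_mul]
    module
  · intro c u
    simp only [NHYM.localPsi, selfAdjPart, adj, h.smul, hd.smul, Matrix.conjTranspose_smul,
      Matrix.mul_smul, Matrix.smul_mul, Complex.star_def, Complex.conj_ofReal]
    module

theorem RealLinear.localTheta (h : RealLinear (A y)) (hψ : RealLinear (ψ y)) :
    RealLinear (localTheta A ψ y) :=
  (h.sub hψ).part01.add' hψ.part10

theorem EntryDiff.localTheta (hA : ∀ v, EntryDiff (fun z => A z v) y)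
    (hψ : ∀ v, EntryDiff (fun z => ψ z v) y) (v : Fin n → ℂ) :
    EntryDiff (fun z => localTheta A ψ z v) y :=
  ((((hA v).sub (hψ v)).add (((hA _).sub (hψ _)).smul _)).smul _).add
    (((hψ v).sub ((hψ _).smul _)).smul _)

theorem dbarDeriv_realLinear (M : (Fin n → ℂ) → Matrix (Fin r) (Fin r) ℂ) (y : Fin n → ℂ) :
    RealLinear (dbarDeriv M y) :=
  (dirDeriv_realLinear M y).part01

theorem isRealBilin_of_antisymm {α β : (Fin n → ℂ) → (Fin n → ℂ) → Matrix (Fin r) (Fin r) ℂ}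
    (hα : ∀ u v, α u v = β u v - β v u) (h1 : ∀ v, RealLinear fun u => β u v)
    (h2 : ∀ u, RealLinear (β u)) : IsRealBilin α := by
  constructor
  · intro u u' v
    rw [hα, hα, hα, (h1 v).add, (h2 v).add]
    abel
  · intro c u v
    rw [hα, hα, (h1 v).smul, (h2 v).smul, smul_sub]
  · intro u v v'
    rw [hα, hα, hα, (h2 u).add, (h1 u).add]
    abel
  · intro c u v
    rw [hα, hα, (h2 u).smul, (h1 u).smul, smul_sub]

theorem dirDeriv_form_realLinear (hd : ∀ v, EntryDiff (fun z => θ z v) y)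
    (hl : ∀ᶠ z in 𝓝 y, RealLinear (θ z)) (u : Fin n → ℂ) :
    RealLinear fun v => dirDeriv (fun z => θ z v) y u := by
  constructor
  · intro v v'
    rw [← dirDeriv_add (hd v) (hd v')]
    exact dirDeriv_congr (hl.mono fun z hz => hz.add v v')
  · intro c v
    rw [← dirDeriv_smul (c : ℂ) (hd v)]
    exact dirDeriv_congr (hl.mono fun z hz => hz.smul c v)

theorem mul_form_realLinear_right (hl : RealLinear (θ y)) (u : Fin n → ℂ) :
    RealLinear fun v => θ y u * θ y v :=
  ⟨fun v v' => by rw [hl.add, mul_add], fun c v => by rw [hl.smul, Matrix.mul_smul]⟩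

theorem mul_form_realLinear_left (hl : RealLinear (θ y)) (v : Fin n → ℂ) :
    RealLinear fun u => θ y u * θ y v :=
  ⟨fun u u' => by rw [hl.add, add_mul], fun c u => by rw [hl.smul, Matrix.smul_mul]⟩

theorem isRealBilin_curv (hd : ∀ v, EntryDiff (fun z => θ z v) y)
    (hl : ∀ᶠ z in 𝓝 y, RealLinear (θ z)) : IsRealBilin (curv θ y) :=
  isRealBilin_of_antisymm (β := fun u v => dirDeriv (fun z => θ z v) y u + θ y u * θ y v)
    (fun u v => by simp only [curv]; abel)
    (fun v => (dirDeriv_realLinear _ y).add' (mul_form_realLinear_left hl.self_of_nhds v))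
    (fun u => (dirDeriv_form_realLinear hd hl u).add'
      (mul_form_realLinear_right hl.self_of_nhds u))

theorem isRealBilin_dbarCurv (hd : ∀ v, EntryDiff (fun z => θ z v) y)
    (hl : ∀ᶠ z in 𝓝 y, RealLinear (θ z)) : IsRealBilin (dbarCurv θ y) :=
  isRealBilin_of_antisymm (β := fun u v => dbarDeriv (fun z => θ z v) y u + θ y u * θ y v)
    (fun u v => by simp only [dbarCurv]; abel)
    (fun v => (dbarDeriv_realLinear _ y).add' (mul_form_realLinear_left hl.self_of_nhds v))
    (fun u => (((dirDeriv_form_realLinear hd hl u).add'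
      ((dirDeriv_form_realLinear hd hl (Complex.I • u)).const_smul _)).const_smul _).add'
        (mul_form_realLinear_right hl.self_of_nhds u))

end FormLinear

/-! ### Gram matrices and change of frame. -/

section Gram

variable {n : ℕ} {X : Type*} [TopologicalSpace X] [ChartedSpace (Fin n → ℂ) X]
  {r : ℕ} {E : X → Type*} [∀ x, AddCommGroup (E x)] [∀ x, Module ℂ (E x)]
  [TopologicalSpace (TotalSpace (Fin r → ℂ) E)] [∀ x, TopologicalSpace (E x)]
  [FiberBundle (Fin r → ℂ) E]
  {φ : OpenPartialHomeomorph X (Fin n → ℂ)} {y : Fin n → ℂ}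
  {e e' : Trivialization (Fin r → ℂ) (π (Fin r → ℂ) E)}

theorem HermitianMetric.entryC2_gram [IsManifold 𝓘(ℂ, Fin n → ℂ) ω X] (H : HermitianMetric n r E)
    [MemTrivializationAtlas e] (hφ : φ ∈ atlas (Fin n → ℂ) X)
    (hy : y ∈ φ.target) (he : φ.symm y ∈ e.baseSet) : EntryC2 (fun z => H.gram e (φ.symm z)) y := by
  intro i j
  have h1 := (H.smooth e i j).contMDiffAt (e.open_baseSet.mem_nhds he)
  have h2 := h1.comp y (contMDiffAt_chart_symm hφ hy)
  rw [contMDiffAt_iff_contDiffAt] at h2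
  exact h2.of_le (by norm_cast)

variable [VectorBundle ℂ (Fin r → ℂ) E] [MemTrivializationAtlas e] [MemTrivializationAtlas e']

theorem symm_eq_sum {x : X} (hx : x ∈ e.baseSet) (c : Fin r → ℂ) :
    e.symm x c = ∑ i, c i • frame e i x := by
  have h : ∀ w, e.symm x w = e.symmₗ ℂ x w := fun w => (e.symmₗ_apply (R := ℂ) hx w).symm
  rw [h]
  conv_lhs => rw [pi_eq_sum_univ' c, map_sum]
  refine Finset.sum_congr rfl fun i _ => ?_
  rw [map_smul, frame, h]

omit [VectorBundle ℂ (Fin r → ℂ) E] in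
theorem HermitianMetric.inner_sum (H : HermitianMetric n r E) (x : X) (s t : Fin r → E x)
    (c d : Fin r → ℂ) : H.inner x (∑ i, c i • s i) (∑ j, d j • t j)
      = ∑ i, ∑ j, star (c i) * H.inner x (s i) (t j) * d j := by
  simp only [map_sum, LinearMap.map_smulₛₗ, LinearMap.sum_apply, LinearMap.smul_apply, map_smul,
    smul_eq_mul, Finset.mul_sum]
  rw [Finset.sum_comm]
  refine Finset.sum_congr rfl fun i _ => Finset.sum_congr rfl fun j _ => ?_
  rw [starRingEnd_apply]
  ring

theorem HermitianMetric.gram_posDef (H : HermitianMetric n r E) {x : X} (hx : x ∈ e.baseSet) :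
    (H.gram e x).PosDef := by
  refine Matrix.PosDef.of_dotProduct_mulVec_pos ?_ ?_
  · ext i j
    rw [Matrix.conjTranspose_apply, gram, Matrix.of_apply, Matrix.of_apply, ← starRingEnd_apply,
      ← H.symm]
  · intro c hc
    have h1 : e.symm x c ≠ 0 := by
      intro h0
      have h2 := e.apply_mk_symm hx c
      have h3 := e.apply_mk_symm hx 0
      have h4 : e.symm x 0 = 0 := by rw [← e.symmₗ_apply (R := ℂ) hx, map_zero]
      rw [h0] at h2
      rw [h4, h2] at h3
      exact hc (congrArg Prod.snd h3)
    have h2 : star c ⬝ᵥ (H.gram e x *ᵥ c) = H.inner x (e.symm x c) (e.symm x c) := by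
      rw [symm_eq_sum hx, inner_sum]
      simp only [dotProduct, Matrix.mulVec, Finset.mul_sum, gram, Matrix.of_apply, Pi.star_apply]
      exact Finset.sum_congr rfl fun i _ => Finset.sum_congr rfl fun j _ => by ring
    rw [h2, Complex.pos_iff]
    refine ⟨H.positive x _ h1, ?_⟩
    have h3 := congrArg Complex.im (H.symm x (e.symm x c) (e.symm x c))
    rw [Complex.conj_im] at h3
    linarith

/-- The transition matrix between two frames. -/
noncomputable def transitionMatrix (e e' : Trivialization (Fin r → ℂ) (π (Fin r → ℂ) E)) (x : X) :
    Matrix (Fin r) (Fin r) ℂ :=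
  Matrix.of fun i j => (e ⟨x, frame e' j x⟩).2 i

omit [MemTrivializationAtlas e'] in
theorem HermitianMetric.gram_eq (H : HermitianMetric n r E) {x : X} (hx : x ∈ e.baseSet) :
    H.gram e' x = (transitionMatrix e e' x)ᴴ * H.gram e x * transitionMatrix e e' x := by
  have h : ∀ j, frame e' j x = ∑ i, transitionMatrix e e' x i j • frame e i x := by
    intro j
    rw [← symm_eq_sum hx fun i => transitionMatrix e e' x i j]
    exact (e.symm_apply_apply_mk hx (frame e' j x)).symm
  ext j k
  rw [gram, Matrix.of_apply, h j, h k, inner_sum, mul_assoc]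
  simp only [Matrix.mul_apply, Matrix.conjTranspose_apply, Finset.mul_sum, gram, Matrix.of_apply]
  exact Finset.sum_congr rfl fun i _ => Finset.sum_congr rfl fun l _ => by ring

theorem relEnd_gram (K H : HermitianMetric n r E) {x : X} (hx : x ∈ e.baseSet)
    (hx' : x ∈ e'.baseSet) : IsUnit (transitionMatrix e e' x) ∧
      relEnd (K.gram e' x) (H.gram e' x) = (transitionMatrix e e' x)⁻¹
        * relEnd (K.gram e x) (H.gram e x) * transitionMatrix e e' x := by
  have hK := K.gram_eq (e' := e') hx
  have hH := H.gram_eq (e' := e') hx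
  have hu := isUnit_det_of_posDef (K.gram_posDef hx')
  set T := transitionMatrix e e' x
  have hT : IsUnit T.det := by
    rw [hK, Matrix.det_mul] at hu
    exact isUnit_of_mul_isUnit_right hu
  have hTH : IsUnit (Tᴴ).det := by
    rw [Matrix.det_conjTranspose]
    exact hT.star
  refine ⟨(Matrix.isUnit_iff_isUnit_det _).2 hT, ?_⟩
  rw [relEnd, relEnd, hK, hH, Matrix.mul_inv_rev, Matrix.mul_inv_rev]
  simp only [mul_assoc]
  rw [Matrix.nonsing_inv_mul_cancel_left _ _ hTH]

/-- The preferred frame used by `gramAt` varies with the point. Since `h` only changes by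
conjugation, its traces near a point can be computed in one fixed frame and differentiated there. -/
theorem trace_aeval_relEnd_gram (K H : HermitianMetric n r E) {x : X} (hx : x ∈ e.baseSet)
    (hx' : x ∈ e'.baseSet) (f : Polynomial ℝ) :
    (Polynomial.aeval (relEnd (K.gram e' x) (H.gram e' x)) f).trace
      = (Polynomial.aeval (relEnd (K.gram e x) (H.gram e x)) f).trace := by
  obtain ⟨hT, h⟩ := relEnd_gram K H hx hx'
  set T := transitionMatrix e e' x
  have hT' := (Matrix.isUnit_iff_isUnit_det T).1 hT
  have h1 : T * relEnd (K.gram e' x) (H.gram e' x) = relEnd (K.gram e x) (H.gram e x) * T := by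
    rw [h, mul_assoc, Matrix.mul_nonsing_inv_cancel_left _ _ hT']
  have h2 : Polynomial.aeval (relEnd (K.gram e' x) (H.gram e' x)) f
      = T⁻¹ * Polynomial.aeval (relEnd (K.gram e x) (H.gram e x)) f * T := by
    have hs : SemiconjBy T (relEnd (K.gram e' x) (H.gram e' x)) (relEnd (K.gram e x) (H.gram e x)) :=
      h1
    have h3 : SemiconjBy T (Polynomial.aeval (relEnd (K.gram e' x) (H.gram e' x)) f)
        (Polynomial.aeval (relEnd (K.gram e x) (H.gram e x)) f) := by
      induction f using Polynomial.induction_on' with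
      | add p q hp hq =>
        rw [map_add, map_add]
        exact hp.add_right hq
      | monomial k a =>
        rw [Polynomial.aeval_monomial, Polynomial.aeval_monomial]
        exact SemiconjBy.mul_right (Algebra.commutes a T).symm (hs.pow_right k)
    rw [mul_assoc, ← h3.eq, Matrix.nonsing_inv_mul_cancel_left _ _ hT']
  rw [h2, Matrix.trace_mul_comm, ← mul_assoc, Matrix.mul_nonsing_inv _ hT', one_mul]

theorem traceSum_gram (K H : HermitianMetric n r E) {x : X} (hx : x ∈ e.baseSet)
    (hx' : x ∈ e'.baseSet) :
    (relEnd (K.gram e' x) (H.gram e' x)).trace + ((relEnd (K.gram e' x) (H.gram e' x))⁻¹).trace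
      = (relEnd (K.gram e x) (H.gram e x)).trace
        + ((relEnd (K.gram e x) (H.gram e x))⁻¹).trace := by
  obtain ⟨hT, h⟩ := relEnd_gram K H hx hx'
  set T := transitionMatrix e e' x
  have hT' := (Matrix.isUnit_iff_isUnit_det T).1 hT
  rw [h]
  congr 1
  · rw [Matrix.trace_mul_comm, ← mul_assoc, Matrix.mul_nonsing_inv _ hT', one_mul]
  · rw [Matrix.mul_inv_rev, Matrix.mul_inv_rev, Matrix.nonsing_inv_nonsing_inv _ hT',
      Matrix.trace_mul_comm, mul_assoc, Matrix.mul_nonsing_inv _ hT', mul_one]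

end Gram

end NHYM

namespace NHYM

open Filter Topology Polynomial

/-! ### Regularity of the logarithm of the trace sum. -/

section LocalLog

variable {n r : ℕ} {A : (Fin n → ℂ) → (Fin n → ℂ) → Matrix (Fin r) (Fin r) ℂ}
  {H K : (Fin n → ℂ) → Matrix (Fin r) (Fin r) ℂ} {y : Fin n → ℂ}

theorem SimDiag.trace_inv {K H P : Matrix (Fin r) (Fin r) ℂ} {l : Fin r → ℝ}
    (h : SimDiag K H P l) : ((NHYM.relEnd K H)⁻¹).trace.re = ∑ a, (l a)⁻¹ := by
  have e : (NHYM.relEnd K H)⁻¹ = P * realDiag (fun a => (l a)⁻¹) * P⁻¹ := by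
    rw [h.relEnd_eq]
    apply Matrix.inv_eq_right_inv
    have hd : realDiag l * realDiag (fun a => (l a)⁻¹) = 1 := by
      rw [realDiag, realDiag, Matrix.diagonal_mul_diagonal, ← Matrix.diagonal_one]
      congr 1
      funext a
      have : (l a : ℂ) ≠ 0 := by exact_mod_cast (h.pos a).ne'
      simp [this]
    calc _ = P * (realDiag l * ((P⁻¹ * P) * realDiag (fun a => (l a)⁻¹))) * P⁻¹ := by
          simp only [mul_assoc]
      _ = 1 := by rw [h.inv_mul, one_mul, hd, mul_one, h.mul_inv]
  rw [e, h.trace_conj, realDiag, Matrix.trace_diagonal, Complex.re_sum]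
  rfl

theorem SimDiag.traceSum_pos {K H P : Matrix (Fin r) (Fin r) ℂ} {l : Fin r → ℝ}
    (h : SimDiag K H P l) (hr : 0 < r) :
    0 < ((NHYM.relEnd K H).trace + ((NHYM.relEnd K H)⁻¹).trace).re := by
  have : Nonempty (Fin r) := ⟨⟨0, hr⟩⟩
  have h1 := h.trace_aeval (X : ℝ[X])
  rw [aeval_X] at h1
  rw [Complex.add_re, h1, h.trace_inv]
  have p1 : 0 < ∑ a, (X : ℝ[X]).eval (l a) :=
    Finset.sum_pos (fun a _ => by simpa using h.pos a) Finset.univ_nonempty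
  have p2 : 0 < ∑ a, (l a)⁻¹ :=
    Finset.sum_pos (fun a _ => inv_pos.2 (h.pos a)) Finset.univ_nonempty
  linarith

theorem contDiffAt_log_traceSum (hK : EntryC2 K y) (hH : EntryC2 H y) (hK' : (K y).PosDef)
    (hH' : (H y).PosDef) :
    ContDiffAt ℝ 2 (fun z => Real.log ((relEnd (K z) (H z)).trace
      + ((relEnd (K z) (H z))⁻¹).trace).re) y := by
  rcases Nat.eq_zero_or_pos r with rfl | hr
  · simpa [Matrix.trace] using contDiffAt_const
  obtain ⟨P, l, hd, -⟩ := exists_simDiag hK' hH'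
  have hh := hK.relEnd hH (isUnit_det_of_posDef hK')
  have hu : IsUnit (relEnd (K y) (H y)).det := by
    rw [relEnd, Matrix.det_mul]
    exact ((Matrix.isUnit_nonsing_inv_det_iff).2 (isUnit_det_of_posDef hK')).mul
      (isUnit_det_of_posDef hH')
  have h1 : ContDiffAt ℝ 2 (fun z => ((relEnd (K z) (H z)).trace
      + ((relEnd (K z) (H z))⁻¹).trace).re) y :=
    Complex.reCLM.contDiff.contDiffAt.comp y (hh.trace.add (hh.inv hu).trace)
  exact h1.log (hd.traceSum_pos hr).ne'

end LocalLog

/-! ### Transfer of the local inequality to the bundle. -/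

section Points

variable {n : ℕ} {X : Type*} [TopologicalSpace X] [ChartedSpace (Fin n → ℂ) X]
  [IsManifold 𝓘(ℂ, Fin n → ℂ) ω X]
  {r : ℕ} {E : X → Type*} [∀ x, AddCommGroup (E x)] [∀ x, Module ℂ (E x)]
  [TopologicalSpace (TotalSpace (Fin r → ℂ) E)] [∀ x, TopologicalSpace (E x)]
  [∀ x, IsTopologicalAddGroup (E x)] [∀ x, ContinuousSMul ℝ (E x)]
  [FiberBundle (Fin r → ℂ) E] [VectorBundle ℝ (Fin r → ℂ) E]

theorem Connection.form_realLinear (D : Connection n r E)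
    {φ : OpenPartialHomeomorph X (Fin n → ℂ)} {z : Fin n → ℂ}
    {e : Trivialization (Fin r → ℂ) (π (Fin r → ℂ) E)} [MemTrivializationAtlas e]
    (he : φ.symm z ∈ e.baseSet) : RealLinear (D.form φ e z) := by
  have hlin := e.linear ℝ he
  have hs : ∀ (c : ℝ) (u : Fin n → ℂ), chartVec φ z ((c : ℂ) • u) = c • chartVec φ z u := by
    intro c u
    rw [Complex.coe_smul]
    exact map_smul (mfderiv 𝓘(ℝ, Fin n → ℂ) 𝓘(ℝ, Fin n → ℂ) φ.symm z) c u
  have ha : ∀ u v : Fin n → ℂ, chartVec φ z (u + v) = chartVec φ z u + chartVec φ z v :=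
    fun u v => map_add (mfderiv 𝓘(ℝ, Fin n → ℂ) 𝓘(ℝ, Fin n → ℂ) φ.symm z) u v
  constructor
  · intro u v
    ext k i
    simp only [form, Matrix.of_apply, Matrix.add_apply]
    rw [ha, map_add]
    exact congrFun (hlin.map_add _ _) k
  · intro c u
    ext k i
    simp only [form, Matrix.of_apply, Matrix.smul_apply]
    rw [hs, map_smul, Complex.coe_smul]
    exact congrFun (hlin.map_smul c _) k

variable [VectorBundle ℂ (Fin r → ℂ) E]

omit [IsManifold 𝓘(ℂ, Fin n → ℂ) ω X] [∀ x, IsTopologicalAddGroup (E x)]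
  [∀ x, ContinuousSMul ℝ (E x)] [VectorBundle ℝ (Fin r → ℂ) E] in
theorem traceSum_eventuallyEq (H K : HermitianMetric n r E) (x : X) :
    (fun p => Real.log (traceSum K H p)) ∘ (chartAt (Fin n → ℂ) x).symm
      =ᶠ[𝓝 (chartAt (Fin n → ℂ) x x)] fun z =>
        Real.log ((relEnd (K.gram (trivializationAt (Fin r → ℂ) E x)
            ((chartAt (Fin n → ℂ) x).symm z)) (H.gram (trivializationAt (Fin r → ℂ) E x)
            ((chartAt (Fin n → ℂ) x).symm z))).trace
          + ((relEnd (K.gram (trivializationAt (Fin r → ℂ) E x)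
            ((chartAt (Fin n → ℂ) x).symm z)) (H.gram (trivializationAt (Fin r → ℂ) E x)
            ((chartAt (Fin n → ℂ) x).symm z)))⁻¹).trace).re := by
  set φ := chartAt (Fin n → ℂ) x
  set e := trivializationAt (Fin r → ℂ) E x
  have hx : φ.symm (φ x) ∈ e.baseSet := by
    rw [φ.left_inv (mem_chart_source _ x)]
    exact mem_baseSet_trivializationAt _ _ x
  filter_upwards [(φ.continuousAt_symm (mem_chart_target _ x)).eventually
    (e.open_baseSet.mem_nhds hx)] with z hz
  rw [Function.comp_apply, traceSum, HermitianMetric.gramAt, HermitianMetric.gramAt,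
    traceSum_gram K H hz (mem_baseSet_trivializationAt _ _ _)]

variable [ContMDiffVectorBundle ∞ (Fin r → ℂ) E 𝓘(ℝ, Fin n → ℂ)] [T2Space X]

theorem Connection.localPair (D : Connection n r E) (H K : HermitianMetric n r E) (x : X) :
    LocalPair (D.form (chartAt (Fin n → ℂ) x) (trivializationAt (Fin r → ℂ) E x))
      (fun z => K.gram (trivializationAt (Fin r → ℂ) E x) ((chartAt (Fin n → ℂ) x).symm z))
      (fun z => H.gram (trivializationAt (Fin r → ℂ) E x) ((chartAt (Fin n → ℂ) x).symm z))
      (chartAt (Fin n → ℂ) x x) := by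
  have hφ := chart_mem_atlas (Fin n → ℂ) x
  have hy := mem_chart_target (Fin n → ℂ) x
  have hx : (chartAt (Fin n → ℂ) x).symm (chartAt (Fin n → ℂ) x x)
      ∈ (trivializationAt (Fin r → ℂ) E x).baseSet := by
    rw [(chartAt (Fin n → ℂ) x).left_inv (mem_chart_source _ x)]
    exact mem_baseSet_trivializationAt _ _ x
  have hev := ((chartAt (Fin n → ℂ) x).continuousAt_symm hy).eventually
    ((trivializationAt (Fin r → ℂ) E x).open_baseSet.mem_nhds hx)
  exact ⟨fun v k i => (D.contDiffAt_form hφ hy hx v k i).differentiableAt (by simp),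
    hev.mono fun z hz => (D.form_realLinear hz).neg, K.entryC2_gram hφ hy hx,
    H.entryC2_gram hφ hy hx, hev.mono fun z hz => K.gram_posDef hz,
    hev.mono fun z hz => H.gram_posDef hz⟩

omit [VectorBundle ℂ (Fin r → ℂ) E] [ContMDiffVectorBundle ∞ (Fin r → ℂ) E 𝓘(ℝ, Fin n → ℂ)]
  [T2Space X] in
theorem Connection.eventually_form_realLinear (D : Connection n r E) (x : X) :
    ∀ᶠ z in 𝓝 (chartAt (Fin n → ℂ) x x),
      RealLinear (D.form (chartAt (Fin n → ℂ) x) (trivializationAt (Fin r → ℂ) E x) z) := by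
  have hx : (chartAt (Fin n → ℂ) x).symm (chartAt (Fin n → ℂ) x x)
      ∈ (trivializationAt (Fin r → ℂ) E x).baseSet := by
    rw [(chartAt (Fin n → ℂ) x).left_inv (mem_chart_source _ x)]
    exact mem_baseSet_trivializationAt _ _ x
  exact (((chartAt (Fin n → ℂ) x).continuousAt_symm (mem_chart_target _ x)).eventually
    ((trivializationAt (Fin r → ℂ) E x).open_baseSet.mem_nhds hx)).mono
    fun z hz => D.form_realLinear hz

variable (ω₀ : KahlerForm n X) {D : Connection n r E} {x : X} {b : Fin n → Fin n → ℂ}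

/-- The contraction of the bilinear form `G_H` may be evaluated in the adapted frame, which links
the global quantity to the local estimates. -/
theorem Connection.normLambdaG_eq (H : HermitianMetric n r E)
    (hb : ω₀.Adapted (chartAt (Fin n → ℂ) x) (chartAt (Fin n → ℂ) x x) b) :
    D.normLambdaG ω₀ H x = endNorm
      (H.gram (trivializationAt (Fin r → ℂ) E x)
        ((chartAt (Fin n → ℂ) x).symm (chartAt (Fin n → ℂ) x x)))
      (localLambdaG (D.form (chartAt (Fin n → ℂ) x) (trivializationAt (Fin r → ℂ) E x))
        (fun z => H.gram (trivializationAt (Fin r → ℂ) E x) ((chartAt (Fin n → ℂ) x).symm z))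
        (chartAt (Fin n → ℂ) x x) b) := by
  have hp := D.localPair H H x
  have hψ := fun v => EntryDiff.localPsi hp.form_diff hp.left
    (isUnit_det_of_posDef hp.left_pos.self_of_nhds) v
  have hbil := isRealBilin_dbarCurv (EntryDiff.localTheta hp.form_diff hψ)
    ((D.eventually_form_realLinear x).mono fun z hz => hz.localTheta hz.localPsi)
  have h1 : ω₀.iLambda (chartAt (Fin n → ℂ) x) (chartAt (Fin n → ℂ) x x) (D.pseudoCurvature H x)
      = localLambdaG (D.form (chartAt (Fin n → ℂ) x) (trivializationAt (Fin r → ℂ) E x))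
        (fun z => H.gram (trivializationAt (Fin r → ℂ) E x) ((chartAt (Fin n → ℂ) x).symm z))
        (chartAt (Fin n → ℂ) x x) b := hb.iLambda_eq hbil
  rw [normLambdaG, h1, HermitianMetric.gramAt, (chartAt (Fin n → ℂ) x).left_inv
    (mem_chart_source _ x)]

omit [VectorBundle ℂ (Fin r → ℂ) E] in
theorem Connection.IsNHYM.sum_diag11 (hD : D.IsNHYM ω₀) : ∃ c : ℝ, ∀ (x : X)
    (b : Fin n → Fin n → ℂ), ω₀.Adapted (chartAt (Fin n → ℂ) x) (chartAt (Fin n → ℂ) x x) b →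
    ∑ l, diag11 (curv (D.form (chartAt (Fin n → ℂ) x) (trivializationAt (Fin r → ℂ) E x))
      (chartAt (Fin n → ℂ) x x)) (b l) = (c : ℂ) • (1 : Matrix (Fin r) (Fin r) ℂ) := by
  obtain ⟨-, c, hc⟩ := hD
  refine ⟨c, fun x b hb => ?_⟩
  rw [← hc x]
  refine (hb.iLambda_eq (isRealBilin_curv (fun v k i => ?_)
    (D.eventually_form_realLinear x))).symm
  have hx : (chartAt (Fin n → ℂ) x).symm (chartAt (Fin n → ℂ) x x)
      ∈ (trivializationAt (Fin r → ℂ) E x).baseSet := by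
    rw [(chartAt (Fin n → ℂ) x).left_inv (mem_chart_source _ x)]
    exact mem_baseSet_trivializationAt _ _ x
  exact (D.contDiffAt_form (chart_mem_atlas _ x) (mem_chart_target _ x) hx v k i).differentiableAt
    (by simp)

theorem Connection.IsNHYM.laplacian_log_traceSum (hD : D.IsNHYM ω₀) (H K : HermitianMetric n r E)
    (x : X) : -4 * D.normLambdaG ω₀ H x - 4 * D.normLambdaG ω₀ K x
      ≤ ω₀.laplacian (fun p => Real.log (traceSum K H p)) x := by
  obtain ⟨c, hc⟩ := hD.sum_diag11
  obtain ⟨b, hb⟩ := ω₀.exists_adapted (chart_mem_atlas (Fin n → ℂ) x) (mem_chart_target _ x)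
  have hp := D.localPair H K x
  have h1 := hp.frameSum_hess_log_traceSum b (hc x b hb)
  have hev := traceSum_eventuallyEq H K x
  have hcd := (contDiffAt_log_traceSum hp.left hp.right hp.left_pos.self_of_nhds
    hp.right_pos.self_of_nhds).congr_of_eventuallyEq hev
  rw [ω₀.laplacian_eq_chartAt hcd hb, Connection.normLambdaG_eq ω₀ H hb,
    Connection.normLambdaG_eq ω₀ K hb]
  refine h1.trans_eq ?_
  congr 2
  exact funext fun v => (hess_congr hev v).symm

end Points

end NHYM

namespace NHYM

open Filter Topology Polynomial

/-! ### Polynomial approximation of `log²` together with its derivatives. -/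

section Approximation

theorem exists_derivative_eq (p : ℝ[X]) : ∃ q : ℝ[X], derivative q = p := by
  induction p using Polynomial.induction_on' with
  | add p p' hp hp' =>
    obtain ⟨q, hq⟩ := hp
    obtain ⟨q', hq'⟩ := hp'
    exact ⟨q + q', by rw [derivative_add, hq, hq']⟩
  | monomial k a =>
    refine ⟨monomial (k + 1) (a / (k + 1)), ?_⟩
    rw [derivative_monomial]
    have : ((k : ℝ) + 1) ≠ 0 := by positivity
    simp [this]

variable {m M : ℝ}

/-- Uniform approximation of the derivative gives uniform approximation of the function. -/
theorem exists_antiderivative_near (hm : 0 < m) (hm1 : m ≤ 1) (hM : 1 ≤ M) {G G' : ℝ → ℝ}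
    (hG : ∀ t ∈ Icc m M, HasDerivAt G (G' t) t) {p : ℝ[X]} {ε : ℝ} (hε : 0 ≤ ε)
    (hp : ∀ t ∈ Icc m M, |p.eval t - G' t| ≤ ε) :
    ∃ q : ℝ[X], derivative q = p ∧ ∀ t ∈ Icc m M, |q.eval t - G t| ≤ ε * M := by
  obtain ⟨q₀, hq₀⟩ := exists_derivative_eq p
  -- The constant of integration makes the error vanish at `1`; every `t` in the interval is within
  -- `M` of `1`, hence the factor `M`.
  refine ⟨q₀ + C (G 1 - q₀.eval 1), by simp [hq₀], fun t ht => ?_⟩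
  set q := q₀ + C (G 1 - q₀.eval 1) with hq
  have hqd : derivative q = p := by simp [hq, hq₀]
  have h1 : (1 : ℝ) ∈ Icc m M := ⟨hm1, hM⟩
  have h := Convex.norm_image_sub_le_of_norm_hasDerivWithin_le (f := fun t => q.eval t - G t)
    (f' := fun t => p.eval t - G' t) (s := Icc m M) (C := ε) (x := 1) (y := t)
    (fun x hx => by
      have := (q.hasDerivAt x).sub (hG x hx)
      rw [hqd] at this
      exact this.hasDerivWithinAt)
    (fun x hx => hp x hx) (convex_Icc m M) h1 ht
  have e1 : q.eval 1 - G 1 = 0 := by simp [hq]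
  rw [e1, sub_zero, Real.norm_eq_abs, Real.norm_eq_abs] at h
  refine h.trans (mul_le_mul_of_nonneg_left ?_ hε)
  rw [abs_le]
  constructor <;> linarith [ht.1, ht.2]

theorem hasDerivAt_log_sq {t : ℝ} (ht : t ≠ 0) :
    HasDerivAt (fun t => Real.log t ^ 2) (2 * Real.log t / t) t := by
  have h := (Real.hasDerivAt_log ht).pow 2
  have e : 2 * Real.log t / t = ((2 : ℕ) : ℝ) * Real.log t ^ (2 - 1) * t⁻¹ := by
    norm_num
    field_simp
  rw [e]
  exact h

theorem hasDerivAt_log_div {t : ℝ} (ht : t ≠ 0) :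
    HasDerivAt (fun t => 2 * Real.log t / t) ((2 - 2 * Real.log t) / t ^ 2) t := by
  have h := ((Real.hasDerivAt_log ht).const_mul 2).div (hasDerivAt_id t) ht
  have e : (2 - 2 * Real.log t) / t ^ 2
      = (2 * t⁻¹ * id t - 2 * Real.log t * 1) / id t ^ 2 := by
    simp only [id]
    field_simp
  rw [e]
  exact h

/-- The polynomial replacing `log²` on `[m, M]`, with the differential inequalities that make the
square root of its trace almost subharmonic. -/
structure IsLogSq (f : ℝ[X]) (m M η : ℝ) : Prop where
  pos : ∀ t ∈ Icc m M, 0 < f.eval t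
  lower : ∀ t ∈ Icc m M, Real.log t ^ 2 ≤ f.eval t
  upper : ∀ t ∈ Icc m M, f.eval t ≤ Real.log t ^ 2 + 2 * η
  deriv_nonneg : ∀ t ∈ Icc m M, 0 ≤ (derivative (derivative f * X)).eval t
  grad : ∀ t ∈ Icc m M, (derivative f * X).eval t ^ 2
    ≤ 2 * f.eval t * (t * (derivative (derivative f * X)).eval t)
  four : ∀ t ∈ Icc m M, (derivative f * X).eval t ^ 2 ≤ 4 * f.eval t

/-- For `log²` one has `g = 2 log` and `t g'(t) = 2`, so `g² ≤ 2 f t g'` and `g² ≤ 4 f` are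
equalities; adding `η` to `f` leaves room for errors. Weierstrass is applied to the second
derivative, and integrating twice controls `f`, `g` and `g'` at once. -/
theorem exists_isLogSq (hm : 0 < m) (hm1 : m ≤ 1) (hM : 1 ≤ M) {η : ℝ} (hη : 0 < η) :
    ∃ f : ℝ[X], IsLogSq f m M η := by
  obtain ⟨L, hL0, hL⟩ : ∃ L : ℝ, 0 ≤ L ∧ ∀ t ∈ Icc m M, |Real.log t| ≤ L := by
    have hc : ContinuousOn (fun t => |Real.log t|) (Icc m M) :=
      (Real.continuousOn_log.mono fun t ht => (hm.trans_le ht.1).ne').abs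
    obtain ⟨L, hL⟩ := isCompact_Icc.bddAbove_image hc
    exact ⟨max L 0, le_max_right _ _, fun t ht =>
      (hL (mem_image_of_mem _ ht)).trans (le_max_left _ _)⟩
  have hM0 : 0 < M := zero_lt_one.trans_le hM
  have hD : 0 < 4 * L + 6 + 2 * (L ^ 2 + η) := by positivity
  -- The tolerance is chosen so that all error terms in `grad` and `four` together are at most `η`;
  -- here `L` bounds `|log|` on the interval.
  set e := η / (4 * L + 6 + 2 * (L ^ 2 + η)) with he
  have he0 : 0 < e := by positivity
  have heD : e * (4 * L + 6 + 2 * (L ^ 2 + η)) = η := div_mul_cancel₀ _ hD.ne'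
  have he1 : e ≤ 1 := by
    rw [he, div_le_one hD]
    nlinarith [sq_nonneg L]
  have hcont : ContinuousOn (fun t => (2 - 2 * Real.log t) / t ^ 2) (Icc m M) := by
    have hne : ∀ t ∈ Icc m M, t ≠ 0 := fun t ht => (hm.trans_le ht.1).ne'
    exact (continuousOn_const.sub (continuousOn_const.mul (Real.continuousOn_log.mono hne))).div
      (continuousOn_id.pow 2) fun t ht => pow_ne_zero 2 (hne t ht)
  -- Each integration, and each multiplication by `t`, costs a factor `M`; two of them turn `ε` into
  -- `e / 2`.
  set ε := e / (2 * M ^ 2) with hε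
  have hε0 : 0 < ε := by positivity
  have hεM : ε * M * M = e / 2 := by rw [hε]; field_simp
  obtain ⟨p, hp⟩ := exists_polynomial_near_of_continuousOn m M _ hcont ε hε0
  obtain ⟨q, hqd, hq⟩ := exists_antiderivative_near hm hm1 hM
    (fun t ht => hasDerivAt_log_div (hm.trans_le ht.1).ne') hε0.le fun t ht => (hp t ht).le
  obtain ⟨f₀, hfd, hf⟩ := exists_antiderivative_near hm hm1 hM
    (fun t ht => hasDerivAt_log_sq (hm.trans_le ht.1).ne') (by positivity) hq
  have hder : derivative (f₀ + C η) = q := by simp [hfd]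
  have key : ∀ t ∈ Icc m M, |(f₀ + C η).eval t - (Real.log t ^ 2 + η)| ≤ e ∧
      |(derivative (f₀ + C η) * X).eval t - 2 * Real.log t| ≤ e ∧
      |t * (derivative (derivative (f₀ + C η) * X)).eval t - 2| ≤ e := by
    intro t ht
    have ht0 : 0 < t := hm.trans_le ht.1
    have h1 := hp t ht
    have h2 := hq t ht
    have h3 := hf t ht
    rw [hεM] at h3
    have h4 : |t * (q.eval t - 2 * Real.log t / t)| ≤ e / 2 := by
      rw [abs_mul, abs_of_pos ht0, ← hεM, mul_comm]
      exact mul_le_mul h2 ht.2 ht0.le (by positivity)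
    have h5 : |t ^ 2 * (p.eval t - (2 - 2 * Real.log t) / t ^ 2)| ≤ e / 2 := by
      rw [abs_mul, abs_of_pos (by positivity), ← hεM, mul_comm, mul_assoc, ← sq]
      exact mul_le_mul h1.le (pow_le_pow_left₀ ht0.le ht.2 2) (by positivity) hε0.le
    rw [hder]
    refine ⟨?_, ?_, ?_⟩
    · simp only [eval_add, eval_C]
      rw [add_sub_add_right_eq_sub]
      linarith
    · rw [eval_mul, eval_X]
      have : q.eval t * t - 2 * Real.log t = t * (q.eval t - 2 * Real.log t / t) := by
        field_simp
      rw [this]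
      linarith
    · rw [derivative_mul, hqd, derivative_X, mul_one, eval_add, eval_mul, eval_X]
      have : t * (p.eval t * t + q.eval t) - 2 = t ^ 2 * (p.eval t - (2 - 2 * Real.log t) / t ^ 2)
          + t * (q.eval t - 2 * Real.log t / t) := by
        field_simp
        ring
      rw [this]
      exact (abs_add_le _ _).trans (by linarith)
  have hsmall : e * (4 * L) + 6 * e + 2 * e * (L ^ 2 + η) = η := by
    linarith [heD]
  have hmisc : 0 ≤ 2 * e * (L ^ 2 + η) := by positivity
  have hmisc' : 0 ≤ e * (4 * L) := by positivity
  have hgsq : ∀ t ∈ Icc m M, (derivative (f₀ + C η) * X).eval t ^ 2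
      ≤ 4 * Real.log t ^ 2 + e * (4 * L) + e := by
    intro t ht
    obtain ⟨-, k2, -⟩ := key t ht
    set g := (derivative (f₀ + C η) * X).eval t
    have hl := hL t ht
    have h1 : g ^ 2 = 4 * Real.log t ^ 2 + 4 * (Real.log t * (g - 2 * Real.log t))
        + (g - 2 * Real.log t) ^ 2 := by ring
    have h2 : Real.log t * (g - 2 * Real.log t) ≤ L * e := by
      refine (le_abs_self _).trans ?_
      rw [abs_mul]
      exact mul_le_mul hl k2 (abs_nonneg _) hL0
    have h3 : (g - 2 * Real.log t) ^ 2 ≤ e := by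
      rw [← sq_abs]
      calc |g - 2 * Real.log t| ^ 2 ≤ e ^ 2 := pow_le_pow_left₀ (abs_nonneg _) k2 2
        _ = e * e := sq e
        _ ≤ e * 1 := by gcongr
        _ = e := mul_one e
    linarith
  refine ⟨f₀ + C η, ?_, ?_, ?_, ?_, ?_, ?_⟩
  · intro t ht
    have := (abs_le.1 (key t ht).1).1
    have := sq_nonneg (Real.log t)
    linarith
  · intro t ht
    have := (abs_le.1 (key t ht).1).1
    linarith
  · intro t ht
    have := (abs_le.1 (key t ht).1).2
    linarith
  · intro t ht
    have h1 := (abs_le.1 (key t ht).2.2).1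
    exact (pos_of_mul_pos_right (by linarith : 0 < t * _) (hm.trans_le ht.1).le).le
  · intro t ht
    have h1 := (abs_le.1 (key t ht).2.2).1
    have h2 := (abs_le.1 (key t ht).1).1
    have h3 := hgsq t ht
    have h4 : Real.log t ^ 2 ≤ L ^ 2 := sq_le_sq' (neg_le_of_abs_le (hL t ht)) (le_of_abs_le (hL t ht))
    set F := (f₀ + C η).eval t
    set T := t * (derivative (derivative (f₀ + C η) * X)).eval t
    have hF : Real.log t ^ 2 + η - e ≤ F := by linarith
    have hT : 2 - e ≤ T := by linarith
    have hlow : 0 ≤ Real.log t ^ 2 + η - e := by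
      have := sq_nonneg (Real.log t)
      linarith
    have h5 : (Real.log t ^ 2 + η - e) * (2 - e) ≤ F * T :=
      mul_le_mul hF hT (by linarith) (hlow.trans hF)
    have h6 : e * Real.log t ^ 2 ≤ e * L ^ 2 := by gcongr
    nlinarith [sq_nonneg e]
  · intro t ht
    have h2 := (abs_le.1 (key t ht).1).1
    have h3 := hgsq t ht
    linarith

theorem IsLogSq.mono {f : ℝ[X]} {η : ℝ} (h : IsLogSq f m M η) {a b : ℝ} (ha : a ∈ Icc m M)
    (hb : b ∈ Icc m M) :
    0 ≤ ((derivative f * X).eval a - (derivative f * X).eval b) * (a - b) := by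
  have hmon : MonotoneOn (fun t => (derivative f * X).eval t) (Icc m M) := by
    refine monotoneOn_of_deriv_nonneg (convex_Icc m M) (Polynomial.continuous _).continuousOn
      (Polynomial.differentiable _).differentiableOn fun t ht => ?_
    rw [Polynomial.deriv]
    exact h.deriv_nonneg t (interior_subset ht)
  rcases le_total a b with hab | hab
  · exact mul_nonneg_of_nonpos_of_nonpos (sub_nonpos.2 (hmon ha hb hab)) (sub_nonpos.2 hab)
  · exact mul_nonneg (sub_nonneg.2 (hmon hb ha hab)) (sub_nonneg.2 hab)

end Approximation

end NHYM

namespace NHYM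

open Filter Topology Polynomial

/-! ### Approximation of `|log h|` and its supremum bound. -/

section LogNorm

variable {n : ℕ} {X : Type*} [TopologicalSpace X] [ChartedSpace (Fin n → ℂ) X]
  [IsManifold 𝓘(ℂ, Fin n → ℂ) ω X]
  {r : ℕ} {E : X → Type*} [∀ x, AddCommGroup (E x)] [∀ x, Module ℂ (E x)]
  [TopologicalSpace (TotalSpace (Fin r → ℂ) E)] [∀ x, TopologicalSpace (E x)]
  [FiberBundle (Fin r → ℂ) E] [VectorBundle ℂ (Fin r → ℂ) E]

/-- The function `tr f(h)` for `h = K⁻¹ H`. -/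
noncomputable def traceAeval (f : ℝ[X]) (K H : HermitianMetric n r E) (x : X) : ℝ :=
  (aeval (relEnd (K.gramAt x) (H.gramAt x)) f).trace.re

omit [IsManifold 𝓘(ℂ, Fin n → ℂ) ω X] in
theorem traceAeval_eventuallyEq (f : ℝ[X]) (K H : HermitianMetric n r E)
    {φ : OpenPartialHomeomorph X (Fin n → ℂ)} {y : Fin n → ℂ} (hy : y ∈ φ.target)
    {e : Trivialization (Fin r → ℂ) (π (Fin r → ℂ) E)} [MemTrivializationAtlas e]
    (he : φ.symm y ∈ e.baseSet) :
    traceAeval f K H ∘ φ.symm =ᶠ[𝓝 y] fun z =>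
      (aeval (relEnd (K.gram e (φ.symm z)) (H.gram e (φ.symm z))) f).trace.re := by
  filter_upwards [(φ.continuousAt_symm hy).eventually (e.open_baseSet.mem_nhds he)] with z hz
  rw [Function.comp_apply, traceAeval, HermitianMetric.gramAt, HermitianMetric.gramAt,
    trace_aeval_relEnd_gram K H hz (mem_baseSet_trivializationAt _ _ _)]

theorem isC2_traceAeval (f : ℝ[X]) (K H : HermitianMetric n r E) : IsC2 n (traceAeval f K H) := by
  intro φ hφ y hy
  have he := mem_baseSet_trivializationAt (Fin r → ℂ) E (φ.symm y)
  refine ContDiffAt.congr_of_eventuallyEq ?_ (traceAeval_eventuallyEq f K H hy he)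
  exact Complex.reCLM.contDiff.contDiffAt.comp y
    (((K.entryC2_gram hφ hy he).relEnd (H.entryC2_gram hφ hy he)
      (isUnit_det_of_posDef (K.gram_posDef he))).aeval f).trace

omit [IsManifold 𝓘(ℂ, Fin n → ℂ) ω X] in
theorem gramAt_posDef (H : HermitianMetric n r E) (x : X) : (H.gramAt x).PosDef :=
  H.gram_posDef (mem_baseSet_trivializationAt _ _ x)

/-- On a compact manifold the eigenvalues of `K⁻¹ H` lie in a compact interval. -/
theorem exists_eigenvalue_bound [CompactSpace X] (K H : HermitianMetric n r E) :
    ∃ N : ℝ, 1 ≤ N ∧ ∀ x P l, SimDiag (K.gramAt x) (H.gramAt x) P l → ∀ a, l a ∈ Icc N⁻¹ N := by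
  obtain ⟨N₁, h1⟩ := isCompact_univ.bddAbove_image
    (isC2_traceAeval (Polynomial.X : ℝ[X]) K H).continuous.continuousOn
  obtain ⟨N₂, h2⟩ := isCompact_univ.bddAbove_image
    (isC2_traceAeval (Polynomial.X : ℝ[X]) H K).continuous.continuousOn
  refine ⟨max 1 (max N₁ N₂), le_max_left _ _, fun x P l hd a => ?_⟩
  have hN0 : 0 < max 1 (max N₁ N₂) := zero_lt_one.trans_le (le_max_left _ _)
  have e1 := h1 (mem_image_of_mem _ (mem_univ x))
  have e2 := h2 (mem_image_of_mem _ (mem_univ x))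
  rw [traceAeval, hd.trace_aeval] at e1
  rw [traceAeval, aeval_X, ← hd.relEnd_inv, hd.trace_inv] at e2
  simp only [eval_X] at e1
  -- A positive eigenvalue is at most the trace. The trace of `h` bounds it above, that of `h⁻¹`
  -- below.
  have s1 := Finset.single_le_sum (f := l) (fun b _ => (hd.pos b).le) (Finset.mem_univ a)
  have s2 := Finset.single_le_sum (f := fun b => (l b)⁻¹) (fun b _ => (inv_pos.2 (hd.pos b)).le)
    (Finset.mem_univ a)
  constructor
  · rw [inv_le_comm₀ hN0 (hd.pos a)]
    exact (s2.trans e2).trans ((le_max_right _ _).trans (le_max_right _ _))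
  · exact (s1.trans e1).trans ((le_max_left _ _).trans (le_max_right _ _))

omit [IsManifold 𝓘(ℂ, Fin n → ℂ) ω X] [VectorBundle ℂ (Fin r → ℂ) E] in
theorem logNorm_eq {K H : HermitianMetric n r E} {x : X} {P : Matrix (Fin r) (Fin r) ℂ}
    {l : Fin r → ℝ} (hd : SimDiag (K.gramAt x) (H.gramAt x) P l)
    (hl : logRelEnd (K.gramAt x) (H.gramAt x) = P * realDiag (fun a => Real.log (l a)) * P⁻¹) :
    logNorm K H x = Real.sqrt (∑ a, Real.log (l a) ^ 2) := by
  rw [logNorm, hl, hd.endNorm_left]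
  congr 1
  refine Finset.sum_congr rfl fun a _ => ?_
  rw [Finset.sum_eq_single a]
  · simp [realDiag, sq]
  · intro b _ hb
    simp [realDiag, Matrix.diagonal_apply_ne' _ hb]
  · simp

theorem abs_sqrt_sub_le {a b c : ℝ} (ha : 0 ≤ a) (hab : a ≤ b) (hc : 0 ≤ c) (hbc : b ≤ a + c ^ 2) :
    |Real.sqrt b - Real.sqrt a| ≤ c := by
  have h1 := Real.sqrt_le_sqrt hab
  have h2 : Real.sqrt b ≤ Real.sqrt a + c := by
    rw [Real.sqrt_le_left (by positivity)]
    nlinarith [Real.sq_sqrt ha, Real.sqrt_nonneg a]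
  rw [abs_of_nonneg (by linarith)]
  linarith

variable [∀ x, IsTopologicalAddGroup (E x)] [∀ x, ContinuousSMul ℝ (E x)]
  [VectorBundle ℝ (Fin r → ℂ) E] [ContMDiffVectorBundle ∞ (Fin r → ℂ) E 𝓘(ℝ, Fin n → ℂ)]

/-- `|log h|_K` is a uniform limit of `C²` functions whose Laplacian is bounded below. -/
theorem Connection.IsNHYM.exists_approx_logNorm [CompactSpace X] [T2Space X] {ω₀ : KahlerForm n X}
    {D : Connection n r E} (hD : D.IsNHYM ω₀) (H K : HermitianMetric n r E) {ε : ℝ} (hε : 0 < ε) :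
    ∃ u : X → ℝ, IsC2 n u ∧ (∀ x, 0 ≤ u x) ∧ (∀ x, |u x - logNorm K H x| ≤ ε) ∧
      ∀ x, -4 * D.normLambdaG ω₀ H x - 4 * D.normLambdaG ω₀ K x ≤ ω₀.laplacian u x := by
  obtain ⟨N, hN1, hN⟩ := exists_eigenvalue_bound K H
  have hN0 : 0 < N := zero_lt_one.trans_le hN1
  -- This `η` makes the total error `2 r η` under the square root at most `ε²`, so the square roots
  -- differ by at most `ε`; `r + 1` avoids division by zero.
  obtain ⟨f, hf⟩ := exists_isLogSq (m := N⁻¹) (M := N) (η := ε ^ 2 / (2 * (r + 1)))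
    (inv_pos.2 hN0) (inv_le_one_of_one_le₀ hN1) hN1 (by positivity)
  have hC2 : IsC2 n fun x => Real.sqrt (traceAeval f K H x) := by
    rcases Nat.eq_zero_or_pos r with rfl | hr
    · intro φ _ y _
      have : (fun x => Real.sqrt (traceAeval f K H x)) ∘ φ.symm = fun _ => 0 := by
        funext z
        simp [traceAeval, Matrix.trace]
      rw [this]
      exact contDiffAt_const
    · intro φ hφ y hy
      refine ContDiffAt.sqrt (isC2_traceAeval f K H φ hφ y hy) (ne_of_gt ?_)
      obtain ⟨P, l, hd, -⟩ := exists_simDiag (gramAt_posDef K (φ.symm y)) (gramAt_posDef H (φ.symm y))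
      have : Nonempty (Fin r) := ⟨⟨0, hr⟩⟩
      rw [traceAeval, hd.trace_aeval]
      exact Finset.sum_pos (fun a _ => hf.pos _ (hN _ _ _ hd a)) Finset.univ_nonempty
  refine ⟨fun x => Real.sqrt (traceAeval f K H x), hC2, fun x => Real.sqrt_nonneg _, fun x => ?_,
    fun x => ?_⟩
  · obtain ⟨P, l, hd, hl⟩ := exists_simDiag (gramAt_posDef K x) (gramAt_posDef H x)
    have ht : traceAeval f K H x = ∑ a, f.eval (l a) := hd.trace_aeval f
    rw [logNorm_eq hd hl]
    change |Real.sqrt (traceAeval f K H x) - _| ≤ ε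
    rw [ht]
    refine abs_sqrt_sub_le (Finset.sum_nonneg fun a _ => sq_nonneg _)
      (Finset.sum_le_sum fun a _ => hf.lower _ (hN _ _ _ hd a)) hε.le ?_
    refine (Finset.sum_le_sum fun a _ => hf.upper _ (hN _ _ _ hd a)).trans ?_
    rw [Finset.sum_add_distrib]
    gcongr
    rw [Finset.sum_const, Finset.card_univ, Fintype.card_fin, nsmul_eq_mul]
    have : (r : ℝ) * (2 * (ε ^ 2 / (2 * (r + 1)))) = ε ^ 2 * (r / (r + 1)) := by
      field_simp
    rw [this]
    refine mul_le_of_le_one_right (sq_nonneg ε) ?_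
    rw [div_le_one (by positivity)]
    linarith
  · obtain ⟨c, hc⟩ := hD.sum_diag11
    obtain ⟨b, hb⟩ := ω₀.exists_adapted (chart_mem_atlas (Fin n → ℂ) x) (mem_chart_target _ x)
    have hp := D.localPair H K x
    have hx := (chartAt (Fin n → ℂ) x).left_inv (mem_chart_source _ x)
    have he : (chartAt (Fin n → ℂ) x).symm (chartAt (Fin n → ℂ) x x)
        ∈ (trivializationAt (Fin r → ℂ) E x).baseSet := by
      rw [hx]
      exact mem_baseSet_trivializationAt _ _ x
    obtain ⟨P, l, hd, -⟩ := exists_simDiag (gramAt_posDef K x) (gramAt_posDef H x)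
    have hl := hN x P l hd
    have hd' : SimDiag (K.gram (trivializationAt (Fin r → ℂ) E x)
          ((chartAt (Fin n → ℂ) x).symm (chartAt (Fin n → ℂ) x x)))
        (H.gram (trivializationAt (Fin r → ℂ) E x)
          ((chartAt (Fin n → ℂ) x).symm (chartAt (Fin n → ℂ) x x))) P l := by
      rw [hx]
      exact hd
    have h1 := hp.frameSum_hess_sqrt b (hc x b hb) f hd' (fun a => hf.pos _ (hl a))
      (fun a a' => hf.mono (hl a) (hl a')) (fun a => hf.deriv_nonneg _ (hl a))
      (fun a => hf.grad _ (hl a)) (fun a => hf.four _ (hl a))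
    have hev := (traceAeval_eventuallyEq f K H (mem_chart_target (Fin n → ℂ) x) he).fun_comp
      Real.sqrt
    rw [ω₀.laplacian_eq_chartAt (hC2 _ (chart_mem_atlas _ x) _ (mem_chart_target _ x)) hb,
      Connection.normLambdaG_eq ω₀ H hb, Connection.normLambdaG_eq ω₀ K hb]
    refine h1.trans_eq ?_
    congr 2
    exact funext fun v => (hess_congr hev v).symm

/-- As a uniform limit of continuous functions. Continuity makes `|log h|` integrable, so the
integral in the bound is a genuine one. -/
theorem Connection.IsNHYM.continuous_logNorm [CompactSpace X] [T2Space X] {ω₀ : KahlerForm n X}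
    {D : Connection n r E} (hD : D.IsNHYM ω₀) (H K : HermitianMetric n r E) :
    Continuous (logNorm K H) := by
  refine continuous_of_uniform_approx_of_continuous fun U hU => ?_
  obtain ⟨ε, hε, hεU⟩ := Metric.mem_uniformity_dist.1 hU
  obtain ⟨u, hu, -, h, -⟩ := hD.exists_approx_logNorm H K (half_pos hε)
  refine ⟨u, hu.continuous, fun x => hεU ?_⟩
  rw [dist_comm, Real.dist_eq]
  exact (h x).trans_lt (half_lt_self hε)

/-- The mean value inequality is applied to an approximant within distance `1`. Comparing the
integrals costs `C` times the volume; the `2` is the `1` of that inequality plus the distance. -/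
theorem Connection.IsNHYM.logNorm_le [CompactSpace X] [T2Space X] [MeasurableSpace X]
    [BorelSpace X] {ω₀ : KahlerForm n X} {D : Connection n r E} (hD : D.IsNHYM ω₀)
    {H K : HermitianMetric n r E} {β C : ℝ} (hC : 0 ≤ C)
    (hmean : ∀ f : X → ℝ, IsC2 n f → (∀ p, 0 ≤ f p) → (∀ p, -β ≤ ω₀.laplacian f p) →
      ∀ p, f p ≤ C * ∫ q, f q ∂ω₀.volumeMeasure + 1)
    (hβ : ∀ x, 4 * D.normLambdaG ω₀ H x + 4 * D.normLambdaG ω₀ K x ≤ β) (x : X) :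
    logNorm K H x ≤ C * ∫ p, logNorm K H p ∂ω₀.volumeMeasure
      + (C * ω₀.volumeMeasure.real univ + 2) := by
  obtain ⟨u, hu, hu0, h, hl⟩ := hD.exists_approx_logNorm H K one_pos
  have h1 := hmean u hu hu0 (fun p => (by linarith [hβ p, hl p])) x
  have hcompact : ∀ {f : X → ℝ}, Continuous f → Integrable f ω₀.volumeMeasure := fun hf =>
    hf.integrable_of_hasCompactSupport (HasCompactSupport.of_compactSpace _)
  have hint := hcompact (hD.continuous_logNorm H K)
  have h2 : ∫ p, u p ∂ω₀.volumeMeasure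
      ≤ ∫ p, logNorm K H p ∂ω₀.volumeMeasure + ω₀.volumeMeasure.real univ := by
    have h3 : ∫ p, u p ∂ω₀.volumeMeasure ≤ ∫ p, (logNorm K H p + 1) ∂ω₀.volumeMeasure :=
      integral_mono (hcompact hu.continuous) (hint.add (integrable_const 1)) fun p => by
        have := (abs_le.1 (h p)).2
        simp only
        linarith
    rw [integral_add hint (integrable_const 1), integral_const, smul_eq_mul, mul_one] at h3
    exact h3
  have h4 := (abs_le.1 (h x)).1
  have h5 := mul_le_mul_of_nonneg_left h2 hC
  linarith

end LogNorm

end NHYM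

/-! ### The global statement. -/

theorem proposition4p6 {n : ℕ} {X : Type*} [TopologicalSpace X] [ChartedSpace (Fin n → ℂ) X]
    [IsManifold 𝓘(ℂ, Fin n → ℂ) ω X] [CompactSpace X] [T2Space X] [MeasurableSpace X]
    [BorelSpace X] (ω₀ : KahlerForm n X) :
    (∀ (r : ℕ) (E : X → Type*) [∀ x, AddCommGroup (E x)] [∀ x, Module ℂ (E x)]
      [TopologicalSpace (TotalSpace (Fin r → ℂ) E)] [∀ x, TopologicalSpace (E x)]
      [∀ x, IsTopologicalAddGroup (E x)] [∀ x, ContinuousSMul ℝ (E x)]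
      [FiberBundle (Fin r → ℂ) E] [VectorBundle ℝ (Fin r → ℂ) E] [VectorBundle ℂ (Fin r → ℂ) E]
      [ContMDiffVectorBundle ∞ (Fin r → ℂ) E 𝓘(ℝ, Fin n → ℂ)]
      (D : Connection n r E), D.IsNHYM ω₀ →
      ∀ (H K : HermitianMetric n r E) (x : X),
        ω₀.laplacian (fun p => Real.log (traceSum K H p)) x
          ≥ -4 * D.normLambdaG ω₀ H x - 4 * D.normLambdaG ω₀ K x) ∧
    ∀ bH bK : ℝ, ∃ C₁ C₂ : ℝ, 0 < C₁ ∧ 0 < C₂ ∧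
      ∀ (r : ℕ) (E : X → Type*) [∀ x, AddCommGroup (E x)] [∀ x, Module ℂ (E x)]
        [TopologicalSpace (TotalSpace (Fin r → ℂ) E)] [∀ x, TopologicalSpace (E x)]
        [∀ x, IsTopologicalAddGroup (E x)] [∀ x, ContinuousSMul ℝ (E x)]
        [FiberBundle (Fin r → ℂ) E] [VectorBundle ℝ (Fin r → ℂ) E] [VectorBundle ℂ (Fin r → ℂ) E]
        [ContMDiffVectorBundle ∞ (Fin r → ℂ) E 𝓘(ℝ, Fin n → ℂ)]
        (D : Connection n r E), D.IsNHYM ω₀ →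
        ∀ H K : HermitianMetric n r E,
          (∀ x, D.normLambdaG ω₀ H x ≤ bH) → (∀ x, D.normLambdaG ω₀ K x ≤ bK) →
          ∀ x, logNorm K H x ≤ C₁ * ∫ p, logNorm K H p ∂ω₀.volumeMeasure + C₂ := by
  refine ⟨fun r E _ _ _ _ _ _ _ _ _ _ D hD H K x => hD.laplacian_log_traceSum ω₀ H K x,
    fun bH bK => ?_⟩
  -- The mean value inequality needs a nonnegative constant, hence the positive parts of the two
  -- bounds. The constant is fixed before the rank and the bundle are introduced.
  obtain ⟨C, hC, hmean⟩ := ω₀.le_integral (β := 4 * max bH 0 + 4 * max bK 0) (by positivity)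
  refine ⟨C, C * ω₀.volumeMeasure.real univ + 2, hC, by positivity, ?_⟩
  intro r E _ _ _ _ _ _ _ _ _ _ D hD H K hH hK x
  refine hD.logNorm_le hC.le hmean (fun p => ?_) x
  have h1 := (hH p).trans (le_max_left bH 0)
  have h2 := (hK p).trans (le_max_left bK 0)
  linarith
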